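/- There is an absolute constant $c>0$ with the following property. Let $\mathcal N$ be a semifinite von Neumann algebra with a normal semifinite faithful trace $\tau$, and let $\mathcal T=(T_t)_{t\ge 0}$ be a standard semigroup on $\mathcal N$: $T_0=\mathrm{id}$, $T_{s+t}=T_sT_t$, every $T_t$ is a normal completely positive map on $\mathcal N$ with $T_t(1)=1$, $\tau(T_t(f)g)=\tau(fT_t(g))$, and $T_tf\to f$ in the strong operator topology as $t\to0$ for every $f\in\mathcal N$. Let $\mathcal P=(P_t)_{t>0}$ be the subordinated Poisson semigroup $$P_t=\frac1{2\sqrt\pi}\int_0^\infty t\,e^{-t^2/(4u)}\,u^{-3/2}\,T_u\,du ,$$ and write $P_s'f=\frac{\partial}{\partial s}P_sf$ and $|x|^2=x^*x$; $T_t$ and $P_t$ are extended to $L_1(\mathcal N)$ and $L_2(\mathcal N)$ by continuity. For $f\in\mathcal N\cup L_2(\mathcal N)$ put $$\|f\|_{BMO^c(\mathcal T)}=\sup_{t>0}\big\|T_t|f-T_tf|^2\big\|^{1/2},\qquad \|f\|_{BMO^c(\mathcal P)}=\sup_{t>0}\big\|P_t|f-P_tf|^2\big\|^{1/2},$$ $$\|f\|_{BMO^c(\partial)}=\sup_{t>0}\Big\|P_t\int_0^t|P_s'f|^2\,s\,ds\Big\|^{1/2},$$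 where $\|\cdot\|$ is the operator norm, with value $\infty$ for an element that is not bounded. Then for every $f\in\mathcal N\cup L_2(\mathcal N)$ $$\|f\|_{BMO^c(\partial)}\le c\,\|f\|_{BMO^c(\mathcal P)}\qquad\text{and}\qquad \|f\|_{BMO^c(\mathcal P)}\le c\,\|f\|_{BMO^c(\mathcal T)} .$$ -/

import Mathlib

open scoped ENNReal NNReal InnerProductSpace ComplexOrder Topology
open MeasureTheory Set Filter

noncomputable section

namespace SemigroupBMO

universe u

variable {H : Type u} [NormedAddCommGroup H] [InnerProductSpace ℂ H] [CompleteSpace H]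

/-- Von Neumann algebras are closed under complex scalars; this makes `N` a normed space. -/
instance instSMulMem : SMulMemClass (VonNeumannAlgebra H) ℂ (H →L[ℂ] H) where
  smul_mem {N} c _ hx := N.toStarSubalgebra.smul_mem hx c

/-! ### Traces -/

/-- A normal semifinite faithful trace on `N`, as a map from the positive cone to `[0, ∞]`
(the values of `toFun` off the positive cone are irrelevant). -/
structure NSFTrace (N : VonNeumannAlgebra H) where
  toFun : N → ℝ≥0∞
  map_add : ∀ x y : N, 0 ≤ x → 0 ≤ y → toFun (x + y) = toFun x + toFun y
  map_smul : ∀ (c : ℝ≥0) (x : N), 0 ≤ x → toFun (((c : ℝ) : ℂ) • x) = c * toFun x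
  tracial : ∀ x : N, toFun (star x * x) = toFun (x * star x)
  normal : ∀ (D : Set N) (x : N), D.Nonempty → (∀ y ∈ D, 0 ≤ y) → DirectedOn (· ≤ ·) D →
    IsLUB D x → toFun x = ⨆ y ∈ D, toFun y
  faithful : ∀ x : N, 0 ≤ x → toFun x = 0 → x = 0
  semifinite : ∀ x : N, 0 ≤ x → x ≠ 0 → ∃ y : N, 0 ≤ y ∧ y ≤ x ∧ y ≠ 0 ∧ toFun y < ∞

variable {N : VonNeumannAlgebra H}

theorem star_mul_self_nonneg' (x : N) : 0 ≤ star x * x :=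
  star_mul_self_nonneg (x : H →L[ℂ] H)

theorem mul_star_self_nonneg' (x : N) : 0 ≤ x * star x :=
  mul_star_self_nonneg (x : H →L[ℂ] H)

theorem smul_nonneg' (c : ℝ≥0) {x : N} (hx : 0 ≤ x) : 0 ≤ ((c : ℝ) : ℂ) • x := by
  have h : (0 : H →L[ℂ] H) ≤ ((c : ℝ) : ℂ) • (x : H →L[ℂ] H) := by
    have h1 : (0 : H →L[ℂ] H) ≤ x := hx
    rw [ContinuousLinearMap.nonneg_iff_isPositive] at h1 ⊢
    exact h1.smul_of_nonneg (by exact_mod_cast c.2)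
  exact h

theorem NSFTrace.mono (τ : NSFTrace N) {x y : N} (hx : 0 ≤ x) (hxy : x ≤ y) :
    τ.toFun x ≤ τ.toFun y := by
  have := τ.map_add x (y - x) hx (sub_nonneg.2 hxy)
  rw [add_sub_cancel] at this
  rw [this]; exact le_self_add

theorem NSFTrace.map_zero (τ : NSFTrace N) : τ.toFun 0 = 0 := by
  simpa using τ.map_smul 0 (0 : N) le_rfl

theorem NSFTrace.sq_smul (τ : NSFTrace N) (c : ℂ) (x : N) :
    τ.toFun (star (c • x) * (c • x)) = (‖c‖₊ ^ 2 : ℝ≥0) * τ.toFun (star x * x) := by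
  rw [← τ.map_smul _ _ (star_mul_self_nonneg' x)]
  congr 1
  rw [star_smul, smul_mul_smul_comm]
  congr 1
  simpa using RCLike.conj_mul c

theorem NSFTrace.sq_add_le (τ : NSFTrace N) (x y : N) {s : ℝ≥0} (hs : 0 < s) :
    τ.toFun (star (x + y) * (x + y)) ≤
      (1 + s ^ 2 : ℝ≥0) * τ.toFun (star x * x) +
        (1 + (s⁻¹) ^ 2 : ℝ≥0) * τ.toFun (star y * y) := by
  have hx := star_mul_self_nonneg' x
  have hy := star_mul_self_nonneg' y
  rw [← τ.map_smul _ _ hx, ← τ.map_smul _ _ hy,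
    ← τ.map_add _ _ (smul_nonneg' _ hx) (smul_nonneg' _ hy)]
  refine τ.mono (star_mul_self_nonneg' _) ?_
  rw [← sub_nonneg]
  have key := star_mul_self_nonneg' (((s : ℝ) : ℂ) • x - (((s⁻¹ : ℝ≥0) : ℝ) : ℂ) • y)
  have hs' : ((s : ℝ) : ℂ) ≠ 0 := by exact_mod_cast hs.ne'
  convert key using 1
  simp only [star_add, star_sub, star_smul, add_mul, mul_add, sub_mul, mul_sub,
    smul_mul_smul_comm, RCLike.star_def, Complex.conj_ofReal]
  push_cast
  rw [mul_inv_cancel₀ hs', inv_mul_cancel₀ hs']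
  module

/-! ### The space `L₂` -/

/-- The left ideal of all `x ∈ N` with `τ(x* x) < ∞`, that is, `N ∩ L₂`. -/
def squareIntegrable (τ : NSFTrace N) : Submodule ℂ N where
  carrier := {x | τ.toFun (star x * x) < ∞}
  zero_mem' := by simp [τ.map_zero]
  add_mem' := by
    intro x y hx hy
    refine (τ.sq_add_le x y one_pos).trans_lt ?_
    exact ENNReal.add_lt_top.2 ⟨ENNReal.mul_lt_top ENNReal.coe_lt_top hx,
      ENNReal.mul_lt_top ENNReal.coe_lt_top hy⟩
  smul_mem' := by
    intro c x hx
    change τ.toFun (star (c • x) * (c • x)) < ∞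
    rw [τ.sq_smul]
    exact ENNReal.mul_lt_top ENNReal.coe_lt_top hx

/-- `N ∩ L₂` as a type of its own, so that it can carry the norm `‖x‖₂ = τ(|x|²)^{1/2}`
instead of the operator norm. -/
def L2Pre (τ : NSFTrace N) : Type u := squareIntegrable τ

instance (τ : NSFTrace N) : AddCommGroup (L2Pre τ) :=
  inferInstanceAs (AddCommGroup (squareIntegrable τ))

instance (τ : NSFTrace N) : Module ℂ (L2Pre τ) :=
  inferInstanceAs (Module ℂ (squareIntegrable τ))

/-- The underlying element of `N`. -/
def L2Pre.val {τ : NSFTrace N} (x : L2Pre τ) : N := Subtype.val (p := (· ∈ squareIntegrable τ)) x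

theorem L2Pre.lt_top {τ : NSFTrace N} (x : L2Pre τ) : τ.toFun (star x.val * x.val) < ∞ :=
  Subtype.property (p := (· ∈ squareIntegrable τ)) x

instance (τ : NSFTrace N) : Norm (L2Pre τ) :=
  ⟨fun x => Real.sqrt (τ.toFun (star x.val * x.val)).toReal⟩

theorem L2Pre.norm_def {τ : NSFTrace N} (x : L2Pre τ) :
    ‖x‖ = Real.sqrt (τ.toFun (star x.val * x.val)).toReal := rfl

theorem L2Pre.norm_sq {τ : NSFTrace N} (x : L2Pre τ) :
    ‖x‖ ^ 2 = (τ.toFun (star x.val * x.val)).toReal :=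
  Real.sq_sqrt ENNReal.toReal_nonneg

theorem L2Pre.norm_smul_eq {τ : NSFTrace N} (c : ℂ) (x : L2Pre τ) : ‖c • x‖ = ‖c‖ * ‖x‖ := by
  have h : τ.toFun (star (c • x).val * (c • x).val) = _ := τ.sq_smul c x.val
  rw [L2Pre.norm_def, L2Pre.norm_def, h, ENNReal.toReal_mul, Real.sqrt_mul (by positivity)]
  congr 1
  simp

theorem L2Pre.eq_zero_of_norm {τ : NSFTrace N} (x : L2Pre τ) (h : ‖x‖ = 0) : x = 0 := by
  have h1 := x.norm_sq
  rw [h, zero_pow two_ne_zero, eq_comm, ENNReal.toReal_eq_zero_iff] at h1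
  have h2 := τ.faithful _ (star_mul_self_nonneg' _) (h1.resolve_right x.lt_top.ne)
  have h3 : star (x.val : H →L[ℂ] H) * (x.val : H →L[ℂ] H) = 0 := congrArg Subtype.val h2
  rw [CStarRing.star_mul_self_eq_zero_iff] at h3
  exact Subtype.ext (Subtype.ext h3)

theorem L2Pre.norm_add_le' {τ : NSFTrace N} (x y : L2Pre τ) : ‖x + y‖ ≤ ‖x‖ + ‖y‖ := by
  by_cases hx : ‖x‖ = 0
  · rw [x.eq_zero_of_norm hx, zero_add]
    exact le_add_of_nonneg_left (Real.sqrt_nonneg _)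
  by_cases hy : ‖y‖ = 0
  · rw [y.eq_zero_of_norm hy, add_zero]
    exact le_add_of_nonneg_right (Real.sqrt_nonneg _)
  have hx' : 0 < ‖x‖ := lt_of_le_of_ne (Real.sqrt_nonneg _) (Ne.symm hx)
  have hy' : 0 < ‖y‖ := lt_of_le_of_ne (Real.sqrt_nonneg _) (Ne.symm hy)
  set s : ℝ≥0 := Real.toNNReal (Real.sqrt (‖y‖ / ‖x‖)) with hs
  have hs0 : 0 < s := Real.toNNReal_pos.2 (Real.sqrt_pos.2 (by positivity))
  have hs2 : (s : ℝ) ^ 2 = ‖y‖ / ‖x‖ := by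
    rw [hs, Real.coe_toNNReal _ (Real.sqrt_nonneg _), Real.sq_sqrt (by positivity)]
  have h : τ.toFun (star (x + y).val * (x + y).val) ≤ _ := τ.sq_add_le x.val y.val hs0
  have h' := ENNReal.toReal_mono (ENNReal.add_lt_top.2
    ⟨ENNReal.mul_lt_top ENNReal.coe_lt_top x.lt_top,
      ENNReal.mul_lt_top ENNReal.coe_lt_top y.lt_top⟩).ne h
  rw [ENNReal.toReal_add (ENNReal.mul_lt_top ENNReal.coe_lt_top x.lt_top).ne
    (ENNReal.mul_lt_top ENNReal.coe_lt_top y.lt_top).ne, ENNReal.toReal_mul, ENNReal.toReal_mul,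
    ← L2Pre.norm_sq, ← L2Pre.norm_sq, ← L2Pre.norm_sq, ENNReal.coe_toReal, ENNReal.coe_toReal]
    at h'
  push_cast at h'
  rw [inv_pow, hs2] at h'
  refine abs_le_of_sq_le_sq' (h'.trans_eq ?_) (by positivity) |>.2
  field_simp
  ring

theorem L2Pre.core (τ : NSFTrace N) : NormedSpace.Core ℂ (L2Pre τ) where
  norm_nonneg _ := Real.sqrt_nonneg _
  norm_smul := L2Pre.norm_smul_eq
  norm_triangle := L2Pre.norm_add_le'
  norm_eq_zero_iff x := by
    refine ⟨x.eq_zero_of_norm, ?_⟩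
    rintro rfl
    simpa using L2Pre.norm_smul_eq (0 : ℂ) (0 : L2Pre τ)

instance (τ : NSFTrace N) : NormedAddCommGroup (L2Pre τ) :=
  NormedAddCommGroup.ofCore (L2Pre.core τ)

instance (τ : NSFTrace N) : NormedSpace ℂ (L2Pre τ) :=
  NormedSpace.ofCore (L2Pre.core τ)

/-- The noncommutative `L₂(N)`, the completion of `N ∩ L₂` for `‖·‖₂`. -/
abbrev L2 (τ : NSFTrace N) : Type u := UniformSpace.Completion (L2Pre τ)

/-! ### Standard semigroups -/

/-- Positivity of the matrix `X ∈ N ⊗ Mₙ` as an operator on `Hⁿ`. -/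
def IsPosMatrix {n : ℕ} (X : Fin n → Fin n → N) : Prop :=
  ∀ ξ : Fin n → H, 0 ≤ ∑ i, ∑ j, ⟪ξ i, (X i j : H →L[ℂ] H) (ξ j)⟫_ℂ

/-- `T ⊗ Iₙ` is positive on `N ⊗ Mₙ` for each `n`. -/
def CompletelyPositive (T : N →ₗ[ℂ] N) : Prop :=
  ∀ (n : ℕ) (X : Fin n → Fin n → N), IsPosMatrix X → IsPosMatrix fun i j => T (X i j)

/-- A standard semigroup `(T_t)_{t ≥ 0}` on `(N, τ)`.
* `normal`: `T_t` preserves suprema of increasing nets (Scott continuity), which is normality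
  of a positive map.
* `symm`: `τ(T_t(f) g) = τ(f T_t(g))` in `[0, ∞]` for all positive `f = a* a` and `g = b* b`; here
  `τ(x b* b)` is `τ(b x b*)` for `x ≥ 0`.
* `tendsto`: `T_t f → f` in the strong operator topology as `t → 0`. -/
structure StandardSemigroup (τ : NSFTrace N) where
  toFun : ℝ≥0 → N →ₗ[ℂ] N
  zero : toFun 0 = LinearMap.id
  add : ∀ s t, toFun (s + t) = toFun s ∘ₗ toFun t
  completelyPositive : ∀ t, CompletelyPositive (toFun t)
  normal : ∀ t, ScottContinuous (toFun t)
  unital : ∀ t, toFun t 1 = 1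
  symm : ∀ t (a b : N), τ.toFun (b * toFun t (star a * a) * star b) =
    τ.toFun (a * toFun t (star b * b) * star a)
  tendsto : ∀ (f : N) (ξ : H),
    Tendsto (fun t => (toFun t f : H →L[ℂ] H) ξ) (𝓝 0) (𝓝 ((f : H →L[ℂ] H) ξ))

variable {τ : NSFTrace N}

theorem isPosMatrix_gram {n : ℕ} (v : Fin n → N) : IsPosMatrix fun i j => star (v i) * v j := by
  intro ξ
  have : ∑ i, ∑ j, ⟪ξ i, ((star (v i) * v j : N) : H →L[ℂ] H) (ξ j)⟫_ℂ =
      ⟪∑ i, (v i : H →L[ℂ] H) (ξ i), ∑ i, (v i : H →L[ℂ] H) (ξ i)⟫_ℂ := by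
    rw [sum_inner]
    refine Finset.sum_congr rfl fun i _ => ?_
    rw [inner_sum]
    refine Finset.sum_congr rfl fun j _ => ?_
    exact ContinuousLinearMap.adjoint_inner_right (v i : H →L[ℂ] H) _ _
  rw [this, inner_self_eq_norm_sq_to_K]
  exact pow_nonneg (by simp) 2

theorem CompletelyPositive.gram_nonneg {T : N →ₗ[ℂ] N} (hT : CompletelyPositive T)
    (h1 : T 1 = 1) (a : N) (ξ η : H) :
    0 ≤ ⟪ξ, (T (star a * a) : H →L[ℂ] H) ξ⟫_ℂ + ⟪ξ, (T (star a) : H →L[ℂ] H) η⟫_ℂ +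
      (⟪η, (T a : H →L[ℂ] H) ξ⟫_ℂ + ⟪η, η⟫_ℂ) := by
  have := hT 2 _ (isPosMatrix_gram ![a, 1]) ![ξ, η]
  simpa [Fin.sum_univ_two, h1] using this

theorem CompletelyPositive.map_star {T : N →ₗ[ℂ] N} (hT : CompletelyPositive T)
    (h1 : T 1 = 1) (a : N) : T (star a) = star (T a) := by
  apply Subtype.ext
  ext η
  refine ext_inner_left ℂ fun ξ => ?_
  have e : ⟪ξ, ((star (T a) : N) : H →L[ℂ] H) η⟫_ℂ = ⟪(T a : H →L[ℂ] H) ξ, η⟫_ℂ :=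
    ContinuousLinearMap.adjoint_inner_right (T a : H →L[ℂ] H) ξ η
  rw [e, ← inner_conj_symm ((T a : H →L[ℂ] H) ξ) η]
  have p0 := (Complex.le_def.1 (hT.gram_nonneg h1 a ξ 0)).2
  have p1 := (Complex.le_def.1 (hT.gram_nonneg h1 a ξ η)).2
  have p2 := (Complex.le_def.1 (hT.gram_nonneg h1 a ξ (Complex.I • η))).2
  have q := inner_self_im (𝕜 := ℂ) η
  simp only [inner_zero_left, inner_zero_right, map_zero, map_smul, inner_smul_left,
    inner_smul_right, Complex.add_im, Complex.zero_im, Complex.mul_im, Complex.conj_I,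
    Complex.I_re, Complex.I_im, Complex.neg_re, Complex.neg_im, Complex.mul_re,
    RCLike.im_to_complex] at p0 p1 p2 q
  apply Complex.ext
  · rw [Complex.conj_re]
    rw [q] at p2
    linarith
  · rw [Complex.conj_im]
    linarith

theorem CompletelyPositive.kadison_schwarz {T : N →ₗ[ℂ] N} (hT : CompletelyPositive T)
    (h1 : T 1 = 1) (a : N) : star (T a) * T a ≤ T (star a * a) := by
  have key : ((star (T a) * T a : N) : H →L[ℂ] H) ≤ (T (star a * a) : H →L[ℂ] H) := by
    rw [ContinuousLinearMap.le_def, ContinuousLinearMap.isPositive_iff_complex]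
    intro ξ
    have h := hT.gram_nonneg h1 a ξ (-(T a : H →L[ℂ] H) ξ)
    rw [hT.map_star h1] at h
    set A : H →L[ℂ] H := (T (star a * a) : H →L[ℂ] H) - ((star (T a) * T a : N) : H →L[ℂ] H)
    have h' : 0 ≤ ⟪ξ, A ξ⟫_ℂ := by
      refine h.trans_eq ?_
      have e : ((star (T a) * T a : N) : H →L[ℂ] H) ξ =
        ((star (T a) : N) : H →L[ℂ] H) ((T a : H →L[ℂ] H) ξ) := rfl
      simp only [A, sub_apply, e, inner_sub_right, map_neg, inner_neg_right,
        inner_neg_left]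
      ring
    have h2 : 0 ≤ ⟪A ξ, ξ⟫_ℂ := by
      have h3 := Complex.conj_eq_iff_real.2 ⟨_, Complex.eq_re_of_ofReal_le h'⟩
      rw [← inner_conj_symm, h3]
      exact h'
    exact ⟨(Complex.eq_re_of_ofReal_le h2).symm, (Complex.le_def.1 h2).1⟩
  exact key

/-- `T_t` is contractive for `‖·‖₂`. -/
theorem StandardSemigroup.trace_sq_le (S : StandardSemigroup τ) (t : ℝ≥0) (a : N) :
    τ.toFun (star (S.toFun t a) * S.toFun t a) ≤ τ.toFun (star a * a) := by
  refine (τ.mono (star_mul_self_nonneg' _)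
    ((S.completelyPositive t).kadison_schwarz (S.unital t) a)).trans_eq ?_
  have := S.symm t a 1
  simp only [star_one, one_mul, mul_one, S.unital] at this
  rw [this, ← τ.tracial]

/-- `T_t` on `N ∩ L₂`. -/
def StandardSemigroup.preMap (S : StandardSemigroup τ) (t : ℝ≥0) (a : L2Pre τ) : L2Pre τ :=
  (⟨S.toFun t a.val, (S.trace_sq_le t a.val).trans_lt a.lt_top⟩ : squareIntegrable τ)

theorem StandardSemigroup.uniformContinuous_preMap (S : StandardSemigroup τ) (t : ℝ≥0) :
    UniformContinuous (S.preMap t) := by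
  refine LipschitzWith.uniformContinuous (K := 1) (LipschitzWith.of_dist_le_mul fun a b => ?_)
  have e : S.preMap t a - S.preMap t b = S.preMap t (a - b) :=
    Subtype.ext ((S.toFun t).map_sub a.val b.val).symm
  rw [dist_eq_norm, dist_eq_norm, e, NNReal.coe_one, one_mul]
  exact Real.sqrt_le_sqrt (ENNReal.toReal_mono (a - b).lt_top.ne (S.trace_sq_le t (a - b).val))

/-- `T_t` on `L₂(N)`, the continuous extension of `T_t` on `N ∩ L₂`. -/
def StandardSemigroup.mapL2 (S : StandardSemigroup τ) (t : ℝ≥0) : L2 τ → L2 τ :=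
  UniformSpace.Completion.map (S.preMap t)

/-! ### The subordinated Poisson semigroup -/

/-- The density `t / (2 √π) · exp(-t² / (4u)) · u^{-3/2}`, `u > 0`. -/
def poissonKernel (t u : ℝ) : ℝ :=
  t / (2 * √Real.pi) * Real.exp (-t ^ 2 / (4 * u)) * u ^ (-(3 / 2) : ℝ)

open Classical in
/-- `P_t f = ∫₀^∞ poissonKernel t u • T_u f du` for `f ∈ N` and `t > 0`, a weak integral: the
unique element of `N` with the matrix coefficients below. For a standard semigroup it exists,
as `u ↦ T_u f` is bounded by `‖f‖` and right continuous in the weak operator topology. -/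
def StandardSemigroup.poisson (S : StandardSemigroup τ) (t : ℝ) (f : N) : N :=
  if h : ∃ x : N, ∀ ξ η : H, ⟪ξ, (x : H →L[ℂ] H) η⟫_ℂ =
      ∫ u in Ioi (0 : ℝ), (poissonKernel t u : ℂ) *
        ⟪ξ, (S.toFun u.toNNReal f : H →L[ℂ] H) η⟫_ℂ
  then h.choose else 0

/-- `P_t g = ∫₀^∞ poissonKernel t u • T_u g du` for `g ∈ L₂(N)` and `t > 0`. -/
def StandardSemigroup.poissonL2 (S : StandardSemigroup τ) (t : ℝ) (g : L2 τ) : L2 τ :=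
  ∫ u in Ioi (0 : ℝ), poissonKernel t u • S.mapL2 u.toNNReal g

/-! ### BMO norms of elements of `N` -/

/-- `sup_{t > 0} ‖Φ_t |f - Φ_t f|²‖^{1/2}` for `f ∈ N`. -/
def bmo (Φ : ℝ → N → N) (f : N) : ℝ≥0∞ :=
  ⨆ (t : ℝ) (_ : 0 < t), ‖Φ t (star (f - Φ t f) * (f - Φ t f))‖ₑ ^ (1 / 2 : ℝ)

/-- `‖f‖_{BMO^c(T)}`, `f ∈ N`. -/
def StandardSemigroup.bmoT (S : StandardSemigroup τ) (f : N) : ℝ≥0∞ :=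
  bmo (fun t a => S.toFun t.toNNReal a) f

/-- `‖f‖_{BMO^c(P)}`, `f ∈ N`. -/
def StandardSemigroup.bmoP (S : StandardSemigroup τ) (f : N) : ℝ≥0∞ :=
  bmo S.poisson f

/-- `‖f‖_{BMO^c(∂)} = sup_{t > 0} ‖P_t ∫₀ᵗ |P_s' f|² s ds‖^{1/2}`, `f ∈ N`. As `P_t` is normal and
the integral is one of positive operators, it is a weak integral with values in the extended
positive cone of `N`, and its norm is the supremum of its quadratic form
`ξ ↦ ∫₀ᵗ ⟨P_t |P_s' f|² ξ, ξ⟩ s ds ∈ [0, ∞]` on the unit ball of `H`. -/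
def StandardSemigroup.bmoPartial (S : StandardSemigroup τ) (f : N) : ℝ≥0∞ :=
  ⨆ (t : ℝ) (_ : 0 < t),
    (⨆ (ξ : H) (_ : ‖ξ‖ ≤ 1), ∫⁻ s in Ioo 0 t, ENNReal.ofReal
      (s * (S.poisson t (star (deriv (fun r => S.poisson r f) s) *
        deriv (fun r => S.poisson r f) s) : H →L[ℂ] H).reApplyInnerSelf ξ)) ^ (1 / 2 : ℝ)

/-! ### BMO norms of elements of `L₂(N)`

For `g ∈ L₂(N)` the elements `|g|²` and `T_t |g|²`, `P_t |g|²` belong to `L₁(N)`, the completion of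
`N ∩ L₁` for `‖x‖₁ = τ(|x|)`. With `Φ = T_t` or `Φ = P_t`, `Φ |g|²` is the limit in `L₁(N)` of
`Φ |a|²` as `a ∈ N ∩ L₂` tends to `g` in `L₂(N)`. It enters through the pairing with positive
`b* b ∈ N`: `τ(h b* b) = τ(b h b*)`. A positive `h ∈ L₁(N)` has operator norm
`‖h‖ = sup {τ(h b* b) : b ∈ N, τ(b* b) ≤ 1}`, with value `∞` when `h` is not in `N`. -/

/-- `τ(Φ(|g|²) b* b) = lim_{a → g} τ(b Φ(|a|²) b*)` for `g ∈ L₂(N)`, the continuous extension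
from `N ∩ L₂` to `L₂(N)`. -/
def sqPairing (Φ : N → N) (b : N) (g : L2 τ) : ℝ≥0∞ :=
  UniformSpace.Completion.isDenseInducing_coe.extend
    (fun a : L2Pre τ => τ.toFun (b * Φ (star a.val * a.val) * star b)) g

/-- `sup_{t > 0} ‖Φ_t |g - Φ_t g|²‖^{1/2}` for `g ∈ L₂(N)`, where `Ψ_t` is `Φ_t` on `L₂(N)`. -/
def bmoL2 (Φ : ℝ → N → N) (Ψ : ℝ → L2 τ → L2 τ) (g : L2 τ) : ℝ≥0∞ :=
  ⨆ (t : ℝ) (_ : 0 < t),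
    (⨆ (b : N) (_ : τ.toFun (star b * b) ≤ 1), sqPairing (Φ t) b (g - Ψ t g)) ^ (1 / 2 : ℝ)

/-- `‖g‖_{BMO^c(T)}`, `g ∈ L₂(N)`. -/
def StandardSemigroup.bmoTL2 (S : StandardSemigroup τ) (g : L2 τ) : ℝ≥0∞ :=
  bmoL2 (fun t a => S.toFun t.toNNReal a) (fun t => S.mapL2 t.toNNReal) g

/-- `‖g‖_{BMO^c(P)}`, `g ∈ L₂(N)`. -/
def StandardSemigroup.bmoPL2 (S : StandardSemigroup τ) (g : L2 τ) : ℝ≥0∞ :=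
  bmoL2 S.poisson S.poissonL2 g

/-- `‖g‖_{BMO^c(∂)} = sup_{t > 0} ‖P_t ∫₀ᵗ |P_s' g|² s ds‖^{1/2}`, `g ∈ L₂(N)`; the integral is
taken in the positive cone of `L₁(N)`, and so commutes with `P_t` and with the pairing. -/
def StandardSemigroup.bmoPartialL2 (S : StandardSemigroup τ) (g : L2 τ) : ℝ≥0∞ :=
  ⨆ (t : ℝ) (_ : 0 < t),
    (⨆ (b : N) (_ : τ.toFun (star b * b) ≤ 1), ∫⁻ s in Ioo 0 t, ENNReal.ofReal s *
      sqPairing (S.poisson t) b (deriv (fun r => S.poissonL2 r g) s)) ^ (1 / 2 : ℝ)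

end SemigroupBMO

end

open scoped ENNReal NNReal InnerProductSpace ComplexOrder Topology
open MeasureTheory Set Filter
noncomputable section
namespace SemigroupBMO
universe u
variable {H : Type u} [NormedAddCommGroup H] [InnerProductSpace ℂ H] [CompleteSpace H]
variable {N : VonNeumannAlgebra H}

/-! Both inequalities are tested against one positive functional `ρ` at a time: `ρ = Re ⟨ξ, · ξ⟩`
for elements of `N`, and `ρ = τ(b · b*)` for elements of `L₂`. What is then needed of `N`, `τ` and
`T` is collected in the structure `Frame`: the real forms `B_v(x, y) = ρ(T_v(x* y))`, the
Kadison–Schwarz inequality `B_v(T_u x, T_u x) ≤ B_{v+u}(x, x)`, and the averages `A k = ∫ k(u) T_u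
du` for `k ∈ L¹(0, ∞)`. Put `C(k, x, y) = ∫ k(v) B_v(x, y) dv` and let `p_t` be the Poisson kernel,
so that `C(p_t, x, x) = ρ(P_t |x|²)`. The kernel enters through four facts: `p_s * p_t = p_{s+t}`,
`∂ₜ² p = ∂ᵤ p`, `p_b ≤ (b/a) p_a` for `a ≤ b`, and the differentiability of `t ↦ p_t` as a curve in
`L¹`. Since `A` and `C` are bounded multilinear maps, the last fact makes every expression below
differentiable.

First inequality. Let `E(r, s)` be the derivative at `δ = 0` of the Jensen defect `ρ(P_{r+δ}|P_s
g|²) - ρ(P_r|P_{s+δ} g|²)`. It is nonnegative, and `E(b, s) ≤ (b/a) E(a, s)` for `a ≤ b`. On the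
diagonal, `d/ds E(t+s, s) ≤ -2 ρ(P_{t+s}|P_s' g|²)`: the cross terms cancel, and `∂ₜ² p = ∂ᵤ p`
turns the remaining second order terms into minus a carré du champ of `T`. On the antidiagonal,
`E(t-s, s) = -d/ds ρ(P_{t-s}|P_s g|²)`. Comparing the two and integrating by parts gives `∫₀^{t/2}
ρ(P_{3t/2}|P_s' g|²) s ds ≤ 7 ρ(P_t|g|²)` (`integral_mul_C_le`). For `g = f - P_t f` the right side
is controlled by the norm in `BMO^c(P)`. The rest of the derivative, `P_{s+t}' f`, and the range of
large `s` are handled by the pointwise bound `C_Q_le`, of order `M / s`, obtained by telescoping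
`P_w' f = P_w'(f - P_w f) + P_{2w}' f` over `w = 2ⁿ s`. `lintegral_C_Q_le` assembles these bounds.

Second inequality. The hypothesis gives `B_v(f - T_u f, f - T_u f) ≤ M²` for `u ≤ v`. For `u > v`,
each doubling of `u` adds at most `M` to the square root, so the growth is logarithmic in `u/v`,
hence at most a constant times `(u/v)^{1/4}`. Writing `f - P_t f` as the average of `f - T_u f`
against `p_t` and applying Jensen leaves moments of `p_t` that are finite and, by scaling,
independent of `t` (`C_sub_P_le`).

Construction of the frames. The orbit `u ↦ T_u x` is used only as a weakly right continuous
function, so averages in `N` are weak integrals. Pulling `x ↦ ρ(T_v(y* x))` through them requires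
normal functionals to be sequentially continuous for the weak operator topology on bounded sets.
This is derived from the trace: bounded sequences that are Cauchy in `‖·‖₂` and weakly null are null
in `‖·‖₂`, and convex combinations turn weak convergence into `‖·‖₂`-convergence. On `L₂`, symmetry
gives `τ(b T_t(|a|²) b*) = ‖a T_t(b* b)^{1/2}‖₂²`, which extends continuously from `N ∩ L₂` and
furnishes the forms `B_v`. -/

/-! ### Elements of a von Neumann algebra through their matrix coefficients -/

/-- The matrix coefficient `⟨ξ, x η⟩`. -/
def mc (x : N) (ξ η : H) : ℂ := ⟪ξ, (x : H →L[ℂ] H) η⟫_ℂ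

theorem mc_add (x y : N) (ξ η : H) : mc (x + y) ξ η = mc x ξ η + mc y ξ η :=
  inner_add_right _ _ _

theorem mc_sub (x y : N) (ξ η : H) : mc (x - y) ξ η = mc x ξ η - mc y ξ η :=
  inner_sub_right _ _ _

theorem mc_zero (ξ η : H) : mc (0 : N) ξ η = 0 := inner_zero_right _

theorem mc_smul (c : ℂ) (x : N) (ξ η : H) : mc (c • x) ξ η = c * mc x ξ η :=
  inner_smul_right _ _ _

theorem mc_real_smul (c : ℝ) (x : N) (ξ η : H) : mc (c • x) ξ η = c * mc x ξ η :=
  mc_smul (c : ℂ) x ξ η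

theorem mc_mul (x y : N) (ξ η : H) :
    mc (x * y) ξ η = mc x ξ ((y : H →L[ℂ] H) η) := rfl

theorem mc_star_mul (x y : N) (ξ η : H) :
    mc (star x * y) ξ η = mc y ((x : H →L[ℂ] H) ξ) η :=
  ContinuousLinearMap.adjoint_inner_right (x : H →L[ℂ] H) ξ _

theorem mc_mul_left (x y : N) (ξ η : H) :
    mc (x * y) ξ η = mc y (((star x : N) : H →L[ℂ] H) ξ) η := by
  rw [← mc_star_mul, star_star]

theorem mc_star (x : N) (ξ η : H) : mc (star x) ξ η = starRingEnd ℂ (mc x η ξ) := by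
  rw [mc, mc, inner_conj_symm]
  exact ContinuousLinearMap.adjoint_inner_right (x : H →L[ℂ] H) ξ η

theorem mc_star_mul_self (x : N) (ξ : H) :
    mc (star x * x) ξ ξ = ((‖(x : H →L[ℂ] H) ξ‖ ^ 2 : ℝ) : ℂ) := by
  rw [mc_star_mul, mc, inner_self_eq_norm_sq_to_K]
  norm_cast

theorem norm_mc_le (x : N) (ξ η : H) : ‖mc x ξ η‖ ≤ ‖x‖ * ‖ξ‖ * ‖η‖ := by
  calc ‖mc x ξ η‖ ≤ ‖ξ‖ * ‖(x : H →L[ℂ] H) η‖ := norm_inner_le_norm _ _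
    _ ≤ ‖ξ‖ * (‖x‖ * ‖η‖) := by gcongr; exact (x : H →L[ℂ] H).le_opNorm η
    _ = _ := by ring

theorem ext_mc {x y : N} (h : ∀ ξ η, mc x ξ η = mc y ξ η) : x = y :=
  Subtype.ext (ContinuousLinearMap.ext fun η => ext_inner_left ℂ fun ξ => h ξ η)

theorem nonneg_iff_mc {x : N} : 0 ≤ x ↔ ∀ ξ, 0 ≤ mc x ξ ξ := by
  change (0 : H →L[ℂ] H) ≤ x ↔ _
  rw [ContinuousLinearMap.nonneg_iff_isPositive, ContinuousLinearMap.isPositive_iff_complex]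
  refine forall_congr' fun ξ => ?_
  rw [mc, ← inner_conj_symm, Complex.le_def]
  simp only [RCLike.re_to_complex, Complex.conj_re, Complex.zero_re, Complex.zero_im]
  constructor
  · rintro ⟨h1, h2⟩
    have h3 := congrArg Complex.im h1
    rw [Complex.ofReal_im, Complex.conj_im] at h3
    exact ⟨h2, by linarith⟩
  · rintro ⟨h1, h2⟩
    refine ⟨Complex.ext ?_ (by rw [Complex.ofReal_im, Complex.conj_im, ← h2, neg_zero]), h1⟩
    rw [Complex.ofReal_re, Complex.conj_re]

theorem le_iff_mc {x y : N} : x ≤ y ↔ ∀ ξ, mc x ξ ξ ≤ mc y ξ ξ := by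
  rw [← sub_nonneg, nonneg_iff_mc]
  simp only [mc_sub, sub_nonneg]

theorem norm_le_of_mc {x : N} {C : ℝ} (hC : 0 ≤ C) (h : ∀ ξ η, ‖mc x ξ η‖ ≤ C * ‖ξ‖ * ‖η‖) :
    ‖x‖ ≤ C := by
  refine (x : H →L[ℂ] H).opNorm_le_bound hC fun η => ?_
  have h1 := h ((x : H →L[ℂ] H) η) η
  rw [mc, inner_self_eq_norm_sq_to_K] at h1
  simp only [Complex.coe_algebraMap, norm_pow, Complex.norm_real, norm_norm] at h1
  rcases (norm_nonneg ((x : H →L[ℂ] H) η)).eq_or_lt with h0 | h0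
  · rw [← h0]; positivity
  · nlinarith

/-- A bounded sesquilinear form that commutes with the commutant of `N` belongs to `N`. -/
theorem exists_of_form (B : H → H → ℂ) (C : ℝ)
    (add_left : ∀ ξ ξ' η, B (ξ + ξ') η = B ξ η + B ξ' η)
    (smul_left : ∀ (c : ℂ) ξ η, B (c • ξ) η = starRingEnd ℂ c * B ξ η)
    (add_right : ∀ ξ η η', B ξ (η + η') = B ξ η + B ξ η')
    (smul_right : ∀ (c : ℂ) ξ η, B ξ (c • η) = c * B ξ η)
    (bound : ∀ ξ η, ‖B ξ η‖ ≤ C * ‖ξ‖ * ‖η‖)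
    (comm : ∀ c ∈ N.commutant, ∀ ξ η, B ξ (c η) = B (star c ξ) η) :
    ∃ x : N, ∀ ξ η, mc x ξ η = B ξ η := by
  let F : H →ₗ⋆[ℂ] H →ₗ[ℂ] ℂ := LinearMap.mk₂'ₛₗ (starRingEnd ℂ) (RingHom.id ℂ) B
    add_left smul_left add_right smul_right
  let G : H →L⋆[ℂ] H →L[ℂ] ℂ := F.mkContinuous₂ C bound
  let G' : H →L⋆[ℂ] H →L[ℂ] ℂ := G
  let a : H →L[ℂ] H := ContinuousLinearMap.adjoint (InnerProductSpace.continuousLinearMapOfBilin G')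
  have ha : ∀ ξ η, ⟪ξ, a η⟫_ℂ = B ξ η := by
    intro ξ η
    rw [ContinuousLinearMap.adjoint_inner_right,
      InnerProductSpace.continuousLinearMapOfBilin_apply]
    rfl
  have hm : a ∈ N := by
    rw [← VonNeumannAlgebra.commutant_commutant N, VonNeumannAlgebra.mem_commutant_iff]
    intro c hc
    ext η
    refine ext_inner_left ℂ fun ξ => ?_
    change ⟪ξ, c (a η)⟫_ℂ = ⟪ξ, a (c η)⟫_ℂ
    rw [ha, comm c hc, ← ha]
    exact (ContinuousLinearMap.adjoint_inner_left c _ _).symm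
  exact ⟨⟨a, hm⟩, ha⟩

theorem mc_commutant (x : N) {c : H →L[ℂ] H} (hc : c ∈ N.commutant) (ξ η : H) :
    mc x ξ (c η) = mc x (star c ξ) η := by
  have h := VonNeumannAlgebra.mem_commutant_iff.1 hc x x.2
  have h1 : (x : H →L[ℂ] H) (c η) = c ((x : H →L[ℂ] H) η) := congrArg (fun f : H →L[ℂ] H => f η) h
  rw [mc, h1]
  exact (ContinuousLinearMap.adjoint_inner_left c _ _).symm

theorem mc_add_left (x : N) (ξ ξ' η : H) : mc x (ξ + ξ') η = mc x ξ η + mc x ξ' η :=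
  inner_add_left _ _ _

theorem mc_smul_left (x : N) (c : ℂ) (ξ η : H) :
    mc x (c • ξ) η = starRingEnd ℂ c * mc x ξ η := inner_smul_left _ _ _

theorem mc_add_right (x : N) (ξ η η' : H) : mc x ξ (η + η') = mc x ξ η + mc x ξ η' := by
  rw [mc, map_add, inner_add_right]; rfl

theorem mc_smul_right (x : N) (c : ℂ) (ξ η : H) : mc x ξ (c • η) = c * mc x ξ η := by
  rw [mc, map_smul, inner_smul_right]; rfl

/-- Pointwise limits of bounded families of matrix coefficients belong to `N`. -/
theorem exists_weak_limit {ι : Type*} {l : Filter ι} [l.NeBot] (X : ι → N) (M : ℝ)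
    (hM : ∀ᶠ i in l, ‖X i‖ ≤ M) (L : H → H → ℂ)
    (hL : ∀ ξ η, Tendsto (fun i => mc (X i) ξ η) l (𝓝 (L ξ η))) :
    ∃ x : N, ∀ ξ η, mc x ξ η = L ξ η := by
  refine exists_of_form L M ?_ ?_ ?_ ?_ ?_ ?_
  · intro ξ ξ' η
    refine tendsto_nhds_unique (hL _ _) ?_
    simpa only [mc_add_left] using (hL ξ η).add (hL ξ' η)
  · intro c ξ η
    refine tendsto_nhds_unique (hL _ _) ?_
    simpa only [mc_smul_left] using (hL ξ η).const_mul _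
  · intro ξ η η'
    refine tendsto_nhds_unique (hL _ _) ?_
    simpa only [mc_add_right] using (hL ξ η).add (hL ξ η')
  · intro c ξ η
    refine tendsto_nhds_unique (hL _ _) ?_
    simpa only [mc_smul_right] using (hL ξ η).const_mul _
  · intro ξ η
    refine le_of_tendsto (hL ξ η).norm ?_
    filter_upwards [hM] with i hi
    refine (norm_mc_le _ _ _).trans ?_
    gcongr
  · intro c hc ξ η
    refine tendsto_nhds_unique (hL _ _) ?_
    simpa only [mc_commutant _ hc] using hL (star c ξ) η

/-! ### Order and norm -/

theorem norm_le_of_nonneg_of_le {x y : N} (hx : 0 ≤ x) (hxy : x ≤ y) : ‖x‖ ≤ ‖y‖ :=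
  CStarAlgebra.norm_le_norm_of_nonneg_of_le (A := H →L[ℂ] H) (a := x) (b := y) hx hxy

theorem norm_le_of_le_smul_one {x : N} (hx : 0 ≤ x) {C : ℝ} (hC : 0 ≤ C)
    (h : x ≤ C • (1 : N)) : ‖x‖ ≤ C := by
  refine (norm_le_of_nonneg_of_le hx h).trans ?_
  refine (norm_smul_le _ _).trans ?_
  rw [Real.norm_of_nonneg hC]
  refine mul_le_of_le_one_right hC ?_
  exact ContinuousLinearMap.norm_id_le

theorem norm_star_mul_self' (x : N) : ‖star x * x‖ = ‖x‖ ^ 2 := by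
  rw [sq]
  exact CStarRing.norm_star_mul_self (x := (x : H →L[ℂ] H))

theorem star_mul_self_le_of_norm_le {x : N} {M : ℝ} (h : ‖x‖ ≤ M) :
    star x * x ≤ (M ^ 2) • (1 : N) := by
  rw [le_iff_mc]
  intro ξ
  rw [mc_star_mul_self, mc_real_smul]
  have e : mc (1 : N) ξ ξ = ((‖ξ‖ ^ 2 : ℝ) : ℂ) := by
    rw [mc]
    change ⟪ξ, ξ⟫_ℂ = _
    rw [inner_self_eq_norm_sq_to_K]; norm_cast
  rw [e]
  have := (x : H →L[ℂ] H).le_of_opNorm_le h ξ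
  have h2 : ‖(x : H →L[ℂ] H) ξ‖ ^ 2 ≤ M ^ 2 * ‖ξ‖ ^ 2 := by
    rw [← mul_pow]; gcongr
  exact_mod_cast h2

theorem norm_sq_apply_le {x y : N} (h : star x * x ≤ y) (ξ : H) :
    ‖(x : H →L[ℂ] H) ξ‖ ^ 2 ≤ (mc y ξ ξ).re := by
  have h1 := le_iff_mc.1 h ξ
  rw [mc_star_mul_self] at h1
  exact (Complex.le_def.1 h1).1

theorem isClosed_vonNeumann (N : VonNeumannAlgebra H) : IsClosed (N : Set (H →L[ℂ] H)) := by
  rw [← VonNeumannAlgebra.centralizer_centralizer N]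
  exact Set.isClosed_centralizer _

instance instCompleteSpace (N : VonNeumannAlgebra H) : CompleteSpace N :=
  (isClosed_vonNeumann N).completeSpace_coe

/-! ### Suprema of directed sets -/

/-- Vigier's theorem. -/
theorem exists_isLUB_of_directed (D : Set N) (hne : D.Nonempty) (h0 : ∀ y ∈ D, 0 ≤ y)
    (hd : DirectedOn (· ≤ ·) D) (z : N) (hz : ∀ y ∈ D, y ≤ z) :
    ∃ x : N, IsLUB D x ∧ ∀ ξ, ∀ ε > 0, ∃ y ∈ D, (mc x ξ ξ).re - ε < (mc y ξ ξ).re := by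
  have : Nonempty D := hne.to_subtype
  have : IsDirectedOrder D := ⟨fun a b => by
    obtain ⟨c, hc, h1, h2⟩ := hd a a.2 b b.2
    exact ⟨⟨c, hc⟩, h1, h2⟩⟩
  -- An ultrafilter finer than the order filter makes all bounded matrix coefficients converge at
  -- once; the weak limit is the supremum, and it is approximated in every vector state.
  let U : Ultrafilter D := Ultrafilter.of atTop
  have hU : (U : Filter D) ≤ atTop := Ultrafilter.of_le _
  have hM : ∀ y : D, ‖(y : N)‖ ≤ ‖z‖ := fun y => norm_le_of_nonneg_of_le (h0 y y.2) (hz y y.2)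
  have hL : ∀ ξ η, ∃ L : ℂ, Tendsto (fun y : D => mc (y : N) ξ η) U (𝓝 L) := by
    intro ξ η
    have hc := isCompact_closedBall (0 : ℂ) (‖z‖ * ‖ξ‖ * ‖η‖)
    obtain ⟨L, -, hL⟩ := hc.ultrafilter_le_nhds (U.map fun y : D => mc (y : N) ξ η) (by
      rw [le_principal_iff]
      refine Filter.mem_map.2 (Filter.univ_mem' fun y => ?_)
      rw [mem_preimage, mem_closedBall_zero_iff]
      refine (norm_mc_le _ _ _).trans ?_
      gcongr
      exact hM y)
    exact ⟨L, hL⟩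
  choose L hL using hL
  obtain ⟨x, hx⟩ := exists_weak_limit (l := (U : Filter D)) (fun y : D => (y : N)) ‖z‖
    (Filter.univ_mem' hM) L hL
  have hL' : ∀ ξ, Tendsto (fun y : D => mc (y : N) ξ ξ) U (𝓝 (mc x ξ ξ)) := fun ξ => by
    rw [hx]; exact hL ξ ξ
  refine ⟨x, ⟨?_, ?_⟩, ?_⟩
  · intro y hy
    rw [le_iff_mc]
    intro ξ
    refine ge_of_tendsto (hL' ξ) ?_
    filter_upwards [hU (Ici_mem_atTop (⟨y, hy⟩ : D))] with w hw
    exact le_iff_mc.1 (show y ≤ (w : N) from hw) ξ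
  · intro w hw
    rw [le_iff_mc]
    intro ξ
    refine le_of_tendsto (hL' ξ) (Filter.univ_mem' fun y => ?_)
    exact le_iff_mc.1 (hw y.2) ξ
  · intro ξ ε hε
    have h1 : Tendsto (fun y : D => (mc (y : N) ξ ξ).re) U (𝓝 (mc x ξ ξ).re) :=
      (Complex.continuous_re.tendsto _).comp (hL' ξ)
    obtain ⟨y, hy⟩ := (h1.eventually (lt_mem_nhds (sub_lt_self _ hε))).exists
    exact ⟨y, y.2, hy⟩

/-- Least upper bounds in `N` are unique, so the given one is the weak limit found above. This is
the normality of vector states. -/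
theorem exists_lt_mc_of_isLUB {D : Set N} (hne : D.Nonempty) (h0 : ∀ y ∈ D, 0 ≤ y)
    (hd : DirectedOn (· ≤ ·) D) {x : N} (hx : IsLUB D x) (ξ : H) {ε : ℝ} (hε : 0 < ε) :
    ∃ y ∈ D, (mc x ξ ξ).re - ε < (mc y ξ ξ).re := by
  obtain ⟨x', h1, h2⟩ := exists_isLUB_of_directed D hne h0 hd x hx.1
  rw [hx.unique h1]
  exact h2 ξ ε hε

/-! ### Functional calculus inside `N` -/

/-- The functional calculus of an element of `N` stays in `N`. -/
def fc (f : ℝ → ℝ) (h : N) : N :=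
  ⟨cfc f (h : H →L[ℂ] H), by
    have := isClosed_vonNeumann N
    exact cfc_mem (𝕜' := ℂ) f h.2⟩

theorem isSelfAdjoint_coe {h : N} (hh : 0 ≤ h) : IsSelfAdjoint (h : H →L[ℂ] H) :=
  IsSelfAdjoint.of_nonneg (R := H →L[ℂ] H) hh

theorem spectrum_nonneg' {h : N} (hh : 0 ≤ h) :
    ∀ x ∈ spectrum ℝ (h : H →L[ℂ] H), 0 ≤ x := fun _ hx =>
  spectrum_nonneg_of_nonneg (A := H →L[ℂ] H) (a := h) hh hx

theorem fc_le_fc {f g : ℝ → ℝ} {h : N} (hh : 0 ≤ h)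
    (hf : ContinuousOn f (spectrum ℝ (h : H →L[ℂ] H)))
    (hg : ContinuousOn g (spectrum ℝ (h : H →L[ℂ] H)))
    (hfg : ∀ x ∈ spectrum ℝ (h : H →L[ℂ] H), f x ≤ g x) : fc f h ≤ fc g h :=
  (cfc_le_iff f g (h : H →L[ℂ] H) hf hg (isSelfAdjoint_coe hh)).2 hfg

theorem fc_id {h : N} (hh : 0 ≤ h) : fc (fun x => x) h = h :=
  Subtype.ext (cfc_id' ℝ (h : H →L[ℂ] H) (isSelfAdjoint_coe hh))

theorem fc_const (c : ℝ) {h : N} (hh : 0 ≤ h) : fc (fun _ => c) h = c • (1 : N) := by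
  apply Subtype.ext
  refine (cfc_const c (h : H →L[ℂ] H) (isSelfAdjoint_coe hh)).trans ?_
  rw [Algebra.algebraMap_eq_smul_one]
  rfl

/-- `h ↦ h (1 + h)⁻¹`. -/
def cutoff (h : N) : N := fc (fun x => 1 - (1 + x)⁻¹) h

theorem continuousOn_cutoff {h : N} (hh : 0 ≤ h) {c : ℝ} (hc : 0 ≤ c) :
    ContinuousOn (fun x : ℝ => 1 - (1 + c * x)⁻¹) (spectrum ℝ (h : H →L[ℂ] H)) := by
  refine continuousOn_const.sub (ContinuousOn.inv₀ (by fun_prop) fun x hx => ?_)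
  have := mul_nonneg hc (spectrum_nonneg' hh x hx)
  positivity

theorem continuousOn_cutoff' {h : N} (hh : 0 ≤ h) :
    ContinuousOn (fun x : ℝ => 1 - (1 + x)⁻¹) (spectrum ℝ (h : H →L[ℂ] H)) := by
  simpa using continuousOn_cutoff hh zero_le_one

theorem cutoff_nonneg {h : N} (hh : 0 ≤ h) : 0 ≤ cutoff h := by
  have := fc_le_fc hh continuousOn_const (continuousOn_cutoff' hh) (f := fun _ => 0) fun x hx => by
    have := spectrum_nonneg' hh x hx
    rw [sub_nonneg]
    exact inv_le_one_of_one_le₀ (by linarith)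
  rwa [fc_const 0 hh, zero_smul] at this

theorem cutoff_le_one {h : N} (hh : 0 ≤ h) : cutoff h ≤ 1 := by
  have := fc_le_fc hh (continuousOn_cutoff' hh) continuousOn_const (g := fun _ => 1) fun x hx => by
    have := spectrum_nonneg' hh x hx
    rw [sub_le_self_iff]
    positivity
  rwa [fc_const 1 hh, one_smul] at this

theorem cutoff_le_self {h : N} (hh : 0 ≤ h) : cutoff h ≤ h := by
  have := fc_le_fc hh (continuousOn_cutoff' hh) continuousOn_id (g := fun x => x) fun x hx => by
    have := spectrum_nonneg' hh x hx
    have h1 : 1 - (1 + x)⁻¹ = x * (1 + x)⁻¹ := by field_simp; ring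
    rw [h1]
    exact mul_le_of_le_one_right this (inv_le_one_of_one_le₀ (by linarith))
  rwa [fc_id hh] at this

/-- Operator monotonicity, which `x ↦ min x 1` lacks, is what keeps truncated families directed. -/
theorem cutoff_mono {h k : N} (hh : 0 ≤ h) (hhk : h ≤ k) : cutoff h ≤ cutoff k := by
  have hk : 0 ≤ k := hh.trans hhk
  have := CFC.monotoneOn_one_sub_one_add_inv_real (A := H →L[ℂ] H) (a := (h : H →L[ℂ] H)) hh
    (b := (k : H →L[ℂ] H)) hk hhk
  have e : ∀ {l : N}, 0 ≤ l → cfcₙ (fun x : ℝ => 1 - (1 + x)⁻¹) (l : H →L[ℂ] H) =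
      (cutoff l : H →L[ℂ] H) := fun {l} hl =>
    cfcₙ_eq_cfc (a := (l : H →L[ℂ] H)) (continuousOn_const.sub
      (ContinuousOn.inv₀ (by fun_prop) fun x hx => by
        have := quasispectrum_nonneg_of_nonneg (A := H →L[ℂ] H) l hl x hx
        positivity)) (by simp)
  simp only [e hh, e hk] at this
  exact this

theorem le_smul_cutoff {h : N} (hh : 0 ≤ h) {M : ℝ} (hM : h ≤ M • (1 : N)) :
    h ≤ (1 + M) • cutoff h := by
  have e : (1 + M) • cutoff h = fc (fun x => (1 + M) * (1 - (1 + x)⁻¹)) h := by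
    apply Subtype.ext
    exact (cfc_const_mul (1 + M) _ (h : H →L[ℂ] H) (continuousOn_cutoff' hh)).symm
  rw [e]
  nth_rewrite 1 [← fc_id hh]
  refine fc_le_fc hh continuousOn_id (continuousOn_const.mul (continuousOn_cutoff' hh))
    fun x hx => ?_
  have h0 := spectrum_nonneg' hh x hx
  have h1 : x ≤ M := by
    have h2 : (h : H →L[ℂ] H) ≤ algebraMap ℝ (H →L[ℂ] H) M := by
      rw [Algebra.algebraMap_eq_smul_one]; exact hM
    exact (le_algebraMap_iff_spectrum_le (isSelfAdjoint_coe hh)).1 h2 x hx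
  have h3 : (1 + M) * (1 - (1 + x)⁻¹) - x = x * (M - x) * (1 + x)⁻¹ := by field_simp; ring
  have : 0 ≤ x * (M - x) * (1 + x)⁻¹ :=
    mul_nonneg (mul_nonneg h0 (sub_nonneg.2 h1)) (by positivity)
  linarith

/-- The hypothesis says `x ≤ (1 + K x)⁻¹` on the spectrum for every `K > 0`, which leaves only `x =
0`. It serves to show that truncations of elements of finite trace increase to `1`. -/
theorem eq_zero_of_le_one_sub_cutoff {y : N} (hy : 0 ≤ y)
    (h : ∀ K : ℝ, 0 < K → y ≤ 1 - cutoff (K • y)) : y = 0 := by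
  have hspec : ∀ x ∈ spectrum ℝ (y : H →L[ℂ] H), x = 0 := by
    intro x hx
    have h0 := spectrum_nonneg' hy x hx
    have key : ∀ K : ℝ, 0 < K → x ≤ (1 + K * x)⁻¹ := by
      intro K hK
      have e : 1 - cutoff (K • y) = fc (fun x => 1 - (1 - (1 + K * x)⁻¹)) y := by
        apply Subtype.ext
        have e1 : ((cutoff (K • y) : N) : H →L[ℂ] H) =
            cfc (fun x => 1 - (1 + K * x)⁻¹) (y : H →L[ℂ] H) := by
          refine (cfc_comp_const_mul K (fun x : ℝ => 1 - (1 + x)⁻¹) (y : H →L[ℂ] H) ?_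
            (isSelfAdjoint_coe hy)).symm
          refine continuousOn_const.sub (ContinuousOn.inv₀ (by fun_prop) ?_)
          rintro _ ⟨x, hx, rfl⟩
          have := mul_nonneg hK.le (spectrum_nonneg' hy x hx)
          dsimp only
          positivity
        have e2 := cfc_sub (fun _ : ℝ => (1 : ℝ)) (fun x => 1 - (1 + K * x)⁻¹) (y : H →L[ℂ] H)
          continuousOn_const (continuousOn_cutoff hy hK.le)
        have e3 := cfc_const_one ℝ (y : H →L[ℂ] H) (isSelfAdjoint_coe hy)
        rw [e3] at e2
        refine Eq.trans ?_ e2.symm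
        rw [← e1]
        rfl
      have h1 := h K hK
      rw [e] at h1
      nth_rewrite 1 [← fc_id hy] at h1
      have := (cfc_le_iff (fun x => x) _ (y : H →L[ℂ] H) continuousOn_id
        (continuousOn_const.sub (continuousOn_cutoff hy hK.le)) (isSelfAdjoint_coe hy)).1 h1 x hx
      simpa using this
    by_contra hne
    have hpos : 0 < x := lt_of_le_of_ne h0 (Ne.symm hne)
    -- This `K` turns the bound into `x ≤ x / (x + 1)`, which is false for `x > 0`.
    have h2 := key (1 / x ^ 2) (by positivity)
    have h3 : 1 + 1 / x ^ 2 * x = (x + 1) / x := by field_simp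
    rw [h3, inv_div, le_div_iff₀ (by positivity)] at h2
    nlinarith
  apply Subtype.ext
  exact CFC.eq_zero_of_spectrum_subset_zero (R := ℝ) (y : H →L[ℂ] H)
    (fun x hx => hspec x hx) (isSelfAdjoint_coe hy)

/-- Positive elements of `N` have square roots in `N`. -/
theorem exists_sqrt {y : N} (hy : 0 ≤ y) : ∃ d : N, star d = d ∧ star d * d = y := by
  have hs : IsSelfAdjoint (fc Real.sqrt y : H →L[ℂ] H) :=
    IsSelfAdjoint.cfc (f := Real.sqrt) (a := (y : H →L[ℂ] H))
  have hs' : star (fc Real.sqrt y) = fc Real.sqrt y := Subtype.ext hs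
  refine ⟨fc Real.sqrt y, hs', ?_⟩
  rw [hs']
  apply Subtype.ext
  have h1 := cfc_mul Real.sqrt Real.sqrt (y : H →L[ℂ] H) Real.continuous_sqrt.continuousOn
    Real.continuous_sqrt.continuousOn
  refine h1.symm.trans ?_
  have h2 : (spectrum ℝ (y : H →L[ℂ] H)).EqOn (fun x => √x * √x) fun x => x := fun x hx =>
    Real.mul_self_sqrt (spectrum_nonneg' hy x hx)
  rw [cfc_congr h2]
  exact cfc_id' ℝ (y : H →L[ℂ] H) (isSelfAdjoint_coe hy)

/-! ### Elementary properties of the trace -/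

namespace NSFTrace

variable (τ : NSFTrace N)

theorem map_real_smul {c : ℝ} (hc : 0 ≤ c) {x : N} (hx : 0 ≤ x) :
    τ.toFun (c • x) = ENNReal.ofReal c * τ.toFun x := by
  have := τ.map_smul ⟨c, hc⟩ x hx
  rw [ENNReal.ofReal, Real.toNNReal_of_nonneg hc]
  exact this

theorem map_sum {ι : Type*} (s : Finset ι) (f : ι → N) (hf : ∀ i ∈ s, 0 ≤ f i) :
    τ.toFun (∑ i ∈ s, f i) = ∑ i ∈ s, τ.toFun (f i) := by
  classical
  induction s using Finset.induction_on with
  | empty => simp [τ.map_zero]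
  | insert a s ha ih =>
    rw [Finset.sum_insert ha, Finset.sum_insert ha,
      τ.map_add _ _ (hf a (Finset.mem_insert_self a s))
        (Finset.sum_nonneg fun i hi => hf i (Finset.mem_insert_of_mem hi)),
      ih fun i hi => hf i (Finset.mem_insert_of_mem hi)]

theorem sq_mul_left_le (x a : N) :
    τ.toFun (star (x * a) * (x * a)) ≤ ENNReal.ofReal (‖x‖ ^ 2) * τ.toFun (star a * a) := by
  rw [← τ.map_real_smul (by positivity) (star_mul_self_nonneg' a)]
  refine τ.mono (star_mul_self_nonneg' _) ?_
  rw [le_iff_mc]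
  intro ξ
  have h := le_iff_mc.1 (star_mul_self_le_of_norm_le (le_refl ‖x‖)) ((a : H →L[ℂ] H) ξ)
  have e1 : mc (star (x * a) * (x * a)) ξ ξ =
      mc (star x * x) ((a : H →L[ℂ] H) ξ) ((a : H →L[ℂ] H) ξ) := by
    rw [mc_star_mul_self, mc_star_mul_self]; rfl
  have e2 : mc (star a * a) ξ ξ = mc (1 : N) ((a : H →L[ℂ] H) ξ) ((a : H →L[ℂ] H) ξ) := by
    rw [mc_star_mul]; rfl
  rw [e1, mc_real_smul, e2, ← mc_real_smul]
  exact h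

theorem sq_mul_right_le (x a : N) :
    τ.toFun (star (a * x) * (a * x)) ≤ ENNReal.ofReal (‖x‖ ^ 2) * τ.toFun (star a * a) := by
  have h := τ.sq_mul_left_le (star x) (star a)
  have e : ‖star x‖ = ‖x‖ := norm_star (x : H →L[ℂ] H)
  rw [e, ← star_mul, star_star, ← τ.tracial, star_star, ← τ.tracial] at h
  exact h

theorem sq_star (a : N) : τ.toFun (star (star a) * star a) = τ.toFun (star a * a) := by
  rw [star_star, ← τ.tracial]

end NSFTrace

/-! ### Domination by small elements -/

theorem sum_geometric_le (k m : ℕ) :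
    ∑ n ∈ Finset.Ico k m, (2 : ℝ) ^ (n + 1) * (1 / 8) ^ n ≤ 4 * (1 / 4) ^ k := by
  have h : ∀ n : ℕ, (2 : ℝ) ^ (n + 1) * (1 / 8) ^ n = 2 * (1 / 4) ^ n := fun n => by
    rw [pow_succ, show (1 / 4 : ℝ) = 2 * (1 / 8) by norm_num, mul_pow]; ring
  simp only [h, ← Finset.mul_sum]
  have := geom_sum_Ico_le_of_lt_one (x := (1 / 4 : ℝ)) (m := k) (n := m) (by norm_num) (by norm_num)
  have h4 : (0 : ℝ) < (1 / 4) ^ k := by positivity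
  have h5 : (1 / 4 : ℝ) ^ k / (1 - 1 / 4) = 4 / 3 * (1 / 4) ^ k := by ring
  rw [h5] at this
  linarith

/-- A substitute for Egorov's theorem. The weighted sums of the `|d n|²` from `k` on have trace at
most `4 · 4⁻ᵏ` but may be unbounded; `Y k` is the supremum of their cutoffs, and normality carries
the trace bound over to it. Nothing is lost on bounded elements: if `‖y‖ ≤ M` then `|y|² ≤ (1 + M²)
cutoff(|y|²)`, so domination by a partial sum becomes domination by `Y k`. -/
theorem exists_dominating (τ : NSFTrace N) (d : ℕ → N)
    (hd : ∀ n, τ.toFun (star (d n) * d n) ≤ ENNReal.ofReal ((1 / 8) ^ n)) :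
    ∃ Y : ℕ → N, Antitone Y ∧ (∀ k, 0 ≤ Y k) ∧ (∀ k, Y k ≤ 1) ∧
      (∀ k, τ.toFun (Y k) ≤ ENNReal.ofReal (4 * (1 / 4) ^ k)) ∧
      ∀ (k m : ℕ) (y : N) (M : ℝ), ‖y‖ ≤ M →
        star y * y ≤ ∑ n ∈ Finset.Ico k m, ((2 : ℝ) ^ (n + 1)) • (star (d n) * d n) →
        star y * y ≤ (1 + M ^ 2) • Y k := by
  let S : ℕ → ℕ → N := fun k m => ∑ n ∈ Finset.Ico k m, ((2 : ℝ) ^ (n + 1)) • (star (d n) * d n)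
  have hterm : ∀ n, (0 : N) ≤ ((2 : ℝ) ^ (n + 1)) • (star (d n) * d n) := fun n =>
    smul_nonneg' ⟨(2 : ℝ) ^ (n + 1), by positivity⟩ (star_mul_self_nonneg' (d n))
  have hS0 : ∀ k m, 0 ≤ S k m := fun k m => Finset.sum_nonneg fun n _ => hterm n
  have hSm : ∀ k, Monotone (S k) := fun k m m' hm =>
    Finset.sum_le_sum_of_subset_of_nonneg (Finset.Ico_subset_Ico_right hm) fun n _ _ => hterm n
  have hSk : ∀ m, Antitone fun k => S k m := fun m k k' hk =>
    Finset.sum_le_sum_of_subset_of_nonneg (Finset.Ico_subset_Ico_left hk) fun n _ _ => hterm n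
  have hSτ : ∀ k m, τ.toFun (S k m) ≤ ENNReal.ofReal (4 * (1 / 4) ^ k) := by
    intro k m
    rw [τ.map_sum _ _ fun n _ => hterm n]
    refine le_trans (Finset.sum_le_sum fun n _ => ?_)
      ((ENNReal.ofReal_sum_of_nonneg fun n _ => by positivity).symm.trans_le
        (ENNReal.ofReal_le_ofReal (sum_geometric_le k m)))
    rw [τ.map_real_smul (by positivity) (star_mul_self_nonneg' _),
      ENNReal.ofReal_mul (by positivity)]
    gcongr
    exact hd n
  let D : ℕ → Set N := fun k => range fun m => cutoff (S k m)
  have hmono : ∀ k, Monotone fun m => cutoff (S k m) := fun k m m' hm =>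
    cutoff_mono (hS0 k m) (hSm k hm)
  have hdir : ∀ k, DirectedOn (· ≤ ·) (D k) := fun k =>
    directedOn_range.2 (hmono k).directed_le
  have hD0 : ∀ k, ∀ y ∈ D k, 0 ≤ y := by
    rintro k _ ⟨m, rfl⟩
    exact cutoff_nonneg (hS0 k m)
  have hD1 : ∀ k, ∀ y ∈ D k, y ≤ 1 := by
    rintro k _ ⟨m, rfl⟩
    exact cutoff_le_one (hS0 k m)
  choose Y hY _ using fun k =>
    exists_isLUB_of_directed (D k) (range_nonempty _) (hD0 k) (hdir k) 1 (hD1 k)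
  have hle : ∀ k m, cutoff (S k m) ≤ Y k := fun k m => (hY k).1 ⟨m, rfl⟩
  refine ⟨Y, ?_, ?_, ?_, ?_, ?_⟩
  · intro k k' hk
    refine (hY k').2 ?_
    rintro _ ⟨m, rfl⟩
    exact (cutoff_mono (hS0 k' m) (hSk m hk)).trans (hle k m)
  · exact fun k => (cutoff_nonneg (hS0 k 0)).trans (hle k 0)
  · exact fun k => (hY k).2 (hD1 k)
  · intro k
    rw [τ.normal (D k) (Y k) (range_nonempty _) (hD0 k) (hdir k) (hY k)]
    refine iSup₂_le ?_
    rintro _ ⟨m, rfl⟩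
    exact (τ.mono (cutoff_nonneg (hS0 k m)) (cutoff_le_self (hS0 k m))).trans (hSτ k m)
  · intro k m y M hM hy
    have h0 := star_mul_self_nonneg' y
    have h1 := le_smul_cutoff h0 (star_mul_self_le_of_norm_le hM)
    refine h1.trans ?_
    have h2 : cutoff (star y * y) ≤ Y k := (cutoff_mono h0 hy).trans (hle k m)
    have h3 := smul_nonneg' ⟨1 + M ^ 2, by positivity⟩ (sub_nonneg.2 h2)
    rw [smul_sub, sub_nonneg] at h3
    exact h3

variable {τ : NSFTrace N}

theorem real_smul_nonneg {c : ℝ} (hc : 0 ≤ c) {x : N} (hx : 0 ≤ x) : 0 ≤ c • x :=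
  smul_nonneg' ⟨c, hc⟩ hx

/-! ### `N ∩ L₂` as an inner product space -/

namespace L2Pre

/-- An element of `N ∩ L₂`. -/
def mk (x : N) (h : τ.toFun (star x * x) < ∞) : L2Pre τ := (⟨x, h⟩ : squareIntegrable τ)

/-- The inclusion of `N ∩ L₂` into `N`. -/
def valₗ : L2Pre τ →ₗ[ℂ] N := (squareIntegrable τ).subtype

theorem val_add (a b : L2Pre τ) : (a + b).val = a.val + b.val := rfl

theorem val_sub (a b : L2Pre τ) : (a - b).val = a.val - b.val := rfl

theorem val_injective : Function.Injective (L2Pre.val (τ := τ)) := Subtype.val_injective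

theorem ofReal_norm_sq (a : L2Pre τ) :
    ENNReal.ofReal (‖a‖ ^ 2) = τ.toFun (star a.val * a.val) := by
  rw [norm_sq, ENNReal.ofReal_toReal a.lt_top.ne]

theorem norm_le_of_trace_le {a : L2Pre τ} {C : ℝ} (hC : 0 ≤ C)
    (h : τ.toFun (star a.val * a.val) ≤ ENNReal.ofReal (C ^ 2)) : ‖a‖ ≤ C := by
  rw [← ofReal_norm_sq, ENNReal.ofReal_le_ofReal_iff (by positivity)] at h
  exact abs_le_of_sq_le_sq' h hC |>.2

/-- Left multiplication by an element of `N`. -/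
def lmul (x : N) (a : L2Pre τ) : L2Pre τ :=
  mk (x * a.val) ((τ.sq_mul_left_le x a.val).trans_lt
    (ENNReal.mul_lt_top ENNReal.ofReal_lt_top a.lt_top))

/-- Right multiplication by an element of `N`. -/
def rmul (x : N) (a : L2Pre τ) : L2Pre τ :=
  mk (a.val * x) ((τ.sq_mul_right_le x a.val).trans_lt
    (ENNReal.mul_lt_top ENNReal.ofReal_lt_top a.lt_top))

theorem lmul_val (x : N) (a : L2Pre τ) : (lmul x a).val = x * a.val := rfl

theorem rmul_val (x : N) (a : L2Pre τ) : (rmul x a).val = a.val * x := rfl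

theorem norm_lmul_le (x : N) (a : L2Pre τ) : ‖lmul x a‖ ≤ ‖x‖ * ‖a‖ := by
  refine norm_le_of_trace_le (by positivity) ((τ.sq_mul_left_le x a.val).trans_eq ?_)
  rw [mul_pow, ENNReal.ofReal_mul (by positivity), ofReal_norm_sq]

theorem norm_rmul_le (x : N) (a : L2Pre τ) : ‖rmul x a‖ ≤ ‖x‖ * ‖a‖ := by
  refine norm_le_of_trace_le (by positivity) ((τ.sq_mul_right_le x a.val).trans_eq ?_)
  rw [mul_pow, ENNReal.ofReal_mul (by positivity), ofReal_norm_sq]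

theorem toReal_trace_add {x y : N} (hx : 0 ≤ x) (hy : 0 ≤ y) (hx' : τ.toFun x ≠ ∞)
    (hy' : τ.toFun y ≠ ∞) :
    (τ.toFun (x + y)).toReal = (τ.toFun x).toReal + (τ.toFun y).toReal := by
  rw [τ.map_add x y hx hy, ENNReal.toReal_add hx' hy']

theorem parallelogram (a b : L2Pre τ) :
    ‖a + b‖ * ‖a + b‖ + ‖a - b‖ * ‖a - b‖ = 2 * (‖a‖ * ‖a‖ + ‖b‖ * ‖b‖) := by
  simp only [← sq]
  rw [norm_sq, norm_sq, norm_sq, norm_sq,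
    ← toReal_trace_add (star_mul_self_nonneg' _) (star_mul_self_nonneg' _)
      (a + b).lt_top.ne (a - b).lt_top.ne]
  have e : star (a + b).val * (a + b).val + star (a - b).val * (a - b).val =
      (star a.val * a.val + star b.val * b.val) + (star a.val * a.val + star b.val * b.val) := by
    rw [val_add, val_sub, star_add, star_sub]
    noncomm_ring
  have h0 := add_nonneg (star_mul_self_nonneg' a.val) (star_mul_self_nonneg' b.val)
  have hfin : τ.toFun (star a.val * a.val + star b.val * b.val) ≠ ∞ := by
    rw [τ.map_add _ _ (star_mul_self_nonneg' _) (star_mul_self_nonneg' _)]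
    exact ENNReal.add_ne_top.2 ⟨a.lt_top.ne, b.lt_top.ne⟩
  rw [e, toReal_trace_add h0 h0 hfin hfin, toReal_trace_add (star_mul_self_nonneg' _)
    (star_mul_self_nonneg' _) a.lt_top.ne b.lt_top.ne]
  ring

/-- The trace is only given on the positive cone, so `τ(a* b)` is recovered from the norm by the
Jordan–von Neumann theorem. The fields are copied one by one in order to keep the existing normed
structure. -/
instance : InnerProductSpace ℂ (L2Pre τ) :=
  let I := InnerProductSpace.ofNorm ℂ (parallelogram (τ := τ))
  { (inferInstance : NormedSpace ℂ (L2Pre τ)) with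
    inner := I.inner
    norm_sq_eq_re_inner := I.norm_sq_eq_re_inner
    conj_inner_symm := I.conj_inner_symm
    add_left := I.add_left
    smul_left := I.smul_left }

theorem re_inner_eq (a b : L2Pre τ) :
    (⟪a, b⟫_ℂ).re = (‖a + b‖ ^ 2 - ‖a - b‖ ^ 2) / 4 := by
  have := re_inner_eq_norm_add_mul_self_sub_norm_sub_mul_self_div_four (𝕜 := ℂ) a b
  rw [sq, sq]
  exact this

/-- After polarization and transposition of the negative terms, this is the trace of an identity
between sums of positive operators: the mixed terms of `|r a + b|² + |a - r* b|²` cancel. Only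
additivity of `τ` on the positive cone is used. -/
theorem re_inner_lmul (r : N) (a b : L2Pre τ) :
    (⟪lmul r a, b⟫_ℂ).re = (⟪a, lmul (star r) b⟫_ℂ).re := by
  rw [re_inner_eq, re_inner_eq]
  congr 1
  rw [sub_eq_sub_iff_add_eq_add, norm_sq, norm_sq, norm_sq, norm_sq,
    ← toReal_trace_add (star_mul_self_nonneg' _) (star_mul_self_nonneg' _)
      (lt_top _).ne (lt_top _).ne,
    ← toReal_trace_add (star_mul_self_nonneg' _) (star_mul_self_nonneg' _)
      (lt_top _).ne (lt_top _).ne]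
  congr 2
  simp only [val_add, val_sub, lmul_val, star_add, star_sub, star_mul, star_star]
  noncomm_ring

/-- The adjoint of an element of `N ∩ L₂`. -/
def adj (a : L2Pre τ) : L2Pre τ :=
  mk (star a.val) (by rw [τ.sq_star]; exact a.lt_top)

theorem adj_val (a : L2Pre τ) : (adj a).val = star a.val := rfl

/-- `τ(b x b*) = ⟨b*, x b*⟩` for positive `x`. -/
theorem trace_conj_eq (b : L2Pre τ) {x : N} (hx : 0 ≤ x) :
    τ.toFun (b.val * x * star b.val) =
      ENNReal.ofReal (⟪adj b, lmul x (adj b)⟫_ℂ).re := by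
  obtain ⟨d, hd, rfl⟩ := exists_sqrt hx
  have e : lmul (star d * d) (adj b) = lmul (star d) (lmul d (adj b)) :=
    val_injective (mul_assoc _ _ _)
  have e2 : (⟪lmul d (adj b), lmul d (adj b)⟫_ℂ).re = ‖lmul d (adj b)‖ ^ 2 :=
    inner_self_eq_norm_sq (𝕜 := ℂ) (lmul d (adj b))
  rw [e, ← re_inner_lmul, e2, ofReal_norm_sq, lmul_val, adj_val, star_mul, star_star]
  simp only [mul_assoc]

end L2Pre

/-! ### The topology of `L₂` on bounded subsets of `N` -/

/-- Cauchy–Schwarz applied to each vector, with the weights `2^{-(n+1)}`, whose sum is at most `1`.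
-/
theorem star_sum_mul_sum_le (d : ℕ → N) (k m : ℕ) :
    star (∑ n ∈ Finset.Ico k m, d n) * (∑ n ∈ Finset.Ico k m, d n) ≤
      ∑ n ∈ Finset.Ico k m, ((2 : ℝ) ^ (n + 1)) • (star (d n) * d n) := by
  rw [le_iff_mc]
  intro ξ
  have e1 : ∀ (s : Finset ℕ) (f : ℕ → N), mc (∑ n ∈ s, f n) ξ ξ = ∑ n ∈ s, mc (f n) ξ ξ := by
    intro s f
    induction s using Finset.induction_on with
    | empty => simp [mc_zero]
    | insert a s ha ih => rw [Finset.sum_insert ha, Finset.sum_insert ha, mc_add, ih]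
  have e2 : ((∑ n ∈ Finset.Ico k m, d n : N) : H →L[ℂ] H) ξ =
      ∑ n ∈ Finset.Ico k m, (d n : H →L[ℂ] H) ξ := by
    have : ((∑ n ∈ Finset.Ico k m, d n : N) : H →L[ℂ] H) =
        ∑ n ∈ Finset.Ico k m, (d n : H →L[ℂ] H) := AddSubmonoidClass.coe_finsetSum _ _
    rw [this, sum_apply]
  rw [e1, mc_star_mul_self, e2]
  simp only [mc_real_smul, mc_star_mul_self]
  have h1 : ‖∑ n ∈ Finset.Ico k m, (d n : H →L[ℂ] H) ξ‖ ^ 2 ≤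
      (∑ n ∈ Finset.Ico k m, ‖(d n : H →L[ℂ] H) ξ‖) ^ 2 := by
    gcongr
    exact norm_sum_le _ _
  have h2 : (∑ n ∈ Finset.Ico k m, ‖(d n : H →L[ℂ] H) ξ‖) ^ 2 ≤
      (∑ n ∈ Finset.Ico k m, (1 / 2 : ℝ) ^ (n + 1)) *
        ∑ n ∈ Finset.Ico k m, (2 : ℝ) ^ (n + 1) * ‖(d n : H →L[ℂ] H) ξ‖ ^ 2 :=
    Finset.sum_sq_le_sum_mul_sum_of_sq_le_mul _ (fun n _ => by positivity)
      (fun n _ => by positivity) fun n _ => by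
        rw [← mul_assoc, ← mul_pow]; norm_num
  have h3 : ∑ n ∈ Finset.Ico k m, (1 / 2 : ℝ) ^ (n + 1) ≤ 1 := by
    have h4 := geom_sum_Ico_le_of_lt_one (x := (1 / 2 : ℝ)) (m := k) (n := m) (by norm_num)
      (by norm_num)
    have h5 : (1 / 2 : ℝ) ^ k ≤ 1 := pow_le_one₀ (by norm_num) (by norm_num)
    simp only [pow_succ, ← Finset.sum_mul]
    have h6 : (1 / 2 : ℝ) ^ k / (1 - 1 / 2) = 2 * (1 / 2) ^ k := by ring
    rw [h6] at h4
    linarith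
  have h4 : ‖∑ n ∈ Finset.Ico k m, (d n : H →L[ℂ] H) ξ‖ ^ 2 ≤
      ∑ n ∈ Finset.Ico k m, (2 : ℝ) ^ (n + 1) * ‖(d n : H →L[ℂ] H) ξ‖ ^ 2 :=
    (h1.trans h2).trans (mul_le_of_le_one_left (Finset.sum_nonneg fun n _ => by positivity) h3)
  exact_mod_cast h4

theorem tendsto_zero_of_subseq_trace_le {z : ℕ → L2Pre τ} {C : ℝ}
    (h : ∀ k, τ.toFun (star (z k).val * (z k).val) ≤ ENNReal.ofReal (C * (1 / 4) ^ k)) :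
    Tendsto z atTop (𝓝 0) := by
  have h1 : Tendsto (fun k => ‖z k‖ ^ 2) atTop (𝓝 0) := by
    have h2 : Tendsto (fun k : ℕ => max (C * (1 / 4) ^ k) 0) atTop (𝓝 0) := by
      have := ((tendsto_pow_atTop_nhds_zero_of_lt_one (r := (1 / 4 : ℝ)) (by norm_num)
        (by norm_num)).const_mul C).max (tendsto_const_nhds (x := (0 : ℝ)))
      simpa using this
    refine squeeze_zero (fun k => by positivity) (fun k => ?_) h2
    have := h k
    rw [← L2Pre.ofReal_norm_sq, ENNReal.ofReal_le_ofReal_iff'] at this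
    rcases this with h | h
    · exact h.trans (le_max_left _ _)
    · exact h.trans (le_max_right _ _)
  rw [tendsto_zero_iff_norm_tendsto_zero]
  have := h1.sqrt
  simpa [Real.sqrt_sq (norm_nonneg _)] using this

/-- The inclusion of bounded subsets of `N` with the weak operator topology into `L₂` is
closable. -/
theorem tendsto_zero_of_cauchySeq {y : ℕ → L2Pre τ} {M : ℝ} (hM : ∀ n, ‖(y n).val‖ ≤ M)
    (hC : CauchySeq y) (hw : ∀ ξ η, Tendsto (fun n => mc (y n).val ξ η) atTop (𝓝 0)) :
    Tendsto y atTop (𝓝 0) := by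
  -- The increments of the subsequence are at most `3⁻ⁿ` in `‖·‖₂`, so their squares are at most
  -- `9⁻ⁿ ≤ 8⁻ⁿ`, as `exists_dominating` requires.
  obtain ⟨f, hf, hfd⟩ := Metric.exists_subseq_bounded_of_cauchySeq y hC (fun n => (1 / 3 : ℝ) ^ n)
    fun n => by positivity
  refine tendsto_nhds_of_cauchySeq_of_subseq hC hf.tendsto_atTop ?_
  have hM0 : 0 ≤ M := (norm_nonneg _).trans (hM 0)
  set z : ℕ → L2Pre τ := y ∘ f with hz
  have hd : ∀ n, τ.toFun (star (z (n + 1) - z n).val * (z (n + 1) - z n).val) ≤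
      ENNReal.ofReal ((1 / 8) ^ n) := by
    intro n
    rw [← L2Pre.ofReal_norm_sq]
    refine ENNReal.ofReal_le_ofReal ?_
    have h1 := hfd n (f (n + 1)) (hf.monotone (Nat.le_succ n))
    rw [dist_eq_norm] at h1
    calc ‖z (n + 1) - z n‖ ^ 2 ≤ ((1 / 3 : ℝ) ^ n) ^ 2 := by gcongr; exact h1.le
      _ = (1 / 9) ^ n := by rw [← pow_mul, mul_comm, pow_mul]; norm_num
      _ ≤ (1 / 8) ^ n := by gcongr; norm_num
  obtain ⟨Y, -, hY0, -, hYτ, hY⟩ := exists_dominating τ (fun n => (z (n + 1) - z n).val) hd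
  have hdiff : ∀ k m, k ≤ m →
      star ((z m).val - (z k).val) * ((z m).val - (z k).val) ≤ (1 + (2 * M) ^ 2) • Y k := by
    intro k m hkm
    have e : (z m).val - (z k).val = ∑ n ∈ Finset.Ico k m, (z (n + 1) - z n).val := by
      simp only [L2Pre.val_sub]
      rw [Finset.sum_Ico_sub (fun n => (z n).val) hkm]
    refine hY k m _ (2 * M) ?_ ?_
    · refine (norm_sub_le _ _).trans ?_
      have h1 := hM (f m)
      have h2 := hM (f k)
      simp only [hz, Function.comp]
      linarith
    · rw [e]
      exact star_sum_mul_sum_le _ _ _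
  -- Lower semicontinuity: in the bound for `|z m - z k|²`, `z m` tends weakly to `0` as `m → ∞`, so
  -- the same bound holds for `|z k|²`. Its trace tends to `0`.
  have hfin : ∀ k, star (z k).val * (z k).val ≤ (1 + (2 * M) ^ 2) • Y k := by
    intro k
    rw [le_iff_mc]
    intro ξ
    set c : ℝ := (mc ((1 + (2 * M) ^ 2) • Y k) ξ ξ).re with hc
    have hY0' : 0 ≤ (1 + (2 * M) ^ 2) • Y k := real_smul_nonneg (by positivity) (hY0 k)
    have hc' : mc ((1 + (2 * M) ^ 2) • Y k) ξ ξ = c :=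
      (Complex.eq_re_of_ofReal_le (r := 0) (by simpa using nonneg_iff_mc.1 hY0' ξ))
    have hc0 : 0 ≤ c := by
      have := nonneg_iff_mc.1 hY0' ξ
      rw [hc'] at this
      exact_mod_cast this
    set v := ((z k).val : H →L[ℂ] H) ξ with hv
    have hlim : Tendsto (fun m => ⟪v, ((z k).val : H →L[ℂ] H) ξ - ((z m).val : H →L[ℂ] H) ξ⟫_ℂ)
        atTop (𝓝 (⟪v, v⟫_ℂ)) := by
      have h1 := (hw v ξ).comp hf.tendsto_atTop
      have h2 := (tendsto_const_nhds (x := ⟪v, v⟫_ℂ)).sub h1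
      rw [sub_zero] at h2
      refine h2.congr fun m => ?_
      rw [inner_sub_right]
      rfl
    have hbd : ‖⟪v, v⟫_ℂ‖ ≤ ‖v‖ * √c := by
      refine le_of_tendsto hlim.norm ?_
      filter_upwards [eventually_ge_atTop k] with m hm
      refine (norm_inner_le_norm _ _).trans ?_
      gcongr
      refine Real.le_sqrt_of_sq_le ?_
      have := norm_sq_apply_le (hdiff k m hm) ξ
      rw [norm_sub_rev]
      exact this
    have hvv : ‖⟪v, v⟫_ℂ‖ = ‖v‖ ^ 2 := by
      rw [inner_self_eq_norm_sq_to_K]; simp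
    rw [hvv] at hbd
    have h5 : ‖v‖ ≤ √c := by
      rcases (norm_nonneg v).eq_or_lt with h0 | h0
      · rw [← h0]; positivity
      · nlinarith
    have h6 : ‖v‖ ^ 2 ≤ c := by
      rw [← Real.sq_sqrt hc0]; gcongr
    rw [mc_star_mul_self, hc']
    exact_mod_cast h6
  refine tendsto_zero_of_subseq_trace_le (C := (1 + (2 * M) ^ 2) * 4) fun k => ?_
  refine (τ.mono (star_mul_self_nonneg' _) (hfin k)).trans ?_
  rw [τ.map_real_smul (by positivity) (hY0 k), mul_assoc, ENNReal.ofReal_mul (by positivity)]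
  gcongr
  exact hYτ k


/-! ### Convex combinations of tails of sequences -/

section ConvexCombinations

/-- The coefficients of the convex combinations of terms of index at least `m`. -/
def tailWeights (m : ℕ) : Set (ℕ →₀ ℝ) :=
  {w | (∀ n, 0 ≤ w n) ∧ Finsupp.linearCombination ℝ (fun _ => (1 : ℝ)) w = 1 ∧
    ∀ n ∈ w.support, m ≤ n}

theorem tailWeights_anti {m l : ℕ} (h : m ≤ l) : tailWeights l ⊆ tailWeights m :=
  fun _ hw => ⟨hw.1, hw.2.1, fun n hn => h.trans (hw.2.2 n hn)⟩

theorem tailWeights_midpoint {m : ℕ} {w w' : ℕ →₀ ℝ} (hw : w ∈ tailWeights m)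
    (hw' : w' ∈ tailWeights m) : (1 / 2 : ℝ) • (w + w') ∈ tailWeights m := by
  refine ⟨fun n => ?_, ?_, fun n hn => ?_⟩
  · have h1 := hw.1 n
    have h2 := hw'.1 n
    simp only [Finsupp.smul_apply, Finsupp.add_apply, smul_eq_mul]
    positivity
  · rw [map_smul, map_add, hw.2.1, hw'.2.1]
    norm_num
  · have h := Finsupp.support_add (Finsupp.support_smul hn)
    rcases Finset.mem_union.1 h with h | h
    · exact hw.2.2 n h
    · exact hw'.2.2 n h

theorem norm_linearCombination_sub_le {E : Type*} [NormedAddCommGroup E] [NormedSpace ℝ E]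
    {F : ℕ → E} {c : E} {ε : ℝ} {m : ℕ} (hF : ∀ n, m ≤ n → ‖F n - c‖ ≤ ε) {w : ℕ →₀ ℝ}
    (hw : w ∈ tailWeights m) : ‖Finsupp.linearCombination ℝ F w - c‖ ≤ ε := by
  have h1 : ∑ n ∈ w.support, w n = 1 := by
    have := hw.2.1
    simpa [Finsupp.linearCombination_apply, Finsupp.sum] using this
  have e : Finsupp.linearCombination ℝ F w - c = ∑ n ∈ w.support, w n • (F n - c) := by
    simp only [smul_sub, Finset.sum_sub_distrib, ← Finset.sum_smul, h1, one_smul]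
    rfl
  rw [e]
  refine (norm_sum_le _ _).trans ?_
  calc ∑ n ∈ w.support, ‖w n • (F n - c)‖ ≤ ∑ n ∈ w.support, w n * ε := by
        refine Finset.sum_le_sum fun n hn => ?_
        rw [norm_smul, Real.norm_of_nonneg (hw.1 n)]
        exact mul_le_mul_of_nonneg_left (hF n (hw.2.2 n hn)) (hw.1 n)
    _ = ε := by rw [← Finset.sum_mul, h1, one_mul]

theorem tendsto_linearCombination {E : Type*} [NormedAddCommGroup E] [NormedSpace ℝ E]
    {F : ℕ → E} {c : E} (hF : Tendsto F atTop (𝓝 c)) {w : ℕ → ℕ →₀ ℝ}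
    (hw : ∀ m, w m ∈ tailWeights m) :
    Tendsto (fun m => Finsupp.linearCombination ℝ F (w m)) atTop (𝓝 c) := by
  rw [Metric.tendsto_atTop] at hF ⊢
  intro ε hε
  obtain ⟨m, hm⟩ := hF (ε / 2) (half_pos hε)
  refine ⟨m, fun l hl => ?_⟩
  rw [dist_eq_norm]
  refine (norm_linearCombination_sub_le (ε := ε / 2) (m := m) (fun n hn => ?_)
    (tailWeights_anti hl (hw l))).trans_lt (half_lt_self hε)
  rw [← dist_eq_norm]
  exact (hm n hn).le

/-- A bounded sequence of an inner product space has convex combinations of its tails that form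
a Cauchy sequence. -/
theorem exists_tailWeights_cauchySeq {E : Type*} [NormedAddCommGroup E] [NormedSpace ℝ E]
    (hE : ∀ x y : E, ‖x + y‖ * ‖x + y‖ + ‖x - y‖ * ‖x - y‖ = 2 * (‖x‖ * ‖x‖ + ‖y‖ * ‖y‖))
    {z : ℕ → E} {R : ℝ} (hR : ∀ n, ‖z n‖ ≤ R) :
    ∃ w : ℕ → ℕ →₀ ℝ, (∀ m, w m ∈ tailWeights m) ∧
      CauchySeq fun m => Finsupp.linearCombination ℝ z (w m) := by
  -- The infima `δ m` of the squared norms over the convex hulls of the tails increase to a finite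
  -- limit. Almost minimal elements form a Cauchy sequence, so neither completeness nor weak
  -- compactness is needed.
  let K : ℕ → Set ℝ := fun m => (fun w => ‖Finsupp.linearCombination ℝ z w‖ ^ 2) '' tailWeights m
  have hne : ∀ m, (K m).Nonempty := fun m => by
    refine ⟨_, Finsupp.single m 1, ⟨fun n => ?_, by simp, fun n hn => ?_⟩, rfl⟩
    · classical
      rw [Finsupp.single_apply]; split_ifs <;> norm_num
    · have := Finsupp.support_single_subset hn
      rw [Finset.mem_singleton] at this
      exact this.ge
  have hbdd : ∀ m, BddBelow (K m) := fun m => ⟨0, by rintro _ ⟨w, -, rfl⟩; positivity⟩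
  let δ : ℕ → ℝ := fun m => sInf (K m)
  have hδm : Monotone δ := fun m l h =>
    csInf_le_csInf (hbdd m) (hne l) (image_mono (tailWeights_anti h))
  have hδb : BddAbove (range δ) := by
    refine ⟨R ^ 2, ?_⟩
    rintro _ ⟨m, rfl⟩
    obtain ⟨_, w, hw, rfl⟩ := hne m
    refine (csInf_le (hbdd m) ⟨w, hw, rfl⟩).trans ?_
    have h1 := norm_linearCombination_sub_le (F := z) (c := 0) (ε := R) (m := m)
      (fun n _ => by simpa using hR n) hw
    rw [sub_zero] at h1
    exact pow_le_pow_left₀ (norm_nonneg _) h1 2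
  have hδl : Tendsto δ atTop (𝓝 (⨆ m, δ m)) := tendsto_atTop_ciSup hδm hδb
  have hex : ∀ m, ∃ w ∈ tailWeights m,
      ‖Finsupp.linearCombination ℝ z w‖ ^ 2 < δ m + 1 / (m + 1 : ℝ) := fun m => by
    obtain ⟨_, ⟨w, hw, rfl⟩, h⟩ := exists_lt_of_csInf_lt (hne m)
      (lt_add_of_pos_right (δ m) (by positivity : (0 : ℝ) < 1 / (m + 1 : ℝ)))
    exact ⟨w, hw, h⟩
  choose w hw hlt using hex
  refine ⟨w, hw, ?_⟩
  set L := ⨆ m, δ m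
  have hδL : ∀ m, δ m ≤ L := fun m => le_ciSup hδb m
  let b : ℕ → ℝ := fun m => √(4 * (L - δ m + 1 / (m + 1 : ℝ)))
  have hb : Tendsto b atTop (𝓝 0) := by
    have h1 : Tendsto (fun m : ℕ => 4 * (L - δ m + 1 / (m + 1 : ℝ))) atTop
        (𝓝 (4 * (L - L + 0))) :=
      ((hδl.const_sub L).add tendsto_one_div_add_atTop_nhds_zero_nat).const_mul 4
    have := h1.sqrt
    rwa [sub_self, add_zero, mul_zero, Real.sqrt_zero] at this
  refine cauchySeq_of_le_tendsto_0' b (fun m l hml => ?_) hb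
  rw [dist_eq_norm]
  refine Real.le_sqrt_of_sq_le ?_
  -- Parallelogram identity: the midpoint belongs to the `m`-th hull, so its squared norm is at
  -- least `δ m`, which forces the difference to be small.
  have h1 := hE (Finsupp.linearCombination ℝ z (w m)) (Finsupp.linearCombination ℝ z (w l))
  have h2 : δ m ≤ ‖Finsupp.linearCombination ℝ z ((1 / 2 : ℝ) • (w m + w l))‖ ^ 2 :=
    csInf_le (hbdd m) ⟨_, tailWeights_midpoint (hw m) (tailWeights_anti hml (hw l)), rfl⟩
  rw [map_smul, map_add, norm_smul, mul_pow] at h2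
  have h3 := hlt m
  have h4 := hlt l
  have h5 : (1 : ℝ) / (l + 1) ≤ 1 / (m + 1) := by
    have : (m : ℝ) ≤ l := by exact_mod_cast hml
    gcongr
  have h6 := hδL l
  have h7 := hδL m
  rw [show ‖(1 / 2 : ℝ)‖ ^ 2 = 1 / 4 by norm_num] at h2
  simp only [← sq] at h1
  linarith

end ConvexCombinations

/-! ### Normal functionals -/

/-- A hermitian positive normal functional on `N`, through its real part. -/
structure NormalFunctional (N : VonNeumannAlgebra H) where
  toFun : N →ₗ[ℝ] ℝ
  nonneg : ∀ x, 0 ≤ x → 0 ≤ toFun x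
  star_eq : ∀ x, toFun (star x) = toFun x
  normal : ∀ (D : Set N) (x : N), D.Nonempty → (∀ y ∈ D, 0 ≤ y) → DirectedOn (· ≤ ·) D →
    IsLUB D x → ∀ ε > 0, ∃ y ∈ D, toFun x - ε < toFun y

namespace NormalFunctional

variable (ρ : NormalFunctional N)

theorem mono {x y : N} (h : x ≤ y) : ρ.toFun x ≤ ρ.toFun y := by
  have := ρ.nonneg _ (sub_nonneg.2 h)
  rwa [map_sub, sub_nonneg] at this

theorem cauchy_schwarz (a b : N) :
    ρ.toFun (star a * b) ^ 2 ≤ ρ.toFun (star a * a) * ρ.toFun (star b * b) := by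
  let B : LinearMap.BilinForm ℝ N := LinearMap.mk₂ ℝ (fun a b => ρ.toFun (star a * b))
    (fun a a' b => by rw [star_add, add_mul, map_add])
    (fun c a b => by
      have : star (c • a) = c • star a := by
        change star ((c : ℂ) • a) = (c : ℂ) • star a
        rw [star_smul, RCLike.star_def, Complex.conj_ofReal]
      rw [this, smul_mul_assoc, map_smul])
    (fun a b b' => by rw [mul_add, map_add])
    (fun c a b => by rw [mul_smul_comm, map_smul])
  refine LinearMap.BilinForm.apply_sq_le_of_symm B
    (fun a => ρ.nonneg _ (star_mul_self_nonneg' a)) ⟨fun a b => ?_⟩ a b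
  change ρ.toFun (star a * b) = ρ.toFun (star b * a)
  rw [← ρ.star_eq, star_mul, star_star]

theorem one_nonneg : 0 ≤ ρ.toFun 1 := by
  have := ρ.nonneg _ (star_mul_self_nonneg' (1 : N))
  rwa [star_one, one_mul] at this

theorem abs_le (x : N) : |ρ.toFun x| ≤ ρ.toFun 1 * ‖x‖ := by
  have h1 := ρ.cauchy_schwarz 1 x
  rw [star_one, one_mul, one_mul] at h1
  have h2 := ρ.mono (star_mul_self_le_of_norm_le (le_refl ‖x‖))
  rw [map_smul, smul_eq_mul] at h2
  refine abs_le_of_sq_le_sq ?_ (mul_nonneg ρ.one_nonneg (norm_nonneg x))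
  nlinarith [mul_le_mul_of_nonneg_left h2 ρ.one_nonneg]

/-- A normal functional tends to zero along decreasing sequences of vanishing trace. -/
theorem tendsto_zero_of_antitone {Y : ℕ → N} (hY : Antitone Y) (hY0 : ∀ k, 0 ≤ Y k)
    {ε : ℕ → ℝ≥0∞} (hε : Tendsto ε atTop (𝓝 0)) (hτ : ∀ k, τ.toFun (Y k) ≤ ε k) :
    Tendsto (fun k => ρ.toFun (Y k)) atTop (𝓝 0) := by
  let D : Set N := range fun k => Y 0 - Y k
  have hD0 : ∀ y ∈ D, 0 ≤ y := by
    rintro _ ⟨k, rfl⟩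
    exact sub_nonneg.2 (hY (Nat.zero_le k))
  have hdir : DirectedOn (· ≤ ·) D := directedOn_range.2
    (Monotone.directed_le fun k l hkl => sub_le_sub_left (hY hkl) _)
  obtain ⟨Z, hZ, -⟩ := exists_isLUB_of_directed D (range_nonempty _) hD0 hdir (Y 0) (by
    rintro _ ⟨k, rfl⟩
    exact sub_le_self _ (hY0 k))
  have hZ0 : 0 ≤ Y 0 - Z := sub_nonneg.2 (hZ.2 (by
    rintro _ ⟨k, rfl⟩
    exact sub_le_self _ (hY0 k)))
  have hZk : ∀ k, Y 0 - Z ≤ Y k := fun k => by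
    have h1 : Y 0 - Y k ≤ Z := hZ.1 ⟨k, rfl⟩
    rw [sub_le_iff_le_add] at h1 ⊢
    rwa [add_comm]
  -- `Y 0 - Z` lies below every `Y k`, so it has trace zero and vanishes by faithfulness. Hence the
  -- `Y 0 - Y k` increase to `Y 0`, and normality of `ρ` applies.
  have hZ1 : Y 0 - Z = 0 := τ.faithful _ hZ0 (le_antisymm (ge_of_tendsto' hε fun k =>
    (τ.mono hZ0 (hZk k)).trans (hτ k)) bot_le)
  rw [sub_eq_zero] at hZ1
  rw [Metric.tendsto_atTop]
  intro δ hδ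
  obtain ⟨_, ⟨k, rfl⟩, hk⟩ := ρ.normal D Z (range_nonempty _) hD0 hdir hZ δ hδ
  refine ⟨k, fun l hl => ?_⟩
  have h1 := ρ.mono (hY hl)
  have h2 := ρ.nonneg _ (hY0 l)
  rw [← hZ1, map_sub] at hk
  rw [Real.dist_eq, sub_zero, abs_of_nonneg h2]
  linarith

/-- A normal functional is continuous for `‖·‖₂` on bounded subsets of `N`. -/
theorem tendsto_zero_of_tendsto_L2 {y : ℕ → L2Pre τ} {M : ℝ} (hM : ∀ n, ‖(y n).val‖ ≤ M)
    (hy : Tendsto y atTop (𝓝 0)) : Tendsto (fun n => ρ.toFun (y n).val) atTop (𝓝 0) := by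
  refine tendsto_of_subseq_tendsto fun ns hns => ?_
  have h1 := tendsto_zero_iff_norm_tendsto_zero.1 (hy.comp hns)
  have h2 : ∀ n : ℕ, ∀ᶠ k in atTop, ‖(y ∘ ns) k‖ ^ 2 ≤ (1 / 8 : ℝ) ^ n := fun n => by
    have h3 : Tendsto (fun k => ‖(y ∘ ns) k‖ ^ 2) atTop (𝓝 0) := by simpa using h1.pow 2
    exact (h3.eventually (gt_mem_nhds (by positivity : (0 : ℝ) < (1 / 8) ^ n))).mono
      fun k hk => le_of_lt hk
  obtain ⟨φ, -, hφ⟩ := extraction_forall_of_eventually h2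
  refine ⟨φ, ?_⟩
  set z : ℕ → L2Pre τ := fun n => y (ns (φ n)) with hz
  -- Along a fast subsequence `|z n|²` is dominated by multiples of elements `Y n` that decrease
  -- with vanishing trace. The conclusion then follows from `ρ(z)² ≤ ρ(1) ρ(|z|²)`.
  obtain ⟨Y, hYa, hY0, -, hYτ, hY⟩ := exists_dominating τ (fun n => (z n).val) fun n => by
    rw [← L2Pre.ofReal_norm_sq]
    exact ENNReal.ofReal_le_ofReal (hφ n)
  have hYl : Tendsto (fun k => ρ.toFun (Y k)) atTop (𝓝 0) := by
    refine ρ.tendsto_zero_of_antitone hYa hY0 (ε := fun k => ENNReal.ofReal (4 * (1 / 4) ^ k)) ?_ hYτ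
    have := ((tendsto_pow_atTop_nhds_zero_of_lt_one (r := (1 / 4 : ℝ)) (by norm_num)
        (by norm_num)).const_mul 4)
    simpa using ENNReal.tendsto_ofReal this
  have hle : ∀ n, star (z n).val * (z n).val ≤ (1 + M ^ 2) • Y n := fun n => by
    refine hY n (n + 1) _ M (hM _) ?_
    rw [Nat.Ico_succ_singleton, Finset.sum_singleton]
    have h4 : (0 : N) ≤ ((2 : ℝ) ^ (n + 1) - 1) • (star (z n).val * (z n).val) :=
      real_smul_nonneg (sub_nonneg.2 (one_le_pow₀ (by norm_num))) (star_mul_self_nonneg' _)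
    rwa [sub_smul, one_smul, sub_nonneg] at h4
  have hsq : Tendsto (fun n => ρ.toFun 1 * ((1 + M ^ 2) * ρ.toFun (Y n))) atTop (𝓝 0) := by
    simpa using (hYl.const_mul (1 + M ^ 2)).const_mul (ρ.toFun 1)
  have hsq' := hsq.sqrt
  rw [Real.sqrt_zero] at hsq'
  refine squeeze_zero_norm (fun n => ?_) hsq'
  refine Real.le_sqrt_of_sq_le ?_
  rw [Real.norm_eq_abs, sq_abs]
  have h5 := ρ.cauchy_schwarz 1 (z n).val
  rw [star_one, one_mul, one_mul] at h5
  have h6 := ρ.mono (hle n)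
  rw [map_smul, smul_eq_mul] at h6
  exact h5.trans (mul_le_mul_of_nonneg_left h6 ρ.one_nonneg)

end NormalFunctional

/-! ### Weak operator convergence of bounded sequences -/

/-- Let `c` be a subsequential limit of `φ (x n)`. Suitable convex combinations of the tails are
Cauchy in `‖·‖₂`; they stay bounded and weakly null, hence they tend to `0` in `‖·‖₂` by
`tendsto_zero_of_cauchySeq`. On them `φ` tends both to `0` and to `c`. -/
theorem tendsto_zero_of_weak {φ : L2Pre τ →ₗ[ℝ] ℝ}
    (hφ : ∀ (M : ℝ) (y : ℕ → L2Pre τ), (∀ n, ‖(y n).val‖ ≤ M) → Tendsto y atTop (𝓝 0) →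
      Tendsto (fun n => φ (y n)) atTop (𝓝 0))
    {x : ℕ → L2Pre τ} {M R K : ℝ} (hM : ∀ n, ‖(x n).val‖ ≤ M) (hR : ∀ n, ‖x n‖ ≤ R)
    (hK : ∀ n, |φ (x n)| ≤ K)
    (hw : ∀ ξ η, Tendsto (fun n => mc (x n).val ξ η) atTop (𝓝 0)) :
    Tendsto (fun n => φ (x n)) atTop (𝓝 0) := by
  refine tendsto_of_subseq_tendsto fun ns hns => ?_
  obtain ⟨c, -, θ, hθ, hc⟩ := tendsto_subseq_of_bounded (s := Metric.closedBall (0 : ℝ) K)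
    Metric.isBounded_closedBall (x := fun n => φ (x (ns n)))
    fun n => by rw [mem_closedBall_zero_iff]; exact hK _
  refine ⟨θ, ?_⟩
  set y : ℕ → L2Pre τ := fun n => x (ns (θ n)) with hy
  obtain ⟨w, hw1, hw2⟩ := exists_tailWeights_cauchySeq L2Pre.parallelogram (z := y) (R := R)
    fun n => hR _
  set k : ℕ → L2Pre τ := fun m => Finsupp.linearCombination ℝ y (w m) with hk
  have hval : ∀ m, (k m).val = Finsupp.linearCombination ℝ (fun n => (y n).val) (w m) := fun m =>
    LinearMap.map_finsupp_linearCombination ((L2Pre.valₗ (τ := τ)).restrictScalars ℝ) _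
  have hkM : ∀ m, ‖(k m).val‖ ≤ M := fun m => by
    have := norm_linearCombination_sub_le (F := fun n => (y n).val) (c := 0) (ε := M) (m := m)
      (fun n _ => by rw [sub_zero]; exact hM _) (hw1 m)
    rwa [sub_zero, ← hval] at this
  have hkw : ∀ ξ η, Tendsto (fun m => mc (k m).val ξ η) atTop (𝓝 0) := fun ξ η => by
    let f : N →ₗ[ℝ] ℂ :=
      { toFun := fun x => mc x ξ η
        map_add' := fun x y => mc_add x y ξ η
        map_smul' := fun c x => by rw [mc_real_smul]; rfl }
    have h1 : ∀ m, mc (k m).val ξ η =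
        Finsupp.linearCombination ℝ (fun n => mc (y n).val ξ η) (w m) := fun m => by
      rw [hval]
      exact LinearMap.map_finsupp_linearCombination f _
    simp only [h1]
    exact tendsto_linearCombination ((hw ξ η).comp (hns.comp hθ.tendsto_atTop)) hw1
  have hk0 : Tendsto k atTop (𝓝 0) := tendsto_zero_of_cauchySeq hkM hw2 hkw
  have h1 := hφ M k hkM hk0
  have h2 : ∀ m, φ (k m) = Finsupp.linearCombination ℝ (fun n => φ (y n)) (w m) := fun m =>
    LinearMap.map_finsupp_linearCombination φ _
  simp only [h2] at h1
  have h3 := tendsto_nhds_unique h1 (tendsto_linearCombination hc hw1)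
  rw [h3]
  exact hc

theorem inner_tendsto_zero_of_weak (a : L2Pre τ) {x : ℕ → L2Pre τ} {M R : ℝ}
    (hM : ∀ n, ‖(x n).val‖ ≤ M) (hR : ∀ n, ‖x n‖ ≤ R)
    (hw : ∀ ξ η, Tendsto (fun n => mc (x n).val ξ η) atTop (𝓝 0)) :
    Tendsto (fun n => (⟪a, x n⟫_ℂ).re) atTop (𝓝 0) := by
  let φ : L2Pre τ →ₗ[ℝ] ℝ := Complex.reLm.comp ((innerSL ℂ a).toLinearMap.restrictScalars ℝ)
  refine tendsto_zero_of_weak (φ := φ) (fun M y _ hy => ?_) hM hR (K := ‖a‖ * R) (fun n => ?_) hw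
  · have h1 : Continuous fun y : L2Pre τ => (⟪a, y⟫_ℂ).re := by fun_prop
    have h2 := (h1.tendsto 0).comp hy
    rw [inner_zero_right] at h2
    exact h2
  · change |(⟪a, x n⟫_ℂ).re| ≤ _
    refine (Complex.abs_re_le_norm _).trans ((norm_inner_le_norm _ _).trans ?_)
    gcongr
    exact hR n

namespace NormalFunctional

variable (ρ : NormalFunctional N)

/-- The cutoffs of positive elements of finite trace form a directed set. Were its supremum `x` not
`1`, semifiniteness would give a nonzero `y ≤ 1 - x` of finite trace; every `cutoff (K • y)` lies
below `x`, so `y = 0` by `eq_zero_of_le_one_sub_cutoff`. Normality of `ρ` then selects one cutoff.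
-/
theorem exists_finite_trace (τ : NSFTrace N) {ε : ℝ} (hε : 0 < ε) :
    ∃ e : N, 0 ≤ e ∧ e ≤ 1 ∧ τ.toFun e < ∞ ∧ ρ.toFun (1 - e) < ε := by
  let D : Set N := cutoff '' {h | 0 ≤ h ∧ τ.toFun h < ∞}
  have hne : D.Nonempty := ⟨_, 0, ⟨le_rfl, by simp [τ.map_zero]⟩, rfl⟩
  have hD0 : ∀ y ∈ D, 0 ≤ y := by
    rintro _ ⟨h, hh, rfl⟩
    exact cutoff_nonneg hh.1
  have hD1 : ∀ y ∈ D, y ≤ 1 := by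
    rintro _ ⟨h, hh, rfl⟩
    exact cutoff_le_one hh.1
  have hdir : DirectedOn (· ≤ ·) D := by
    rintro _ ⟨h, hh, rfl⟩ _ ⟨k, hk, rfl⟩
    refine ⟨_, ⟨h + k, ⟨add_nonneg hh.1 hk.1, ?_⟩, rfl⟩,
      cutoff_mono hh.1 (le_add_of_nonneg_right hk.1),
      cutoff_mono hk.1 (le_add_of_nonneg_left hh.1)⟩
    rw [τ.map_add _ _ hh.1 hk.1]
    exact ENNReal.add_lt_top.2 ⟨hh.2, hk.2⟩
  obtain ⟨x, hx, -⟩ := exists_isLUB_of_directed D hne hD0 hdir 1 hD1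
  have hx1 : x = 1 := by
    by_contra hne1
    have h0 : 0 ≤ 1 - x := sub_nonneg.2 (hx.2 hD1)
    obtain ⟨y, hy0, hyx, hyne, hyτ⟩ := τ.semifinite (1 - x) h0
      fun h => hne1 (sub_eq_zero.1 h).symm
    refine hyne (eq_zero_of_le_one_sub_cutoff hy0 fun K hK => hyx.trans ?_)
    refine sub_le_sub_left (hx.1 ⟨K • y, ⟨real_smul_nonneg hK.le hy0, ?_⟩, rfl⟩) _
    rw [τ.map_real_smul hK.le hy0]
    exact ENNReal.mul_lt_top ENNReal.ofReal_lt_top hyτ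
  obtain ⟨_, ⟨h, hh, rfl⟩, hlt⟩ := ρ.normal D x hne hD0 hdir hx ε hε
  refine ⟨cutoff h, cutoff_nonneg hh.1, cutoff_le_one hh.1,
    (τ.mono (cutoff_nonneg hh.1) (cutoff_le_self hh.1)).trans_lt hh.2, ?_⟩
  rw [map_sub, ← hx1]
  linarith

theorem star_mul_self_le_of_le_one {e : N} (h0 : 0 ≤ e) (h1 : e ≤ 1) : star e * e ≤ e := by
  obtain ⟨d, hd, rfl⟩ := exists_sqrt h0
  rw [le_iff_mc]
  intro ξ
  have e1 : mc (star (star d * d) * (star d * d)) ξ ξ =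
      mc (star d * d) ((d : H →L[ℂ] H) ξ) ((d : H →L[ℂ] H) ξ) := by
    have e2 : star (star d * d) * (star d * d) = star d * ((star d * d) * d) := by
      simp only [star_mul, hd, mul_assoc]
    rw [e2, mc_star_mul, mc_mul]
  rw [e1, mc_star_mul d d ξ ξ]
  exact le_iff_mc.1 h1 _

/-- Normal functionals are sequentially continuous for the weak operator topology on bounded
subsets of `N`. -/
theorem tendsto_zero_of_weak (τ : NSFTrace N) {x : ℕ → N} {M : ℝ} (hM : ∀ n, ‖x n‖ ≤ M)
    (hw : ∀ ξ η, Tendsto (fun n => mc (x n) ξ η) atTop (𝓝 0)) :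
    Tendsto (fun n => ρ.toFun (x n)) atTop (𝓝 0) := by
  have hM0 : 0 ≤ M := (norm_nonneg _).trans (hM 0)
  rw [Metric.tendsto_atTop]
  intro ε hε
  set δ : ℝ := (ε / 2) ^ 2 / (ρ.toFun 1 * M ^ 2 + 1) with hδ
  have hpos : 0 < ρ.toFun 1 * M ^ 2 + 1 := by
    have := mul_nonneg ρ.one_nonneg (sq_nonneg M)
    linarith
  have hδ0 : 0 < δ := by positivity
  -- In the splitting `x n = x n e + x n (1 - e)`, the first term is in `L₂` and is handled by the
  -- preceding lemma. The second is at most `ε / 2` for every `n` by Cauchy–Schwarz; `δ` was chosen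
  -- so that `M² ρ(1) δ ≤ (ε / 2)²`.
  obtain ⟨e, he0, he1, heτ, heρ⟩ := ρ.exists_finite_trace τ hδ0
  have hee : τ.toFun (star e * e) < ∞ :=
    (τ.mono (star_mul_self_nonneg' e) (star_mul_self_le_of_le_one he0 he1)).trans_lt heτ
  let a : L2Pre τ := L2Pre.mk e hee
  let φ : L2Pre τ →ₗ[ℝ] ℝ := ρ.toFun.comp ((L2Pre.valₗ (τ := τ)).restrictScalars ℝ)
  have hφv : ∀ b, φ b = ρ.toFun b.val := fun _ => rfl
  have hlim : Tendsto (fun n => φ (L2Pre.lmul (x n) a)) atTop (𝓝 0) := by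
    refine SemigroupBMO.tendsto_zero_of_weak (φ := φ) (x := fun n => L2Pre.lmul (x n) a)
      (fun M y hM hy => ?_) (M := M * ‖e‖) (R := M * ‖a‖)
      (K := ρ.toFun 1 * (M * ‖e‖)) (fun n => ?_) (fun n => ?_) (fun n => ?_) fun ξ η => ?_
    · simp only [hφv]
      exact ρ.tendsto_zero_of_tendsto_L2 hM hy
    · refine (norm_mul_le _ _).trans ?_
      gcongr
      exacts [hM n, le_rfl]
    · refine (L2Pre.norm_lmul_le _ _).trans ?_
      gcongr
      exact hM n
    · rw [hφv]
      refine (ρ.abs_le _).trans (mul_le_mul_of_nonneg_left ((norm_mul_le _ _).trans ?_)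
        ρ.one_nonneg)
      gcongr
      exacts [hM n, le_rfl]
    · exact hw ξ ((e : H →L[ℂ] H) η)
  have hrest : ∀ n, |ρ.toFun (x n * (1 - e))| ≤ ε / 2 := fun n => by
    refine abs_le_of_sq_le_sq ?_ (by positivity)
    have h1 := ρ.cauchy_schwarz (star (x n)) (1 - e)
    rw [star_star] at h1
    have h2 : ρ.toFun (x n * star (x n)) ≤ M ^ 2 * ρ.toFun 1 := by
      have h3 : ‖star (x n)‖ ≤ M := (norm_star (x n : H →L[ℂ] H)).trans_le (hM n)
      have h4 := ρ.mono (star_mul_self_le_of_norm_le h3)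
      rwa [star_star, map_smul] at h4
    have h3 : ρ.toFun (star (1 - e) * (1 - e)) ≤ ρ.toFun (1 - e) :=
      ρ.mono (star_mul_self_le_of_le_one (sub_nonneg.2 he1) (sub_le_self _ he0))
    have h4 : 0 ≤ ρ.toFun (1 - e) := ρ.nonneg _ (sub_nonneg.2 he1)
    have h5 : 0 ≤ ρ.toFun (star (1 - e) * (1 - e)) := ρ.nonneg _ (star_mul_self_nonneg' _)
    calc ρ.toFun (x n * (1 - e)) ^ 2 ≤ (M ^ 2 * ρ.toFun 1) * ρ.toFun (1 - e) :=
          h1.trans (mul_le_mul h2 h3 h5 (mul_nonneg (sq_nonneg M) ρ.one_nonneg))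
      _ ≤ (M ^ 2 * ρ.toFun 1) * δ :=
          mul_le_mul_of_nonneg_left heρ.le (mul_nonneg (sq_nonneg M) ρ.one_nonneg)
      _ ≤ (ρ.toFun 1 * M ^ 2 + 1) * δ := by nlinarith
      _ = (ε / 2) ^ 2 := by rw [hδ]; field_simp
  obtain ⟨n₀, hn₀⟩ := (Metric.tendsto_atTop.1 hlim) (ε / 2) (half_pos hε)
  refine ⟨n₀, fun n hn => ?_⟩
  have h1 := hn₀ n hn
  have h2 := hrest n
  rw [Real.dist_eq, sub_zero] at h1 ⊢
  rw [hφv] at h1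
  have e1 : ρ.toFun (x n) = ρ.toFun (L2Pre.lmul (x n) a).val + ρ.toFun (x n * (1 - e)) := by
    rw [← map_add, L2Pre.lmul_val, ← mul_add]
    congr 1
    change x n = x n * (e + (1 - e))
    rw [add_sub_cancel, mul_one]
  rw [e1]
  exact (abs_add_le _ _).trans_lt (by linarith)

end NormalFunctional

/-! ### The Poisson kernel -/

section Kernel

theorem poissonKernel_pos {t u : ℝ} (ht : 0 < t) (hu : 0 < u) : 0 < poissonKernel t u := by
  have := Real.pi_pos
  unfold poissonKernel
  positivity

/-- `∂ₜ` of the Poisson kernel. -/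
def poissonKernelDt (t u : ℝ) : ℝ :=
  1 / (2 * √Real.pi) * (1 - t ^ 2 / (2 * u)) * Real.exp (-t ^ 2 / (4 * u)) * u ^ (-(3 / 2) : ℝ)

/-- `∂ₜ²` of the Poisson kernel, which is equal to `∂ᵤ` of the kernel. -/
def poissonKernelDu (t u : ℝ) : ℝ :=
  poissonKernel t u * (t ^ 2 / (4 * u ^ 2) - 3 / (2 * u))

theorem hasDerivAt_poissonKernel_t (t : ℝ) {u : ℝ} (hu : 0 < u) :
    HasDerivAt (fun t => poissonKernel t u) (poissonKernelDt t u) t := by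
  have h1 : HasDerivAt (fun t : ℝ => -t ^ 2 / (4 * u)) (-(2 * t) / (4 * u)) t := by
    simpa using ((hasDerivAt_pow 2 t).neg.div_const (4 * u))
  have h2 := (((hasDerivAt_id t).div_const (2 * √Real.pi)).mul h1.exp).mul_const
    (u ^ (-(3 / 2) : ℝ))
  refine h2.congr_deriv ?_
  simp only [poissonKernelDt, id]
  field_simp
  ring

theorem hasDerivAt_poissonKernelDt_t (t : ℝ) {u : ℝ} (hu : 0 < u) :
    HasDerivAt (fun t => poissonKernelDt t u) (poissonKernelDu t u) t := by
  have h1 : HasDerivAt (fun t : ℝ => -t ^ 2 / (4 * u)) (-(2 * t) / (4 * u)) t := by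
    simpa using ((hasDerivAt_pow 2 t).neg.div_const (4 * u))
  have h0 : HasDerivAt (fun t : ℝ => 1 - t ^ 2 / (2 * u)) (-(2 * t / (2 * u))) t := by
    simpa using ((hasDerivAt_pow 2 t).div_const (2 * u)).const_sub 1
  have h2 := ((h0.const_mul (1 / (2 * √Real.pi))).mul h1.exp).mul_const (u ^ (-(3 / 2) : ℝ))
  refine h2.congr_deriv ?_
  simp only [poissonKernelDu, poissonKernel]
  field_simp
  ring

theorem hasDerivAt_poissonKernel_u (t : ℝ) {u : ℝ} (hu : 0 < u) :
    HasDerivAt (fun u => poissonKernel t u) (poissonKernelDu t u) u := by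
  have h1 : HasDerivAt (fun u : ℝ => -t ^ 2 / (4 * u)) (t ^ 2 / (4 * u ^ 2)) u := by
    have := ((hasDerivAt_inv hu.ne').const_mul (-t ^ 2 / 4))
    refine (this.congr_deriv ?_).congr_of_eventuallyEq ?_
    · field_simp
    · exact Eventually.of_forall fun v => by
        dsimp only
        rw [div_eq_mul_inv, mul_inv]
        ring
  have h2 : HasDerivAt (fun u : ℝ => u ^ (-(3 / 2) : ℝ)) (-(3 / 2) * u ^ (-(3 / 2) - 1 : ℝ)) u :=
    Real.hasDerivAt_rpow_const (Or.inl hu.ne')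
  have h3 := (h1.exp.const_mul (t / (2 * √Real.pi))).mul h2
  refine h3.congr_deriv ?_
  rw [Real.rpow_sub hu, Real.rpow_one]
  simp only [poissonKernelDu, poissonKernel]
  field_simp
  ring

/-- Halving `t` frees the factor `exp(-3z/16)` with `z = t²/u`, which absorbs the polynomials in `z`
produced by differentiation. The derivatives are thereby dominated by the kernel at time `t / 2`. -/
theorem poissonKernel_half (t : ℝ) {u : ℝ} (hu : 0 < u) :
    poissonKernel t u =
      2 * Real.exp (-(3 / 16 * (t ^ 2 / u))) * poissonKernel (t / 2) u := by
  have : Real.exp (-t ^ 2 / (4 * u)) =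
      Real.exp (-(3 / 16 * (t ^ 2 / u))) * Real.exp (-(t / 2) ^ 2 / (4 * u)) := by
    rw [← Real.exp_add]; congr 1; field_simp; ring
  rw [poissonKernel, this, poissonKernel]
  ring

theorem mul_exp_neg_le {x y : ℝ} (hx : 0 ≤ x)
    (h : y ≤ 1 + x + x ^ 2 / 2) : y * Real.exp (-x) ≤ 1 := by
  rw [Real.exp_neg, ← div_eq_mul_inv, div_le_one (Real.exp_pos x)]
  exact h.trans (Real.quadratic_le_exp_of_nonneg hx)

theorem abs_poissonKernelDt_le {t u : ℝ} (ht : 0 < t) (hu : 0 < u) :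
    |poissonKernelDt t u| ≤ 8 / t * poissonKernel (t / 2) u := by
  have hz : 0 ≤ t ^ 2 / u := by positivity
  have e : poissonKernelDt t u = 8 / t * poissonKernel (t / 2) u *
      (((1 - t ^ 2 / u / 2) / 4) * Real.exp (-(3 / 16 * (t ^ 2 / u)))) := by
    have h1 : poissonKernelDt t u = 1 / t * (1 - t ^ 2 / u / 2) * poissonKernel t u := by
      rw [poissonKernelDt, poissonKernel]; field_simp
    rw [h1, poissonKernel_half t hu]
    ring
  have h0 := poissonKernel_pos (half_pos ht) hu
  rw [e, abs_mul, abs_of_nonneg (by positivity)]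
  refine mul_le_of_le_one_right (by positivity) ?_
  rw [abs_mul, abs_of_pos (Real.exp_pos _)]
  refine mul_exp_neg_le (by positivity) ?_
  rw [abs_le]
  constructor <;> nlinarith [sq_nonneg (t ^ 2 / u)]

theorem abs_poissonKernelDu_le {t u : ℝ} (ht : 0 < t) (hu : 0 < u) :
    |poissonKernelDu t u| ≤ 64 / t ^ 2 * poissonKernel (t / 2) u := by
  have hz : 0 ≤ t ^ 2 / u := by positivity
  have e : poissonKernelDu t u = 64 / t ^ 2 * poissonKernel (t / 2) u *
      ((((t ^ 2 / u) ^ 2 / 4 - 3 / 2 * (t ^ 2 / u)) / 32) *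
        Real.exp (-(3 / 16 * (t ^ 2 / u)))) := by
    rw [poissonKernelDu, poissonKernel_half t hu]
    field_simp
    ring
  have h0 := poissonKernel_pos (half_pos ht) hu
  rw [e, abs_mul, abs_of_nonneg (by positivity)]
  refine mul_le_of_le_one_right (by positivity) ?_
  rw [abs_mul, abs_of_pos (Real.exp_pos _)]
  refine mul_exp_neg_le (by positivity) ?_
  rw [abs_le]
  constructor <;> nlinarith [sq_nonneg (t ^ 2 / u)]

theorem poissonKernel_div_le {t u : ℝ} (ht : 0 < t) (hu : 0 < u) :
    poissonKernel t u / u ≤ 64 / t ^ 2 * poissonKernel (t / 2) u := by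
  have hz : 0 ≤ t ^ 2 / u := by positivity
  have e : poissonKernel t u / u = 64 / t ^ 2 * poissonKernel (t / 2) u *
      ((t ^ 2 / u / 32) * Real.exp (-(3 / 16 * (t ^ 2 / u)))) := by
    rw [poissonKernel_half t hu]
    field_simp
    ring
  have h0 := poissonKernel_pos (half_pos ht) hu
  rw [e]
  refine mul_le_of_le_one_right (by positivity) (mul_exp_neg_le (by positivity) ?_)
  nlinarith [sq_nonneg (t ^ 2 / u)]

/-- The comparison of different times. It only raises the time parameter, at the cost of the ratio
of times: the exponential decreases in `t`, and the prefactor is linear in `t`. -/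
theorem poissonKernel_le_of_le {a b u : ℝ} (ha : 0 < a) (hab : a ≤ b) (hu : 0 < u) :
    poissonKernel b u ≤ b / a * poissonKernel a u := by
  have h1 : Real.exp (-b ^ 2 / (4 * u)) ≤ Real.exp (-a ^ 2 / (4 * u)) := by
    refine Real.exp_le_exp.2 ?_
    gcongr
  have e : b / a * poissonKernel a u =
      b / (2 * √Real.pi) * Real.exp (-a ^ 2 / (4 * u)) * u ^ (-(3 / 2) : ℝ) := by
    rw [poissonKernel]; field_simp
  have hb : 0 < b := ha.trans_le hab
  rw [e, poissonKernel]
  gcongr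

theorem measurable_poissonKernel (t : ℝ) : Measurable (poissonKernel t) := by
  unfold poissonKernel
  fun_prop

theorem measurable_poissonKernelDt (t : ℝ) : Measurable (poissonKernelDt t) := by
  unfold poissonKernelDt
  fun_prop

theorem measurable_poissonKernelDu (t : ℝ) : Measurable (poissonKernelDu t) := by
  have := measurable_poissonKernel t
  unfold poissonKernelDu
  fun_prop

/-- The Poisson kernel is dominated by `(1 + u)^{-3/2}`. -/
theorem exists_poissonKernel_le (t : ℝ) (ht : 0 < t) :
    ∃ C : ℝ, 0 ≤ C ∧ ∀ u, 0 < u → poissonKernel t u ≤ C * (1 + u) ^ (-(3 / 2) : ℝ) := by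
  set c : ℝ := t ^ 2 / 4 with hc
  have hc0 : 0 < c := by positivity
  set K : ℝ := max 1 (2 / c) with hK
  have hK1 : 1 ≤ K := le_max_left _ _
  have hpi := Real.pi_pos
  refine ⟨t / (2 * √Real.pi) * K ^ 2, by positivity, fun u hu => ?_⟩
  have hy : 0 < u⁻¹ := inv_pos.2 hu
  have h1 : 1 + u⁻¹ ≤ K * Real.exp (c / 2 * u⁻¹) := by
    have h2 := Real.add_one_le_exp (c / 2 * u⁻¹)
    have h3 : 2 / c ≤ K := le_max_right _ _
    rw [div_le_iff₀ hc0] at h3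
    calc 1 + u⁻¹ ≤ K + (K * c / 2) * u⁻¹ := by nlinarith
      _ = K * (c / 2 * u⁻¹ + 1) := by ring
      _ ≤ _ := by gcongr
  have h2 : (1 + u⁻¹) ^ (3 / 2 : ℝ) ≤ K ^ 2 * Real.exp (c * u⁻¹) := by
    calc (1 + u⁻¹) ^ (3 / 2 : ℝ) ≤ (1 + u⁻¹) ^ (2 : ℝ) :=
          Real.rpow_le_rpow_of_exponent_le (by linarith) (by norm_num)
      _ = (1 + u⁻¹) ^ 2 := by norm_cast
      _ ≤ (K * Real.exp (c / 2 * u⁻¹)) ^ 2 := by gcongr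
      _ = _ := by rw [mul_pow, ← Real.exp_nat_mul]; congr 2; push_cast; ring
  have h3 : u ^ (-(3 / 2) : ℝ) = (1 + u⁻¹) ^ (3 / 2 : ℝ) * (1 + u) ^ (-(3 / 2) : ℝ) := by
    have e : 1 + u⁻¹ = (1 + u) * u⁻¹ := by field_simp; ring
    rw [e, Real.mul_rpow (by positivity) (by positivity), Real.inv_rpow hu.le,
      Real.rpow_neg (by positivity), Real.rpow_neg (by positivity)]
    field_simp
  have h4 : Real.exp (-t ^ 2 / (4 * u)) = (Real.exp (c * u⁻¹))⁻¹ := by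
    rw [← Real.exp_neg]; congr 1; rw [hc]; field_simp
  rw [poissonKernel, h3, h4]
  have h5 : (Real.exp (c * u⁻¹))⁻¹ * (1 + u⁻¹) ^ (3 / 2 : ℝ) ≤ K ^ 2 := by
    rw [inv_mul_le_iff₀ (Real.exp_pos _), mul_comm]; exact h2
  calc t / (2 * √Real.pi) * (Real.exp (c * u⁻¹))⁻¹ *
        ((1 + u⁻¹) ^ (3 / 2 : ℝ) * (1 + u) ^ (-(3 / 2) : ℝ))
      = t / (2 * √Real.pi) * ((Real.exp (c * u⁻¹))⁻¹ * (1 + u⁻¹) ^ (3 / 2 : ℝ)) *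
          (1 + u) ^ (-(3 / 2) : ℝ) := by ring
    _ ≤ _ := by gcongr

/-- The Lebesgue measure on the half line. -/
abbrev halfLine : Measure ℝ := volume.restrict (Ioi 0)

theorem integrable_one_add_rpow :
    Integrable (fun u : ℝ => (1 + u) ^ (-(3 / 2) : ℝ)) halfLine := by
  have h : Integrable (fun u : ℝ => (1 + ‖u‖) ^ (-(3 / 2) : ℝ)) :=
    integrable_one_add_norm (by simp; norm_num)
  refine (h.restrict (s := Ioi 0)).congr ?_
  refine (ae_restrict_iff' measurableSet_Ioi).2 (Eventually.of_forall fun u hu => ?_)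
  dsimp only
  rw [Real.norm_of_nonneg (le_of_lt hu)]

theorem integrable_poissonKernel {t : ℝ} (ht : 0 < t) :
    Integrable (poissonKernel t) halfLine := by
  obtain ⟨C, hC, h⟩ := exists_poissonKernel_le t ht
  refine (integrable_one_add_rpow.const_mul C).mono'
    (measurable_poissonKernel t).aestronglyMeasurable ?_
  refine (ae_restrict_iff' measurableSet_Ioi).2 (Eventually.of_forall fun u hu => ?_)
  rw [Real.norm_of_nonneg (poissonKernel_pos ht hu).le]
  exact h u hu

/-- The primitive of `exp (-x²)`. -/
def gaussPrimitive (z : ℝ) : ℝ := ∫ x in (0 : ℝ)..z, Real.exp (-1 * x ^ 2)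

theorem hasDerivAt_gaussPrimitive (z : ℝ) :
    HasDerivAt gaussPrimitive (Real.exp (-1 * z ^ 2)) z :=
  intervalIntegral.integral_hasDerivAt_right
    ((by fun_prop : Continuous fun x : ℝ => Real.exp (-1 * x ^ 2)).intervalIntegrable _ _)
    ((by fun_prop : Continuous fun x : ℝ => Real.exp (-1 * x ^ 2)).stronglyMeasurableAtFilter _ _)
    (by fun_prop)

theorem gaussPrimitive_zero : gaussPrimitive 0 = 0 := intervalIntegral.integral_same

theorem gaussPrimitive_tendsto_atTop :
    Tendsto gaussPrimitive atTop (𝓝 (√Real.pi / 2)) := by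
  have h1 : IntegrableOn (fun x : ℝ => Real.exp (-1 * x ^ 2)) (Ioi 0) :=
    (integrable_exp_neg_mul_sq one_pos).integrableOn
  have h2 := intervalIntegral_tendsto_integral_Ioi 0 h1 tendsto_id
  rw [integral_gaussian_Ioi, div_one] at h2
  exact h2

theorem gaussPrimitive_neg (z : ℝ) : gaussPrimitive (-z) = -gaussPrimitive z := by
  have h := intervalIntegral.integral_comp_neg (a := 0) (b := z)
    (fun x : ℝ => Real.exp (-1 * x ^ 2))
  simp only [neg_sq, neg_zero] at h
  rw [gaussPrimitive, gaussPrimitive, h, intervalIntegral.integral_symm]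

theorem gaussPrimitive_tendsto_atBot :
    Tendsto gaussPrimitive atBot (𝓝 (-(√Real.pi / 2))) := by
  have := (gaussPrimitive_tendsto_atTop.comp tendsto_neg_atBot_atTop).neg
  refine this.congr fun z => ?_
  rw [Function.comp, gaussPrimitive_neg, neg_neg]

theorem integral_poissonKernel {t : ℝ} (ht : 0 < t) :
    ∫ u in Ioi (0 : ℝ), poissonKernel t u = 1 := by
  have hpi := Real.pi_pos
  let z : ℝ → ℝ := fun u => t / 2 * u ^ (-(1 / 2) : ℝ)
  have hz0 : Tendsto z (𝓝[>] 0) atTop :=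
    (tendsto_rpow_neg_nhdsGT_zero (by norm_num)).const_mul_atTop (by positivity)
  have hzt : Tendsto z atTop (𝓝 0) := by
    have := (tendsto_rpow_neg_atTop (y := 1 / 2) (by norm_num)).const_mul (t / 2)
    rwa [mul_zero] at this
  -- A primitive of the kernel. The value `-1` is its limit at `0`, where `z → ∞`; at infinity it
  -- tends to `0`.
  let g : ℝ → ℝ := fun u => if u ≤ 0 then -1 else -(2 / √Real.pi) * gaussPrimitive (z u)
  have hg : ∀ u, 0 < u → g u = -(2 / √Real.pi) * gaussPrimitive (z u) := fun u hu =>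
    if_neg (not_le.2 hu)
  have hg0 : g 0 = -1 := if_pos le_rfl
  have hcont : ContinuousWithinAt g (Ici 0) 0 := by
    rw [← continuousWithinAt_Ioi_iff_Ici, ContinuousWithinAt, hg0]
    have h1 := (gaussPrimitive_tendsto_atTop.comp hz0).const_mul (-(2 / √Real.pi))
    have e : -(2 / √Real.pi) * (√Real.pi / 2) = -1 := by field_simp
    rw [e] at h1
    refine h1.congr' ?_
    filter_upwards [self_mem_nhdsWithin] with u hu
    exact (hg u hu).symm
  have hderiv : ∀ u ∈ Ioi (0 : ℝ), HasDerivAt g (poissonKernel t u) u := by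
    intro u hu
    have hu' : 0 < u := hu
    have h1 : HasDerivAt z (t / 2 * (-(1 / 2) * u ^ (-(1 / 2) - 1 : ℝ))) u :=
      (Real.hasDerivAt_rpow_const (Or.inl hu'.ne')).const_mul _
    have h2 := ((hasDerivAt_gaussPrimitive (z u)).comp u h1).const_mul (-(2 / √Real.pi))
    refine (h2.congr_deriv ?_).congr_of_eventuallyEq ?_
    · have e1 : (z u) ^ 2 = t ^ 2 / (4 * u) := by
        simp only [z]
        rw [mul_pow, ← Real.rpow_natCast (u ^ (-(1 / 2) : ℝ)), ← Real.rpow_mul hu'.le]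
        norm_num
        rw [Real.rpow_neg_one]
        field_simp
        norm_num
      have e2 : (-(1 / 2) - 1 : ℝ) = -(3 / 2) := by norm_num
      have e3 : -1 * (t ^ 2 / (4 * u)) = -t ^ 2 / (4 * u) := by ring
      rw [e1, e2, e3, poissonKernel]
      field_simp
    · filter_upwards [Ioi_mem_nhds hu'] with v hv
      exact hg v hv
  have hlim : Tendsto g atTop (𝓝 0) := by
    have h1 := (((hasDerivAt_gaussPrimitive 0).continuousAt.tendsto).comp hzt).const_mul
      (-(2 / √Real.pi))
    rw [gaussPrimitive_zero, mul_zero] at h1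
    refine h1.congr' ?_
    filter_upwards [eventually_gt_atTop 0] with u hu
    exact (hg u hu).symm
  rw [integral_Ioi_of_hasDerivAt_of_nonneg hcont hderiv
    (fun u hu => (poissonKernel_pos ht hu).le) hlim, hg0]
  norm_num

end Kernel

/-! ### The Poisson kernels form a convolution semigroup -/

section Convolution

theorem poissonKernel_mul {s t u v : ℝ} (hv : 0 < v) (hvu : v < u) :
    poissonKernel s v * poissonKernel t (u - v) =
      s * t / (4 * Real.pi) * Real.exp (-s ^ 2 / (4 * v) + -t ^ 2 / (4 * (u - v))) *
        u ^ (3 / 2 : ℝ) * ((√(u * (v * (u - v)))) ^ 3)⁻¹ := by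
  have hw : 0 < u - v := sub_pos.2 hvu
  have hu : 0 < u := hv.trans hvu
  have e1 : (√(u * (v * (u - v)))) ^ 3 = u ^ (3 / 2 : ℝ) * (v ^ (3 / 2 : ℝ) * (u - v) ^ (3 / 2 : ℝ)) := by
    rw [← Real.mul_rpow hv.le hw.le, ← Real.mul_rpow hu.le (by positivity), Real.sqrt_eq_rpow,
      ← Real.rpow_natCast, ← Real.rpow_mul (by positivity)]
    norm_num
  have hpi : √Real.pi * √Real.pi = Real.pi := Real.mul_self_sqrt Real.pi_pos.le
  rw [e1, poissonKernel, poissonKernel, Real.rpow_neg hv.le, Real.rpow_neg hw.le, Real.exp_add]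
  have h1 : 0 < u ^ (3 / 2 : ℝ) := by positivity
  have h2 : 0 < v ^ (3 / 2 : ℝ) := by positivity
  have h3 : 0 < (u - v) ^ (3 / 2 : ℝ) := by positivity
  have hsp : 0 < √Real.pi := Real.sqrt_pos.2 Real.pi_pos
  have h4 : s * t / (4 * Real.pi) = s * t / (4 * (√Real.pi * √Real.pi)) := by rw [hpi]
  rw [h4]
  field_simp
  ring

/-- The derivative of `(s (u - v) + t v) / (2 √(u v (u - v)))` in `v`. -/
theorem hasDerivAt_gaussArgument (s t : ℝ) {u v : ℝ} (hv : 0 < v) (hvu : v < u) :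
    HasDerivAt (fun v => (s * (u - v) + t * v) / (2 * √(u * (v * (u - v)))))
      (-(u ^ 2 * (s * (u - v) - t * v)) / (4 * (√(u * (v * (u - v)))) ^ 3)) v := by
  have hw : 0 < u - v := sub_pos.2 hvu
  have hu : 0 < u := hv.trans hvu
  have hpos : 0 < u * (v * (u - v)) := by positivity
  have h1 : HasDerivAt (fun v : ℝ => u * (v * (u - v))) (u * (u - 2 * v)) v := by
    have := ((hasDerivAt_id v).mul ((hasDerivAt_id v).const_sub u)).const_mul u
    refine this.congr_deriv ?_
    simp only [id]; ring
  have h2 : HasDerivAt (fun v : ℝ => s * (u - v) + t * v) (-s + t) v := by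
    have := (((hasDerivAt_id v).const_sub u).const_mul s).add ((hasDerivAt_id v).const_mul t)
    refine this.congr_deriv ?_
    ring
  have h3 := h2.div ((h1.sqrt hpos.ne').const_mul 2) (by positivity)
  refine h3.congr_deriv ?_
  have hR : 0 < √(u * (v * (u - v))) := Real.sqrt_pos.2 hpos
  have hR2 : √(u * (v * (u - v))) ^ 2 = u * (v * (u - v)) := Real.sq_sqrt hpos.le
  set R := √(u * (v * (u - v)))
  have e : 2 * (2 * R) ^ 2 * R ≠ 0 := by positivity
  rw [div_eq_div_iff (by positivity) (by positivity)]
  field_simp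
  rw [hR2]
  ring

/-- Completing the square: the exponent of `p_s(v) p_t(u - v)` is minus this square, up to a term
depending only on `u`. Replacing `t` by `-t` makes that term the exponent `-(s + t)²/(4u)` of
`p_{s+t}`. -/
theorem gaussArgument_sq (s t : ℝ) {u v : ℝ} (hv : 0 < v) (hvu : v < u) :
    ((s * (u - v) + t * v) / (2 * √(u * (v * (u - v))))) ^ 2 =
      s ^ 2 / (4 * v) + t ^ 2 / (4 * (u - v)) - (s - t) ^ 2 / (4 * u) := by
  have hw : 0 < u - v := sub_pos.2 hvu
  have hu : 0 < u := hv.trans hvu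
  rw [div_pow, mul_pow, Real.sq_sqrt (by positivity)]
  field_simp
  ring

theorem tendsto_gaussArgument_zero (s t : ℝ) {u : ℝ} (hs : 0 < s) (hu : 0 < u) :
    Tendsto (fun v => (s * (u - v) + t * v) / (2 * √(u * (v * (u - v))))) (𝓝[>] 0) atTop := by
  have h1 : Tendsto (fun v => s * (u - v) + t * v) (𝓝[>] 0) (𝓝 (s * u)) := by
    have : Continuous fun v : ℝ => s * (u - v) + t * v := by fun_prop
    simpa using (this.tendsto 0).mono_left nhdsWithin_le_nhds
  have h2 : Tendsto (fun v => 2 * √(u * (v * (u - v)))) (𝓝[>] 0) (𝓝[>] 0) := by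
    refine tendsto_nhdsWithin_iff.2 ⟨?_, ?_⟩
    · have : Continuous fun v : ℝ => 2 * √(u * (v * (u - v))) := by fun_prop
      simpa using (this.tendsto 0).mono_left nhdsWithin_le_nhds
    · filter_upwards [self_mem_nhdsWithin, nhdsWithin_le_nhds (Iio_mem_nhds hu)] with v hv hvu
      have hv' : 0 < v := hv
      have hw : 0 < u - v := sub_pos.2 hvu
      exact mul_pos two_pos (Real.sqrt_pos.2 (by positivity))
  exact (h1.pos_mul_atTop (by positivity) (tendsto_inv_nhdsGT_zero.comp h2)).congr
    fun v => (div_eq_mul_inv _ _).symm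

theorem tendsto_gaussArgument_right (s t : ℝ) {u : ℝ} (ht : 0 < t) (hu : 0 < u) :
    Tendsto (fun v => (s * (u - v) + t * v) / (2 * √(u * (v * (u - v))))) (𝓝[<] u) atTop := by
  have h1 : Tendsto (fun v => s * (u - v) + t * v) (𝓝[<] u) (𝓝 (t * u)) := by
    have : Continuous fun v : ℝ => s * (u - v) + t * v := by fun_prop
    simpa using (this.tendsto u).mono_left nhdsWithin_le_nhds
  have h2 : Tendsto (fun v => 2 * √(u * (v * (u - v)))) (𝓝[<] u) (𝓝[>] 0) := by
    refine tendsto_nhdsWithin_iff.2 ⟨?_, ?_⟩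
    · have : Continuous fun v : ℝ => 2 * √(u * (v * (u - v))) := by fun_prop
      simpa using (this.tendsto u).mono_left nhdsWithin_le_nhds
    · filter_upwards [self_mem_nhdsWithin, nhdsWithin_le_nhds (Ioi_mem_nhds hu)] with v hv hvu
      have hw : 0 < u - v := sub_pos.2 hv
      have hv' : 0 < v := hvu
      exact mul_pos two_pos (Real.sqrt_pos.2 (by positivity))
  exact (h1.pos_mul_atTop (by positivity) (tendsto_inv_nhdsGT_zero.comp h2)).congr
    fun v => (div_eq_mul_inv _ _).symm

theorem intervalIntegrable_poissonKernel_mul {s t u : ℝ} (hs : 0 < s) (ht : 0 < t) (hu : 0 < u) :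
    IntervalIntegrable (fun v => poissonKernel s v * poissonKernel t (u - v)) volume 0 u := by
  obtain ⟨C, hC, h⟩ := exists_poissonKernel_le s hs
  have h1 : IntervalIntegrable (poissonKernel t) volume 0 u :=
    (intervalIntegrable_iff_integrableOn_Ioc_of_le hu.le).2
      ((integrable_poissonKernel ht).mono_measure (Measure.restrict_mono Ioc_subset_Ioi_self le_rfl))
  have h2 := (h1.comp_sub_left u).symm
  simp only [sub_self, sub_zero] at h2
  rw [intervalIntegrable_iff_integrableOn_Ioo_of_le hu.le] at h2 ⊢
  refine (h2.const_mul C).mono' ?_ ?_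
  · exact ((measurable_poissonKernel s).mul
      ((measurable_poissonKernel t).comp (measurable_const.sub measurable_id))).aestronglyMeasurable
  · refine (ae_restrict_iff' measurableSet_Ioo).2 (Eventually.of_forall fun v hv => ?_)
    have hp := poissonKernel_pos hs hv.1
    have hq := poissonKernel_pos ht (sub_pos.2 hv.2)
    rw [Real.norm_of_nonneg (by positivity)]
    refine mul_le_mul_of_nonneg_right ((h v hv.1).trans ?_) hq.le
    exact mul_le_of_le_one_right hC
      (Real.rpow_le_one_of_one_le_of_nonpos (by linarith [hv.1]) (by norm_num))

/-- The integrand has an explicit primitive made of two Gauss primitives, with arguments formed with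
`-t` and with `t`. Both arguments tend to `+∞` as `v → 0`; as `v → u` the first tends to `-∞` and
the second to `+∞`. The second therefore contributes nothing, and only the factor `exp(-(s +
t)²/(4u))` remains. -/
theorem integral_poissonKernel_mul {s t u : ℝ} (hs : 0 < s) (ht : 0 < t) (hu : 0 < u) :
    ∫ v in (0 : ℝ)..u, poissonKernel s v * poissonKernel t (u - v) = poissonKernel (s + t) u := by
  have hpi := Real.pi_pos
  let a : ℝ → ℝ := fun v => (s * (u - v) + (-t) * v) / (2 * √(u * (v * (u - v))))
  let b : ℝ → ℝ := fun v => (s * (u - v) + t * v) / (2 * √(u * (v * (u - v))))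
  let e1 : ℝ := Real.exp (-(s + t) ^ 2 / (4 * u))
  let e2 : ℝ := Real.exp (-(s - t) ^ 2 / (4 * u))
  let c : ℝ := -(1 / (2 * Real.pi) * (u ^ (3 / 2 : ℝ))⁻¹)
  let F : ℝ → ℝ := fun v =>
    c * ((s + t) * e1 * gaussPrimitive (a v) + (t - s) * e2 * gaussPrimitive (b v))
  have hderiv : ∀ v ∈ Ioo 0 u,
      HasDerivAt F (poissonKernel s v * poissonKernel t (u - v)) v := by
    rintro v ⟨hv, hvu⟩
    have hw : 0 < u - v := sub_pos.2 hvu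
    have ha := (hasDerivAt_gaussPrimitive (a v)).comp v (hasDerivAt_gaussArgument s (-t) hv hvu)
    have hb := (hasDerivAt_gaussPrimitive (b v)).comp v (hasDerivAt_gaussArgument s t hv hvu)
    refine (((ha.const_mul ((s + t) * e1)).add (hb.const_mul ((t - s) * e2))).const_mul
      c).congr_deriv ?_
    have ea : e1 * Real.exp (-1 * (a v) ^ 2) =
        Real.exp (-s ^ 2 / (4 * v) + -t ^ 2 / (4 * (u - v))) := by
      rw [← Real.exp_add, gaussArgument_sq s (-t) hv hvu]; congr 1; ring
    have eb : e2 * Real.exp (-1 * (b v) ^ 2) =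
        Real.exp (-s ^ 2 / (4 * v) + -t ^ 2 / (4 * (u - v))) := by
      rw [← Real.exp_add, gaussArgument_sq s t hv hvu]; congr 1; ring
    rw [poissonKernel_mul hv hvu]
    set X := Real.exp (-s ^ 2 / (4 * v) + -t ^ 2 / (4 * (u - v)))
    set R := √(u * (v * (u - v)))
    have hR : 0 < R := Real.sqrt_pos.2 (by positivity)
    have hu3 : u ^ (3 / 2 : ℝ) * u ^ (3 / 2 : ℝ) = u ^ 3 := by
      rw [← Real.rpow_add hu, ← Real.rpow_natCast]; norm_num
    have hu0 : 0 < u ^ (3 / 2 : ℝ) := by positivity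
    calc c * ((s + t) * e1 * (Real.exp (-1 * (a v) ^ 2) *
          (-(u ^ 2 * (s * (u - v) - -t * v)) / (4 * R ^ 3))) +
          (t - s) * e2 * (Real.exp (-1 * (b v) ^ 2) *
          (-(u ^ 2 * (s * (u - v) - t * v)) / (4 * R ^ 3))))
        = c * ((s + t) * (e1 * Real.exp (-1 * (a v) ^ 2)) *
          (-(u ^ 2 * (s * (u - v) - -t * v)) / (4 * R ^ 3)) +
          (t - s) * (e2 * Real.exp (-1 * (b v) ^ 2)) *
          (-(u ^ 2 * (s * (u - v) - t * v)) / (4 * R ^ 3))) := by ring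
      _ = c * (X * (-(s * t * u ^ 3) / (2 * R ^ 3))) := by
          rw [ea, eb]; field_simp; ring
      _ = _ := by
          rw [← hu3]
          simp only [c]
          field_simp
          ring
  have h0 : Tendsto F (𝓝[>] 0)
      (𝓝 (c * ((s + t) * e1 * (√Real.pi / 2) + (t - s) * e2 * (√Real.pi / 2)))) :=
    (((gaussPrimitive_tendsto_atTop.comp (tendsto_gaussArgument_zero s (-t) hs hu)).const_mul
      ((s + t) * e1)).add ((gaussPrimitive_tendsto_atTop.comp
        (tendsto_gaussArgument_zero s t hs hu)).const_mul ((t - s) * e2))).const_mul c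
  have haneg : Tendsto a (𝓝[<] u) atBot := by
    have := tendsto_neg_atTop_atBot.comp (tendsto_gaussArgument_right (-s) t ht hu)
    refine this.congr fun v => ?_
    simp only [Function.comp, a]
    rw [← neg_div]
    congr 1
    ring
  have h1 : Tendsto F (𝓝[<] u)
      (𝓝 (c * ((s + t) * e1 * (-(√Real.pi / 2)) + (t - s) * e2 * (√Real.pi / 2)))) :=
    (((gaussPrimitive_tendsto_atBot.comp haneg).const_mul
      ((s + t) * e1)).add ((gaussPrimitive_tendsto_atTop.comp
        (tendsto_gaussArgument_right s t ht hu)).const_mul ((t - s) * e2))).const_mul c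
  rw [intervalIntegral.integral_eq_sub_of_hasDerivAt_of_tendsto hu hderiv
    (intervalIntegrable_poissonKernel_mul hs ht hu) h0 h1, poissonKernel,
    Real.rpow_neg hu.le]
  have hsp : √Real.pi * √Real.pi = Real.pi := Real.mul_self_sqrt hpi.le
  have hsp0 : 0 < √Real.pi := Real.sqrt_pos.2 hpi
  have hc : c = -(1 / (2 * (√Real.pi * √Real.pi)) * (u ^ (3 / 2 : ℝ))⁻¹) := by rw [hsp]
  have hu0 : 0 < u ^ (3 / 2 : ℝ) := by positivity
  change _ = (s + t) / (2 * √Real.pi) * e1 * _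
  rw [hc]
  field_simp
  ring

/-- The Poisson kernel, extended by zero. -/
def poissonExt (t u : ℝ) : ℝ := (Ioi (0 : ℝ)).indicator (poissonKernel t) u

theorem integrable_poissonExt {t : ℝ} (ht : 0 < t) : Integrable (poissonExt t) :=
  (integrable_indicator_iff measurableSet_Ioi).2 (integrable_poissonKernel ht)

theorem integral_poissonExt_mul {s t u : ℝ} (hs : 0 < s) (ht : 0 < t) (hu : 0 < u) :
    ∫ v, poissonExt s v * poissonExt t (u - v) = poissonKernel (s + t) u := by
  rw [← integral_poissonKernel_mul hs ht hu, intervalIntegral.integral_of_le hu.le,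
    integral_Ioc_eq_integral_Ioo, ← integral_indicator measurableSet_Ioo]
  congr 1
  ext v
  by_cases hv : v ∈ Ioo 0 u
  · rw [indicator_of_mem hv, poissonExt, poissonExt, indicator_of_mem (show v ∈ Ioi 0 from hv.1),
      indicator_of_mem (show u - v ∈ Ioi 0 from sub_pos.2 hv.2)]
  · rw [indicator_of_notMem hv, poissonExt, poissonExt]
    by_cases h0 : 0 < v
    · rw [indicator_of_notMem (a := u - v), mul_zero]
      intro h
      exact hv ⟨h0, sub_pos.1 h⟩
    · rw [indicator_of_notMem (a := v) (by simpa using h0), zero_mul]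

/-- Fubini and the convolution identity. The target `E` is general because the lemma is used for
scalar integrands and for `L₂`-valued ones. -/
theorem integral_integral_poissonKernel {E : Type*} [NormedAddCommGroup E] [NormedSpace ℝ E]
    [CompleteSpace E]
    {s t : ℝ} (hs : 0 < s) (ht : 0 < t) {F : ℝ → E} {M : ℝ}
    (hF : AEStronglyMeasurable F halfLine) (hM : ∀ u, 0 < u → ‖F u‖ ≤ M) :
    ∫ v in Ioi (0 : ℝ), poissonKernel s v • ∫ w in Ioi (0 : ℝ), poissonKernel t w • F (v + w) =
      ∫ u in Ioi (0 : ℝ), poissonKernel (s + t) u • F u := by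
  let G : ℝ → E := (Ioi (0 : ℝ)).indicator F
  have hG : AEStronglyMeasurable G := (aestronglyMeasurable_indicator_iff measurableSet_Ioi).2 hF
  have hGM : ∀ u, ‖G u‖ ≤ max M 0 := fun u => by
    by_cases h : u ∈ Ioi (0 : ℝ)
    · simp only [G, indicator_of_mem h]; exact (hM u h).trans (le_max_left _ _)
    · simp only [G, indicator_of_notMem h, norm_zero]; exact le_max_right _ _
  have hint : Integrable (fun p : ℝ × ℝ => (poissonExt s p.2 * poissonExt t (p.1 - p.2)) • G p.1)
      (volume.prod volume) := by
    have h1 := (integrable_poissonExt hs).convolution_integrand (ContinuousLinearMap.mul ℝ ℝ)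
      (integrable_poissonExt ht)
    refine (h1.norm.mul_const (max M 0)).mono' (h1.aestronglyMeasurable.smul hG.comp_fst) ?_
    refine Eventually.of_forall fun p => ?_
    rw [norm_smul]
    exact mul_le_mul_of_nonneg_left (hGM _) (norm_nonneg _)
  have hinner : ∀ v, 0 < v → ∫ w in Ioi (0 : ℝ), poissonKernel t w • F (v + w) =
      ∫ u, poissonExt t (u - v) • G u := by
    intro v hv
    rw [← integral_indicator measurableSet_Ioi,
      ← integral_add_right_eq_self (fun u => poissonExt t (u - v) • G u) v]
    congr 1
    ext w
    rw [add_sub_cancel_right]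
    by_cases hw : w ∈ Ioi (0 : ℝ)
    · have h2 : w + v ∈ Ioi (0 : ℝ) := add_pos hw hv
      rw [indicator_of_mem hw, poissonExt, indicator_of_mem hw]
      simp only [G]
      rw [indicator_of_mem h2, add_comm]
    · rw [indicator_of_notMem hw, poissonExt, indicator_of_notMem hw, zero_smul]
  calc ∫ v in Ioi (0 : ℝ), poissonKernel s v • ∫ w in Ioi (0 : ℝ), poissonKernel t w • F (v + w)
      = ∫ v, ∫ u, (poissonExt s v * poissonExt t (u - v)) • G u := by
        rw [← integral_indicator measurableSet_Ioi]
        congr 1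
        ext v
        simp only [mul_smul, integral_smul]
        by_cases hv : v ∈ Ioi (0 : ℝ)
        · rw [indicator_of_mem hv, hinner v hv, poissonExt, indicator_of_mem hv]
        · rw [indicator_of_notMem hv, poissonExt, indicator_of_notMem hv, zero_smul]
    _ = ∫ u, ∫ v, (poissonExt s v * poissonExt t (u - v)) • G u :=
        integral_integral_swap hint.swap
    _ = ∫ u in Ioi (0 : ℝ), poissonKernel (s + t) u • F u := by
        rw [← integral_indicator measurableSet_Ioi]
        congr 1
        ext u
        rw [integral_smul_const]
        by_cases hu : u ∈ Ioi (0 : ℝ)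
        · rw [integral_poissonExt_mul hs ht hu, indicator_of_mem hu]
          simp only [G, indicator_of_mem hu]
        · rw [indicator_of_notMem hu]
          simp only [G, indicator_of_notMem hu, smul_zero]

end Convolution

/-! ### Moments of the Poisson kernel -/

section Moments

theorem poissonKernel_scale {t u : ℝ} (ht : 0 < t) (hu : 0 < u) :
    poissonKernel t u = (t ^ 2)⁻¹ * poissonKernel 1 ((t ^ 2)⁻¹ * u) := by
  have h1 : ((t ^ 2)⁻¹ * u) ^ (-(3 / 2) : ℝ) = t ^ 3 * u ^ (-(3 / 2) : ℝ) := by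
    rw [Real.mul_rpow (by positivity) hu.le, ← Real.rpow_natCast t 2, ← Real.rpow_neg ht.le,
      ← Real.rpow_mul ht.le]
    norm_num
  rw [poissonKernel, poissonKernel, h1]
  have h2 : -t ^ 2 / (4 * u) = -1 ^ 2 / (4 * ((t ^ 2)⁻¹ * u)) := by field_simp
  rw [h2]
  field_simp

theorem integrable_poissonKernel_mul_scale {q : ℝ → ℝ} {t : ℝ} (ht : 0 < t)
    (hq : Integrable (fun w => poissonKernel 1 w * q w) halfLine) :
    Integrable (fun u => poissonKernel t u * q ((t ^ 2)⁻¹ * u)) halfLine ∧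
      ∫ u in Ioi (0 : ℝ), poissonKernel t u * q ((t ^ 2)⁻¹ * u) =
        ∫ w in Ioi (0 : ℝ), poissonKernel 1 w * q w := by
  have hb : 0 < (t ^ 2)⁻¹ := by positivity
  have e : ∀ u ∈ Ioi (0 : ℝ), (t ^ 2)⁻¹ * (poissonKernel 1 ((t ^ 2)⁻¹ * u) * q ((t ^ 2)⁻¹ * u)) =
      poissonKernel t u * q ((t ^ 2)⁻¹ * u) := fun u hu => by
    rw [poissonKernel_scale ht hu]; ring
  have h1 := (integrableOn_Ioi_comp_mul_left_iff (fun w => poissonKernel 1 w * q w) 0 hb).2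
    (by rwa [mul_zero])
  constructor
  · exact ((Integrable.const_mul h1 ((t ^ 2)⁻¹)).congr
      ((ae_restrict_iff' measurableSet_Ioi).2 (Eventually.of_forall e)))
  · rw [← setIntegral_congr_fun measurableSet_Ioi e, integral_const_mul,
      integral_comp_mul_left_Ioi (fun w => poissonKernel 1 w * q w) 0 hb, mul_zero, smul_eq_mul,
      inv_inv]
    field_simp

theorem integrable_poissonKernel_rpow_quarter :
    Integrable (fun w => poissonKernel 1 w * w ^ (1 / 4 : ℝ)) halfLine := by
  obtain ⟨C, hC, h⟩ := exists_poissonKernel_le 1 one_pos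
  have h1 : Integrable (fun u : ℝ => (1 + ‖u‖) ^ (-(5 / 4) : ℝ)) :=
    integrable_one_add_norm (by simp; norm_num)
  refine ((h1.restrict (s := Ioi 0)).const_mul C).mono' ?_ ?_
  · exact ((measurable_poissonKernel 1).mul (by fun_prop)).aestronglyMeasurable
  · refine (ae_restrict_iff' measurableSet_Ioi).2 (Eventually.of_forall fun u hu => ?_)
    have hu' : 0 < u := hu
    have hp := poissonKernel_pos one_pos hu'
    rw [Real.norm_of_nonneg (by positivity), Real.norm_of_nonneg hu'.le]
    have h2 : u ^ (1 / 4 : ℝ) ≤ (1 + u) ^ (1 / 4 : ℝ) := by gcongr; linarith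
    have h3 : (1 + u) ^ (-(5 / 4) : ℝ) = (1 + u) ^ (-(3 / 2) : ℝ) * (1 + u) ^ (1 / 4 : ℝ) := by
      rw [← Real.rpow_add (by positivity)]; norm_num
    rw [h3, ← mul_assoc]
    exact mul_le_mul (h u hu') h2 (by positivity) (by positivity)

theorem integrable_poissonKernel_rpow_neg_half :
    Integrable (fun w => poissonKernel 1 w * w ^ (-(1 / 2) : ℝ)) halfLine := by
  refine ((integrable_poissonKernel one_pos).add
    ((integrable_poissonKernel (t := 1 / 2) (by norm_num)).const_mul 64)).mono' ?_ ?_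
  · exact ((measurable_poissonKernel 1).mul (by fun_prop)).aestronglyMeasurable
  · refine (ae_restrict_iff' measurableSet_Ioi).2 (Eventually.of_forall fun u hu => ?_)
    have hu' : 0 < u := hu
    have hp := poissonKernel_pos one_pos hu'
    rw [Real.norm_of_nonneg (by positivity)]
    have h1 := poissonKernel_div_le one_pos hu'
    norm_num at h1
    have h2 : u ^ (-(1 / 2) : ℝ) ≤ 1 + u⁻¹ := by
      rcases le_total u 1 with h | h
      · have := Real.rpow_le_rpow_of_exponent_ge hu' h (by norm_num : (-1 : ℝ) ≤ -(1 / 2))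
        rw [Real.rpow_neg_one] at this
        linarith
      · have := Real.rpow_le_one_of_one_le_of_nonpos h (by norm_num : -(1 / 2 : ℝ) ≤ 0)
        have := inv_pos.2 hu'
        linarith
    calc poissonKernel 1 u * u ^ (-(1 / 2) : ℝ) ≤ poissonKernel 1 u * (1 + u⁻¹) := by gcongr
      _ = poissonKernel 1 u + poissonKernel 1 u / u := by rw [div_eq_mul_inv]; ring
      _ ≤ _ := by simpa using h1

end Moments

/-! ### The Poisson kernel as a curve in `L¹(0, ∞)` -/

section L1

/-- `L¹(0, ∞)`. -/
abbrev K1 : Type := Lp ℝ 1 halfLine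

open Classical in
/-- The class of an integrable function in `L¹(0, ∞)`. -/
def mkL1 (f : ℝ → ℝ) : K1 := if h : Integrable f halfLine then h.toL1 f else 0

theorem coeFn_mkL1 {f : ℝ → ℝ} (h : Integrable f halfLine) : mkL1 f =ᵐ[halfLine] f := by
  rw [mkL1, dif_pos h]; exact h.coeFn_toL1

theorem norm_mkL1 {f : ℝ → ℝ} (h : Integrable f halfLine) : ‖mkL1 f‖ = ∫ u, |f u| ∂halfLine := by
  rw [L1.norm_eq_integral_norm]
  refine integral_congr_ae ((coeFn_mkL1 h).mono fun u hu => ?_)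
  simp only [hu, Real.norm_eq_abs]

theorem mkL1_congr {f g : ℝ → ℝ} (h : ∀ u, 0 < u → f u = g u) : mkL1 f = mkL1 g := by
  have e : f =ᵐ[halfLine] g :=
    (ae_restrict_iff' measurableSet_Ioi).2 (Eventually.of_forall h)
  by_cases hf : Integrable f halfLine
  · rw [mkL1, mkL1, dif_pos hf, dif_pos (hf.congr e)]
    exact (Integrable.toL1_eq_toL1_iff _ _ _ _).2 e
  · rw [mkL1, mkL1, dif_neg hf, dif_neg fun hg => hf (hg.congr e.symm)]

theorem norm_mkL1_sub_sub {f g h : ℝ → ℝ} (hf : Integrable f halfLine)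
    (hg : Integrable g halfLine) (hh : Integrable h halfLine) (c : ℝ) :
    ‖mkL1 f - mkL1 g - c • mkL1 h‖ = ∫ u, |f u - g u - c * h u| ∂halfLine := by
  rw [mkL1, mkL1, mkL1, dif_pos hf, dif_pos hg, dif_pos hh, ← Integrable.toL1_sub f g hf hg,
    ← Integrable.toL1_smul' h hh c, ← Integrable.toL1_sub _ _ (hf.sub hg) (hh.smul c),
    L1.norm_eq_integral_norm]
  refine integral_congr_ae
    ((Integrable.coeFn_toL1 ((hf.sub hg).sub (hh.smul c))).mono fun u hu => ?_)
  refine (congrArg _ hu).trans ?_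
  simp only [Real.norm_eq_abs, Pi.sub_apply, Pi.smul_apply, smul_eq_mul]

/-- Dominated convergence for the difference quotients: the integrable Lipschitz constant `g` is the
majorant. Differentiability in `L¹` norm is what passes through the bounded maps `A` and `C`. -/
theorem hasDerivWithinAt_mkL1 {F : ℝ → ℝ → ℝ} {F' g : ℝ → ℝ} {s : Set ℝ} {x₀ : ℝ} (hx₀ : x₀ ∈ s)
    (hF : ∀ x ∈ s, Integrable (F x) halfLine) (hF' : Integrable F' halfLine)
    (hg : Integrable g halfLine)
    (hlip : ∀ x ∈ s, ∀ u, 0 < u → |F x u - F x₀ u| ≤ g u * |x - x₀|)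
    (hd : ∀ u, 0 < u → HasDerivWithinAt (fun x => F x u) (F' u) s x₀) :
    HasDerivWithinAt (fun x => mkL1 (F x)) (mkL1 F') s x₀ := by
  rw [hasDerivWithinAt_iff_tendsto]
  have h0 : Tendsto (fun x => ∫ u, |x - x₀|⁻¹ * |F x u - F x₀ u - (x - x₀) * F' u| ∂halfLine)
      (𝓝[s] x₀) (𝓝 (∫ _, 0 ∂halfLine)) := by
    refine tendsto_integral_filter_of_dominated_convergence (fun u => |g u| + |F' u|) ?_ ?_
      (hg.abs.add hF'.abs) ?_
    · filter_upwards [self_mem_nhdsWithin] with x hx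
      exact ((((hF x hx).sub (hF x₀ hx₀)).sub (hF'.const_mul (x - x₀))).abs.const_mul
        (|x - x₀|⁻¹)).aestronglyMeasurable
    · filter_upwards [self_mem_nhdsWithin] with x hx
      refine (ae_restrict_iff' measurableSet_Ioi).2 (Eventually.of_forall fun u hu => ?_)
      rw [Real.norm_of_nonneg (by positivity)]
      have h1 : |F x u - F x₀ u - (x - x₀) * F' u| ≤ |x - x₀| * (|g u| + |F' u|) := by
        refine (abs_sub _ _).trans ?_
        rw [abs_mul]
        have := mul_le_mul_of_nonneg_right (le_abs_self (g u)) (abs_nonneg (x - x₀))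
        linarith [hlip x hx u hu]
      by_cases hz : |x - x₀| = 0
      · rw [hz, inv_zero, zero_mul]
        positivity
      · rw [inv_mul_le_iff₀ (lt_of_le_of_ne (abs_nonneg _) (Ne.symm hz))]
        exact h1
    · refine (ae_restrict_iff' measurableSet_Ioi).2 (Eventually.of_forall fun u hu => ?_)
      have := hasDerivWithinAt_iff_tendsto.1 (hd u hu)
      simpa only [Real.norm_eq_abs, smul_eq_mul] using this
  rw [integral_zero] at h0
  refine h0.congr' ?_
  filter_upwards [self_mem_nhdsWithin] with x hx
  rw [norm_mkL1_sub_sub (hF x hx) (hF x₀ hx₀) hF', integral_const_mul, Real.norm_eq_abs]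

/-- The Poisson kernel `poissonKernel t` in `L¹(0, ∞)`. -/
def poissonL1 (t : ℝ) : K1 := mkL1 (poissonKernel t)

/-- `∂ₜ poissonKernel` in `L¹(0, ∞)`. -/
def poissonL1Dt (t : ℝ) : K1 := mkL1 (poissonKernelDt t)

/-- `∂ₜ² poissonKernel = ∂ᵤ poissonKernel` in `L¹(0, ∞)`. -/
def poissonL1Du (t : ℝ) : K1 := mkL1 (poissonKernelDu t)

/-- The translate of the Poisson kernel by `ε`. -/
def shiftedKernel (t ε u : ℝ) : ℝ := if ε < u then poissonKernel t (u - ε) else 0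

theorem integrable_of_abs_le_poissonKernel {f : ℝ → ℝ} (hf : Measurable f) {c t : ℝ} (ht : 0 < t)
    (h : ∀ u, 0 < u → |f u| ≤ c * poissonKernel t u) : Integrable f halfLine :=
  ((integrable_poissonKernel ht).const_mul c).mono' hf.aestronglyMeasurable
    ((ae_restrict_iff' measurableSet_Ioi).2 (Eventually.of_forall h))

theorem integrable_poissonKernelDt {t : ℝ} (ht : 0 < t) :
    Integrable (poissonKernelDt t) halfLine :=
  integrable_of_abs_le_poissonKernel (measurable_poissonKernelDt t) (half_pos ht)
    fun _ hu => abs_poissonKernelDt_le ht hu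

theorem integrable_poissonKernelDu {t : ℝ} (ht : 0 < t) :
    Integrable (poissonKernelDu t) halfLine :=
  integrable_of_abs_le_poissonKernel (measurable_poissonKernelDu t) (half_pos ht)
    fun _ hu => abs_poissonKernelDu_le ht hu

theorem integrable_shiftedKernel {t : ℝ} (ε : ℝ) (ht : 0 < t) :
    Integrable (shiftedKernel t ε) halfLine := by
  have h1 := ((integrable_poissonExt ht).comp_sub_right ε).restrict (s := Ioi 0)
  refine h1.congr (Eventually.of_forall fun u => ?_)
  simp only [poissonExt, shiftedKernel]
  by_cases h : ε < u
  · rw [indicator_of_mem (show u - ε ∈ Ioi 0 from sub_pos.2 h), if_pos h]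
  · rw [indicator_of_notMem (by simpa using not_lt.1 h), if_neg h]

theorem norm_poissonL1Dt_le {t : ℝ} (ht : 0 < t) : ‖poissonL1Dt t‖ ≤ 8 / t := by
  rw [poissonL1Dt, norm_mkL1 (integrable_poissonKernelDt ht)]
  calc ∫ u, |poissonKernelDt t u| ∂halfLine ≤ ∫ u, 8 / t * poissonKernel (t / 2) u ∂halfLine :=
        integral_mono_ae (integrable_poissonKernelDt ht).abs
          ((integrable_poissonKernel (half_pos ht)).const_mul _)
          ((ae_restrict_iff' measurableSet_Ioi).2
            (Eventually.of_forall fun u hu => abs_poissonKernelDt_le ht hu))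
    _ = 8 / t := by
        rw [integral_const_mul]
        have := integral_poissonKernel (half_pos ht)
        rw [halfLine, this, mul_one]

theorem Ioo_half_two_mem {t x : ℝ} (ht : 0 < t) (hx : x ∈ Ioo (t / 2) (2 * t)) {u : ℝ}
    (hu : 0 < u) : 0 < x ∧ 8 / x ≤ 16 / t ∧ 64 / x ^ 2 ≤ 256 / t ^ 2 ∧
      poissonKernel (x / 2) u ≤ 4 * poissonKernel (t / 4) u := by
  have hx0 : 0 < x := (half_pos ht).trans hx.1
  have h1 := hx.1
  refine ⟨hx0, ?_, ?_, ?_⟩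
  · rw [div_le_div_iff₀ hx0 ht]; linarith
  · rw [div_le_div_iff₀ (by positivity) (by positivity)]; nlinarith
  · refine (poissonKernel_le_of_le (by positivity : 0 < t / 4) (by linarith) hu).trans ?_
    refine mul_le_mul_of_nonneg_right ?_ (poissonKernel_pos (by positivity) hu).le
    rw [div_le_iff₀ (by positivity)]
    linarith [hx.2]

theorem abs_sub_le_of_deriv_le {f f' : ℝ → ℝ} {s : Set ℝ} (hs : Convex ℝ s) {C : ℝ}
    (hf : ∀ x ∈ s, HasDerivAt f (f' x) x) (hC : ∀ x ∈ s, |f' x| ≤ C) {x y : ℝ} (hx : x ∈ s)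
    (hy : y ∈ s) : |f x - f y| ≤ C * |x - y| := by
  simpa only [Real.norm_eq_abs] using hs.norm_image_sub_le_of_norm_hasDerivWithin_le
    (fun z hz => (hf z hz).hasDerivWithinAt) (fun z hz => by simpa using hC z hz) hy hx

theorem hasDerivAt_poissonL1 {t : ℝ} (ht : 0 < t) :
    HasDerivAt poissonL1 (poissonL1Dt t) t := by
  have hmem : t ∈ Ioo (t / 2) (2 * t) := ⟨by linarith, by linarith⟩
  refine (hasDerivWithinAt_mkL1 (g := fun u => 64 / t * poissonKernel (t / 4) u) hmem
    (fun x hx => integrable_poissonKernel ((half_pos ht).trans hx.1))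
    (integrable_poissonKernelDt ht) ((integrable_poissonKernel (by positivity)).const_mul _)
    (fun x hx u hu => ?_)
    fun u hu => (hasDerivAt_poissonKernel_t t hu).hasDerivWithinAt).hasDerivAt
      (Ioo_mem_nhds hmem.1 hmem.2)
  refine abs_sub_le_of_deriv_le (convex_Ioo _ _)
    (fun y _ => hasDerivAt_poissonKernel_t y hu) (fun y hy => ?_) hx hmem
  obtain ⟨hy0, h1, -, h2⟩ := Ioo_half_two_mem ht hy hu
  refine (abs_poissonKernelDt_le hy0 hu).trans ?_
  calc 8 / y * poissonKernel (y / 2) u ≤ 16 / t * (4 * poissonKernel (t / 4) u) :=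
        mul_le_mul h1 h2 (poissonKernel_pos (half_pos hy0) hu).le (by positivity)
    _ = _ := by ring

theorem hasDerivAt_poissonL1Dt {t : ℝ} (ht : 0 < t) :
    HasDerivAt poissonL1Dt (poissonL1Du t) t := by
  have hmem : t ∈ Ioo (t / 2) (2 * t) := ⟨by linarith, by linarith⟩
  refine (hasDerivWithinAt_mkL1 (g := fun u => 1024 / t ^ 2 * poissonKernel (t / 4) u) hmem
    (fun x hx => integrable_poissonKernelDt ((half_pos ht).trans hx.1))
    (integrable_poissonKernelDu ht) ((integrable_poissonKernel (by positivity)).const_mul _)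
    (fun x hx u hu => ?_)
    fun u hu => (hasDerivAt_poissonKernelDt_t t hu).hasDerivWithinAt).hasDerivAt
      (Ioo_mem_nhds hmem.1 hmem.2)
  refine abs_sub_le_of_deriv_le (convex_Ioo _ _)
    (fun y _ => hasDerivAt_poissonKernelDt_t y hu) (fun y hy => ?_) hx hmem
  obtain ⟨hy0, -, h1, h2⟩ := Ioo_half_two_mem ht hy hu
  refine (abs_poissonKernelDu_le hy0 hu).trans ?_
  calc 64 / y ^ 2 * poissonKernel (y / 2) u ≤ 256 / t ^ 2 * (4 * poissonKernel (t / 4) u) :=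
        mul_le_mul h1 h2 (poissonKernel_pos (half_pos hy0) hu).le (by positivity)
    _ = _ := by ring

theorem shiftedKernel_zero (t : ℝ) {u : ℝ} (hu : 0 < u) :
    shiftedKernel t 0 u = poissonKernel t u := by
  rw [shiftedKernel, if_pos hu, sub_zero]

theorem integral_shiftedKernel_smul {E : Type*} [NormedAddCommGroup E] [NormedSpace ℝ E]
    (r : ℝ) {ε : ℝ} (hε : 0 ≤ ε) (G : ℝ → E) :
    ∫ v, shiftedKernel r ε v • G v ∂halfLine = ∫ v, poissonKernel r v • G (v + ε) ∂halfLine := by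
  calc ∫ v, shiftedKernel r ε v • G v ∂halfLine
      = ∫ v, poissonExt r (v - ε) • G v := by
        rw [halfLine, ← integral_indicator measurableSet_Ioi]
        congr 1
        ext v
        by_cases h : ε < v
        · rw [indicator_of_mem (show v ∈ Ioi 0 from hε.trans_lt h), shiftedKernel, if_pos h,
            poissonExt, indicator_of_mem (show v - ε ∈ Ioi 0 from sub_pos.2 h)]
        · rw [poissonExt, indicator_of_notMem (a := v - ε) (by simpa using not_lt.1 h), zero_smul]
          by_cases h0 : v ∈ Ioi (0 : ℝ)
          · rw [indicator_of_mem h0, shiftedKernel, if_neg h, zero_smul]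
          · rw [indicator_of_notMem h0]
    _ = ∫ v, poissonExt r v • G (v + ε) := by
        rw [← integral_add_right_eq_self (fun v => poissonExt r (v - ε) • G v) ε]
        simp only [add_sub_cancel_right]
    _ = ∫ v, poissonKernel r v • G (v + ε) ∂halfLine := by
        rw [halfLine, ← integral_indicator measurableSet_Ioi]
        congr 1
        ext v
        by_cases h : v ∈ Ioi (0 : ℝ)
        · rw [indicator_of_mem h, poissonExt, indicator_of_mem h]
        · rw [indicator_of_notMem h, poissonExt, indicator_of_notMem h, zero_smul]

/-- `T_ε P_t` is the average with the shifted kernel, so this computes the generator of `T` on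
`P_t`. Because `∂ᵤ p = ∂ₜ² p`, it equals minus the second derivative of `P_t`. -/
theorem hasDerivWithinAt_shiftedKernel {t : ℝ} (ht : 0 < t) :
    HasDerivWithinAt (fun ε => mkL1 (shiftedKernel t ε)) (-poissonL1Du t) (Ici 0) 0 := by
  obtain ⟨C, hC, hC'⟩ := exists_poissonKernel_le (t / 2) (half_pos ht)
  have e : -poissonL1Du t = mkL1 (fun u => -poissonKernelDu t u) := by
    have h := integrable_poissonKernelDu ht
    have h' : Integrable (fun u => -poissonKernelDu t u) halfLine := h.neg
    rw [poissonL1Du, mkL1, mkL1, dif_pos h, dif_pos h', ← Integrable.toL1_neg]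
    rfl
  rw [e]
  -- If `w > 0` and `w ≥ u - 1` then `1 + w ≥ (1 + u) / 2`. The factor `2^{3/2}` thus provides one
  -- majorant for all shifts up to `1`.
  set K : ℝ := 64 / t ^ 2 * (C * 2 ^ (3 / 2 : ℝ)) with hK
  have hpow : ∀ {u w : ℝ}, 0 < u → 0 < w → u - 1 ≤ w →
      64 / t ^ 2 * poissonKernel (t / 2) w ≤ K * (1 + u) ^ (-(3 / 2) : ℝ) := by
    intro u w hu hw huw
    have h1 : (1 + w) ^ (-(3 / 2) : ℝ) ≤ ((1 + u) / 2) ^ (-(3 / 2) : ℝ) :=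
      Real.rpow_le_rpow_of_nonpos (by positivity) (by linarith) (by norm_num)
    have h2 : ((1 + u) / 2) ^ (-(3 / 2) : ℝ) = 2 ^ (3 / 2 : ℝ) * (1 + u) ^ (-(3 / 2) : ℝ) := by
      rw [Real.div_rpow (by positivity) (by norm_num), Real.rpow_neg (by norm_num : (0:ℝ) ≤ 2),
        div_inv_eq_mul, mul_comm]
    rw [h2] at h1
    have h3 := (hC' w hw).trans (mul_le_mul_of_nonneg_left h1 hC)
    rw [hK, mul_assoc, mul_assoc]
    exact mul_le_mul_of_nonneg_left h3 (by positivity)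
  refine (hasDerivWithinAt_mkL1 (s := Icc 0 1) (g := fun u => K * (1 + u) ^ (-(3 / 2) : ℝ))
    (by simp) (fun x _ => integrable_shiftedKernel x ht) (integrable_poissonKernelDu ht).neg
    (integrable_one_add_rpow.const_mul _) (fun x hx u hu => ?_) fun u hu =>
      ?_).mono_of_mem_nhdsWithin (Icc_mem_nhdsGE one_pos)
  · rw [shiftedKernel_zero t hu, sub_zero, abs_of_nonneg hx.1]
    by_cases h : x < u
    · rw [shiftedKernel, if_pos h]
      have h0 : 0 < u - x := sub_pos.2 h
      have := abs_sub_le_of_deriv_le (convex_Icc (u - x) u)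
        (fun y hy => hasDerivAt_poissonKernel_u t (h0.trans_le hy.1))
        (C := K * (1 + u) ^ (-(3 / 2) : ℝ)) (fun y hy => ?_)
        (left_mem_Icc.2 (by linarith [hx.1])) (right_mem_Icc.2 (by linarith [hx.1]))
      · simpa [abs_of_nonneg hx.1] using this
      · exact (abs_poissonKernelDu_le ht (h0.trans_le hy.1)).trans
          (hpow hu (h0.trans_le hy.1) (by linarith [hy.1, hx.2]))
    -- For `u ≤ x` the shifted kernel vanishes at `u`, and the unshifted one is at most `x · p_t(u)
    -- / u`.
    · rw [shiftedKernel, if_neg h, zero_sub, abs_neg, abs_of_pos (poissonKernel_pos ht hu)]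
      have h1 := (poissonKernel_div_le ht hu).trans (hpow hu hu (by linarith))
      rw [div_le_iff₀ hu] at h1
      refine h1.trans (mul_le_mul_of_nonneg_left (not_lt.1 h) ?_)
      have : (0:ℝ) ≤ (1 + u) ^ (-(3 / 2) : ℝ) := by positivity
      positivity
  · have h1 := (hasDerivAt_poissonKernel_u t (u := u - 0) (by simpa using hu)).comp (0 : ℝ)
      ((hasDerivAt_id (0 : ℝ)).const_sub u)
    simp only [sub_zero, mul_neg, mul_one] at h1
    refine (h1.congr_of_eventuallyEq ?_).hasDerivWithinAt
    filter_upwards [Iio_mem_nhds hu] with ε hε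
    rw [shiftedKernel, if_pos (show ε < u from hε)]
    rfl

end L1

/-! ### An abstract form of the estimates, for one positive functional -/

section Frame

theorem le_mul_of_forall_quadratic {p q r α β : ℝ} (h : ∀ c : ℝ, 0 ≤ r * (c * c) + 2 * q * c + p)
    (hp : p ≤ α ^ 2) (hr : r ≤ β ^ 2) (hα : 0 ≤ α) (hβ : 0 ≤ β) : q ≤ α * β := by
  have h1 := discrim_le_zero h
  have hp0 : 0 ≤ p := by simpa using h 0
  rw [discrim] at h1
  refine (abs_le_of_sq_le_sq' (?_ : q ^ 2 ≤ (α * β) ^ 2) (by positivity)).2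
  have h2 : r * p ≤ β ^ 2 * α ^ 2 :=
    (mul_le_mul_of_nonneg_right hr hp0).trans (mul_le_mul_of_nonneg_left hp (by positivity))
  nlinarith

theorem deriv_le_of_eventually_le {f g : ℝ → ℝ} {f' g' a : ℝ} (hf : HasDerivWithinAt f f' (Ici a) a)
    (hg : HasDerivWithinAt g g' (Ici a) a) (ha : f a = g a) (h : ∀ᶠ y in 𝓝[>] a, f y ≤ g y) :
    f' ≤ g' := by
  have h1 := (hasDerivWithinAt_iff_tendsto_slope' (by simp)).1
    ((hg.sub hf).mono Ioi_subset_Ici_self)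
  refine sub_nonneg.1 (ge_of_tendsto h1 ?_)
  filter_upwards [h, self_mem_nhdsWithin] with y hy hy'
  have hy0 : 0 < y - a := sub_pos.2 hy'
  simp only [slope_def_field, Pi.sub_apply, ha, sub_self, sub_zero]
  have := sub_nonneg.2 hy
  positivity

theorem hasDerivWithinAt_clm {E W : Type*} [NormedAddCommGroup E] [NormedSpace ℝ E]
    [NormedAddCommGroup W] [NormedSpace ℝ W] (L : E →L[ℝ] W) {k : ℝ → E} {k' : E}
    {S : Set ℝ} {s : ℝ} (hk : HasDerivWithinAt k k' S s) :
    HasDerivWithinAt (fun s => L (k s)) (L k') S s :=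
  L.hasFDerivAt.comp_hasDerivWithinAt s hk

theorem hasDerivWithinAt_trilinear {E V : Type*} [NormedAddCommGroup E] [NormedSpace ℝ E]
    [NormedAddCommGroup V] [NormedSpace ℝ V] (C : E →L[ℝ] V →L[ℝ] V →L[ℝ] ℝ) {k : ℝ → E} {k' : E}
    {x y : ℝ → V} {x' y' : V} {S : Set ℝ} {s : ℝ} (hk : HasDerivWithinAt k k' S s)
    (hx : HasDerivWithinAt x x' S s) (hy : HasDerivWithinAt y y' S s) :
    HasDerivWithinAt (fun s => C (k s) (x s) (y s))
      (C k' (x s) (y s) + C (k s) x' (y s) + C (k s) (x s) y') S s := by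
  have h0 : HasDerivWithinAt (fun s => C (k s)) (C k') S s :=
    hasDerivWithinAt_clm (W := V →L[ℝ] V →L[ℝ] ℝ) C hk
  refine ((h0.clm_apply hx).clm_apply hy).congr_deriv ?_
  simp only [add_apply]

/-- A semigroup `T` on `V`, the averages `A k = ∫ k(u) T_u du` for `k ∈ L¹(0, ∞)`, and positive
semidefinite forms `B_v`, where `B_v(x, x)` stands for a positive functional applied to
`T_v |x|²`. -/
structure Frame (V : Type*) [NormedAddCommGroup V] [NormedSpace ℝ V] where
  T : ℝ → V →ₗ[ℝ] V
  A : K1 →L[ℝ] V →L[ℝ] V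
  B : ℝ → LinearMap.BilinForm ℝ V
  K : ℝ
  K_nonneg : 0 ≤ K
  norm_T : ∀ u x, ‖T u x‖ ≤ ‖x‖
  T_add : ∀ s t x, 0 ≤ s → 0 ≤ t → T (s + t) x = T s (T t x)
  symm : ∀ v x y, B v x y = B v y x
  nonneg : ∀ v x, 0 ≤ B v x x
  bound : ∀ v x y, |B v x y| ≤ K * ‖x‖ * ‖y‖
  measurable_B : ∀ x y, Measurable fun v => B v x y
  measurable_B_T : ∀ v x y, Measurable fun u => B v y (T u x)
  B_T : ∀ v u x, 0 ≤ v → 0 ≤ u → B v (T u x) (T u x) ≤ B (v + u) x x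
  B_A : ∀ v y k x, B v y (A k x) = ∫ u, k u * B v y (T u x) ∂halfLine
  T_A : ∀ ε s x, 0 ≤ ε → 0 < s →
    T ε (A (poissonL1 s) x) = A (mkL1 (shiftedKernel s ε)) x
  A_A : ∀ s t x, 0 < s → 0 < t → A (poissonL1 s) (A (poissonL1 t) x) = A (poissonL1 (s + t)) x

/-! ### The trilinear form of a frame and Jensen's inequality -/

namespace Frame

variable {V : Type*} [NormedAddCommGroup V] [NormedSpace ℝ V] (F : Frame V)

theorem integrable_mul_B {f : ℝ → ℝ} (hf : Integrable f halfLine) (x y : V) :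
    Integrable (fun v => f v * F.B v x y) halfLine :=
  hf.mul_bdd (c := F.K * ‖x‖ * ‖y‖) (F.measurable_B x y).aestronglyMeasurable
    (Eventually.of_forall fun v => F.bound v x y)

theorem abs_integral_mul_B_le (k : K1) (x y : V) :
    |∫ v, k v * F.B v x y ∂halfLine| ≤ F.K * ‖k‖ * ‖x‖ * ‖y‖ := by
  have h := norm_integral_le_of_norm_le (f := fun v => k v * F.B v x y)
    ((L1.integrable_coeFn k).norm.mul_const (F.K * ‖x‖ * ‖y‖)) (Eventually.of_forall fun v => by
      rw [norm_mul]
      exact mul_le_mul_of_nonneg_left (F.bound v x y) (norm_nonneg _))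
  rw [integral_mul_const, ← L1.norm_eq_integral_norm] at h
  refine h.trans_eq ?_
  ring

/-- `∫ k(v) B_v(x, y) dv`, for fixed `k`. -/
def C₂ (k : K1) : V →L[ℝ] V →L[ℝ] ℝ :=
  LinearMap.mkContinuous₂
    (LinearMap.mk₂ ℝ (fun x y => ∫ v, k v * F.B v x y ∂halfLine)
      (fun x x' y => by
        rw [← integral_add (F.integrable_mul_B (L1.integrable_coeFn k) _ _)
          (F.integrable_mul_B (L1.integrable_coeFn k) _ _)]
        simp only [map_add, LinearMap.add_apply, mul_add])
      (fun c x y => by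
        rw [smul_eq_mul, ← integral_const_mul]
        simp only [map_smul, LinearMap.smul_apply, smul_eq_mul, mul_left_comm])
      (fun x y y' => by
        rw [← integral_add (F.integrable_mul_B (L1.integrable_coeFn k) _ _)
          (F.integrable_mul_B (L1.integrable_coeFn k) _ _)]
        simp only [map_add, mul_add])
      (fun c x y => by
        rw [smul_eq_mul, ← integral_const_mul]
        simp only [map_smul, smul_eq_mul, mul_left_comm]))
    (F.K * ‖k‖) (fun x y => F.abs_integral_mul_B_le k x y)

theorem C₂_apply (k : K1) (x y : V) : F.C₂ k x y = ∫ v, k v * F.B v x y ∂halfLine := rfl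

/-- `∫ k(v) B_v(x, y) dv` as a trilinear form. -/
def C : K1 →L[ℝ] V →L[ℝ] V →L[ℝ] ℝ :=
  LinearMap.mkContinuous
    { toFun := F.C₂
      map_add' := fun k l => by
        ext x y
        simp only [C₂_apply, add_apply]
        rw [← integral_add (F.integrable_mul_B (L1.integrable_coeFn k) _ _)
          (F.integrable_mul_B (L1.integrable_coeFn l) _ _)]
        refine integral_congr_ae ((Lp.coeFn_add k l).mono fun v hv => ?_)
        simp only [hv, Pi.add_apply, add_mul]
      map_smul' := fun c k => by
        ext x y
        simp only [C₂_apply, smul_apply, RingHom.id_apply]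
        rw [smul_eq_mul, ← integral_const_mul]
        refine integral_congr_ae ((Lp.coeFn_smul c k).mono fun v hv => ?_)
        simp only [hv, Pi.smul_apply, smul_eq_mul, mul_assoc] }
    F.K fun k => LinearMap.mkContinuous₂_norm_le _ (mul_nonneg F.K_nonneg (norm_nonneg _))
      fun x y => F.abs_integral_mul_B_le k x y

theorem C_apply (k : K1) (x y : V) : F.C k x y = ∫ v, k v * F.B v x y ∂halfLine := rfl

theorem C_mkL1 {f : ℝ → ℝ} (hf : Integrable f halfLine) (x y : V) :
    F.C (mkL1 f) x y = ∫ v, f v * F.B v x y ∂halfLine :=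
  integral_congr_ae ((coeFn_mkL1 hf).mono fun v hv => by simp only [hv])

theorem C_symm (k : K1) (x y : V) : F.C k x y = F.C k y x := by
  simp only [C_apply, F.symm _ x y]

theorem C_mono {f g : ℝ → ℝ} (hf : Integrable f halfLine) (hg : Integrable g halfLine)
    (h : ∀ v, 0 < v → f v ≤ g v) (x : V) : F.C (mkL1 f) x x ≤ F.C (mkL1 g) x x := by
  rw [F.C_mkL1 hf, F.C_mkL1 hg]
  exact integral_mono_ae (F.integrable_mul_B hf x x) (F.integrable_mul_B hg x x)
    ((ae_restrict_iff' measurableSet_Ioi).2 (Eventually.of_forall fun v hv =>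
      mul_le_mul_of_nonneg_right (h v hv) (F.nonneg v x)))

theorem C_nonneg {t : ℝ} (ht : 0 < t) (x : V) : 0 ≤ F.C (poissonL1 t) x x := by
  rw [poissonL1, F.C_mkL1 (integrable_poissonKernel ht)]
  exact setIntegral_nonneg measurableSet_Ioi fun v hv =>
    mul_nonneg (poissonKernel_pos ht hv).le (F.nonneg v x)

theorem C_le_of_le {a b : ℝ} (ha : 0 < a) (hab : a ≤ b) (x : V) :
    F.C (poissonL1 b) x x ≤ b / a * F.C (poissonL1 a) x x := by
  have h1 := integrable_poissonKernel ha
  refine (F.C_mono (integrable_poissonKernel (ha.trans_le hab)) (h1.const_mul (b / a))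
    (fun v hv => poissonKernel_le_of_le ha hab hv) x).trans_eq ?_
  rw [poissonL1, F.C_mkL1 h1, F.C_mkL1 (h1.const_mul (b / a)), ← integral_const_mul]
  simp only [mul_assoc]

theorem B_add_le {v : ℝ} {x y : V} {α β : ℝ} (hα : 0 ≤ α) (hβ : 0 ≤ β)
    (hx : F.B v x x ≤ α ^ 2) (hy : F.B v y y ≤ β ^ 2) : F.B v (x + y) (x + y) ≤ (α + β) ^ 2 := by
  have h := le_mul_of_forall_quadratic (q := F.B v x y) (fun c => by
    refine (F.nonneg v (x + c • y)).trans_eq ?_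
    simp only [map_add, map_smul, LinearMap.add_apply, LinearMap.smul_apply, smul_eq_mul,
      F.symm v y x]
    ring) hx hy hα hβ
  simp only [map_add, LinearMap.add_apply, F.symm v y x]
  linarith

theorem C_expand (k : K1) (x y : V) (c : ℝ) : F.C k (x + c • y) (x + c • y) =
    F.C k y y * (c * c) + 2 * F.C k x y * c + F.C k x x := by
  simp only [map_add, map_smul, add_apply, smul_apply,
    smul_eq_mul, F.C_symm k y x]
  ring

theorem C_add_le {t : ℝ} (ht : 0 < t) {x y : V} {α β : ℝ} (hα : 0 ≤ α) (hβ : 0 ≤ β)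
    (hx : F.C (poissonL1 t) x x ≤ α ^ 2) (hy : F.C (poissonL1 t) y y ≤ β ^ 2) :
    F.C (poissonL1 t) (x + y) (x + y) ≤ (α + β) ^ 2 := by
  have h := le_mul_of_forall_quadratic (q := F.C (poissonL1 t) x y) (fun c => by
    rw [← F.C_expand]; exact F.C_nonneg ht _) hx hy hα hβ
  have := F.C_expand (poissonL1 t) x y 1
  rw [one_smul] at this
  rw [this]
  linarith

theorem C_add_le_two {t : ℝ} (ht : 0 < t) (x y : V) :
    F.C (poissonL1 t) (x + y) (x + y) ≤
      2 * F.C (poissonL1 t) x x + 2 * F.C (poissonL1 t) y y := by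
  have h1 := F.C_expand (poissonL1 t) x y 1
  have h2 := F.C_expand (poissonL1 t) x y (-1)
  have h3 := F.C_nonneg ht (x + (-1 : ℝ) • y)
  rw [one_smul] at h1
  rw [h1]
  rw [h2] at h3
  linarith

/-- A weak integral `y = ∫ f(u) z_u du` with `|f| ≤ c · poissonKernel w` has
`B_v(y, y) ≤ c² ∫ poissonKernel w u · B_v(z_u, z_u) du`. -/
theorem B_self_le_of_eq_integral {v : ℝ} {y : V} {z : ℝ → V} {f g : ℝ → ℝ} {c w : ℝ}
    (hc : 0 < c) (hw : 0 < w) (hfc : ∀ u, 0 < u → |f u| ≤ c * poissonKernel w u)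
    (hy : F.B v y y = ∫ u, f u * F.B v y (z u) ∂halfLine)
    (hz : ∀ u, 0 < u → F.B v (z u) (z u) ≤ g u)
    (hg : Integrable (fun u => poissonKernel w u * g u) halfLine) :
    F.B v y y ≤ c ^ 2 * ∫ u, poissonKernel w u * g u ∂halfLine := by
  -- Weighted arithmetic–geometric mean. Integrated against `c · p_w`, the term in `B_v(y, y)` has
  -- coefficient `1/2` and is absorbed on the left. Only the majorant `g` is integrated, so no
  -- measurability of `u ↦ B_v(z_u, z_u)` is needed.
  have key : ∀ u, 0 < u → |F.B v y (z u)| ≤ 1 / (2 * c) * F.B v y y + c / 2 * g u := by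
    intro u hu
    have h1 := F.nonneg v (y - c • z u)
    have h2 := F.nonneg v (y + c • z u)
    simp only [map_add, map_sub, map_smul, LinearMap.add_apply, LinearMap.sub_apply,
      LinearMap.smul_apply, smul_eq_mul, F.symm v (z u) y] at h1 h2
    have h3 := mul_le_mul_of_nonneg_left (hz u hu) (by positivity : 0 ≤ c * c)
    have e : 1 / (2 * c) * F.B v y y + c / 2 * g u =
      1 / (2 * c) * (F.B v y y + c * c * g u) := by field_simp
    rw [e, div_mul_eq_mul_div, one_mul, le_div_iff₀ (by positivity),
      ← abs_of_pos (by positivity : 0 < 2 * c), ← abs_mul, abs_le]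
    constructor <;> linarith
  have hint : Integrable (fun u => c * poissonKernel w u * (1 / (2 * c) * F.B v y y + c / 2 * g u))
      halfLine := by
    refine (((integrable_poissonKernel hw).const_mul (1 / 2 * F.B v y y)).add
      (hg.const_mul (c ^ 2 / 2))).congr (Eventually.of_forall fun u => ?_)
    simp only [Pi.add_apply]
    field_simp
  have h1 := norm_integral_le_of_norm_le (f := fun u => f u * F.B v y (z u)) hint
    ((ae_restrict_iff' measurableSet_Ioi).2 (Eventually.of_forall fun u hu => by
      rw [norm_mul]
      exact mul_le_mul (hfc u hu) (key u hu) (norm_nonneg _)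
        (mul_nonneg hc.le (poissonKernel_pos hw hu).le)))
  have h2 : ∫ u, c * poissonKernel w u * (1 / (2 * c) * F.B v y y + c / 2 * g u) ∂halfLine =
      1 / 2 * F.B v y y + c ^ 2 / 2 * ∫ u, poissonKernel w u * g u ∂halfLine := by
    have h3 := integral_poissonKernel hw
    rw [← mul_one (1 / 2 * F.B v y y), ← h3, ← integral_const_mul, ← integral_const_mul]
    change _ = ∫ u, _ ∂halfLine + _
    rw [← integral_add ((integrable_poissonKernel hw).const_mul _) (hg.const_mul _)]
    congr 1
    ext u
    field_simp
  rw [← hy, h2, Real.norm_of_nonneg (F.nonneg v y)] at h1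
  linarith

theorem integrable_mul_B_add {w : ℝ} (hw : 0 < w) (v : ℝ) (x : V) :
    Integrable (fun u => poissonKernel w u * F.B (v + u) x x) halfLine :=
  (integrable_poissonKernel hw).mul_bdd (c := F.K * ‖x‖ * ‖x‖)
    ((F.measurable_B x x).comp (measurable_const.add measurable_id)).aestronglyMeasurable
    (Eventually.of_forall fun u => F.bound (v + u) x x)

/-- Jensen's inequality for the average, followed by Kadison–Schwarz for each `T_u`, which moves the
time from `v` to `v + u`. -/
theorem B_A_le {v c w : ℝ} (hv : 0 ≤ v) (hc : 0 < c) (hw : 0 < w) {f : ℝ → ℝ}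
    (hf : Integrable f halfLine) (hfc : ∀ u, 0 < u → |f u| ≤ c * poissonKernel w u) (x : V) :
    F.B v (F.A (mkL1 f) x) (F.A (mkL1 f) x) ≤
      c ^ 2 * ∫ u, poissonKernel w u * F.B (v + u) x x ∂halfLine := by
  refine F.B_self_le_of_eq_integral hc hw hfc (z := fun u => F.T u x) ?_
    (fun u hu => F.B_T v u x hv hu.le) (F.integrable_mul_B_add hw v x)
  rw [F.B_A]
  exact integral_congr_ae ((coeFn_mkL1 hf).mono fun u hu => by simp only [hu])

theorem measurable_integral_B_add (w : ℝ) (x : V) :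
    Measurable fun v => ∫ u, poissonKernel w u * F.B (v + u) x x ∂halfLine := by
  have h : StronglyMeasurable (fun p : ℝ × ℝ => poissonKernel w p.2 * F.B (p.1 + p.2) x x) :=
    (((measurable_poissonKernel w).comp measurable_snd).mul
      ((F.measurable_B x x).comp (measurable_fst.add measurable_snd))).stronglyMeasurable
  exact h.integral_prod_right'.measurable

theorem integrable_mul_integral_B_add {t w : ℝ} (ht : 0 < t) (hw : 0 < w) (x : V) :
    Integrable (fun v => poissonKernel t v *
      ∫ u, poissonKernel w u * F.B (v + u) x x ∂halfLine) halfLine := by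
  refine (integrable_poissonKernel ht).mul_bdd (c := F.K * ‖x‖ * ‖x‖)
    (F.measurable_integral_B_add w x).aestronglyMeasurable (Eventually.of_forall fun v => ?_)
  refine (norm_integral_le_of_norm_le ((integrable_poissonKernel hw).mul_const (F.K * ‖x‖ * ‖x‖))
    ((ae_restrict_iff' measurableSet_Ioi).2 (Eventually.of_forall fun u hu => ?_))).trans_eq ?_
  · have hp := poissonKernel_pos hw hu
    rw [norm_mul, Real.norm_of_nonneg hp.le]
    exact mul_le_mul_of_nonneg_left (F.bound (v + u) x x) hp.le
  · have := integral_poissonKernel hw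
    rw [integral_mul_const, halfLine, this, one_mul]

theorem integral_mul_integral_B_add {t w : ℝ} (ht : 0 < t) (hw : 0 < w) (x : V) :
    ∫ v, poissonKernel t v * ∫ u, poissonKernel w u * F.B (v + u) x x ∂halfLine ∂halfLine =
      F.C (poissonL1 (t + w)) x x := by
  rw [poissonL1, F.C_mkL1 (integrable_poissonKernel (by positivity))]
  exact integral_integral_poissonKernel ht hw (F := fun v => F.B v x x)
    (F.measurable_B x x).aestronglyMeasurable fun v _ => F.bound v x x

theorem C_A_le {t c w : ℝ} (ht : 0 < t) (hc : 0 < c) (hw : 0 < w) {f : ℝ → ℝ}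
    (hf : Integrable f halfLine) (hfc : ∀ u, 0 < u → |f u| ≤ c * poissonKernel w u) (x : V) :
    F.C (poissonL1 t) (F.A (mkL1 f) x) (F.A (mkL1 f) x) ≤
      c ^ 2 * F.C (poissonL1 (t + w)) x x := by
  rw [← F.integral_mul_integral_B_add ht hw, ← integral_const_mul, poissonL1,
    F.C_mkL1 (integrable_poissonKernel ht)]
  refine integral_mono_ae (F.integrable_mul_B (integrable_poissonKernel ht) _ _)
    ((F.integrable_mul_integral_B_add ht hw x).const_mul _)
    ((ae_restrict_iff' measurableSet_Ioi).2 (Eventually.of_forall fun v hv => ?_))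
  have h := mul_le_mul_of_nonneg_left (F.B_A_le (le_of_lt hv) hc hw hf hfc x)
    (poissonKernel_pos ht hv).le
  dsimp only
  linarith

theorem C_poisson_le {t w : ℝ} (ht : 0 < t) (hw : 0 < w) (x : V) :
    F.C (poissonL1 t) (F.A (poissonL1 w) x) (F.A (poissonL1 w) x) ≤
      F.C (poissonL1 (t + w)) x x := by
  have := F.C_A_le ht one_pos hw (integrable_poissonKernel hw) (fun u hu => by
    rw [one_mul, abs_of_pos (poissonKernel_pos hw hu)]) x
  rwa [one_pow, one_mul] at this

theorem C_poissonDt_le {t w : ℝ} (ht : 0 < t) (hw : 0 < w) (x : V) :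
    F.C (poissonL1 t) (F.A (poissonL1Dt w) x) (F.A (poissonL1Dt w) x) ≤
      (8 / w) ^ 2 * F.C (poissonL1 (t + w / 2)) x x :=
  F.C_A_le ht (by positivity) (half_pos hw) (integrable_poissonKernelDt hw)
    (fun _ hu => abs_poissonKernelDt_le hw hu) x

/-- The defect in Jensen's inequality is monotone, up to a factor, in the kernel. -/
theorem defect_le {a b w : ℝ} (ha : 0 < a) (hab : a ≤ b) (hw : 0 < w) (x : V) :
    F.C (poissonL1 (b + w)) x x - F.C (poissonL1 b) (F.A (poissonL1 w) x) (F.A (poissonL1 w) x) ≤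
      b / a * (F.C (poissonL1 (a + w)) x x -
        F.C (poissonL1 a) (F.A (poissonL1 w) x) (F.A (poissonL1 w) x)) := by
  have hb := ha.trans_le hab
  -- The defect is the integral against `p_r` of a function of `v` that does not depend on `r` and
  -- is nonnegative by Jensen, so the pointwise comparison of kernels applies.
  have e : ∀ {r}, 0 < r → F.C (poissonL1 (r + w)) x x -
      F.C (poissonL1 r) (F.A (poissonL1 w) x) (F.A (poissonL1 w) x) =
      ∫ v, (poissonKernel r v * (∫ u, poissonKernel w u * F.B (v + u) x x ∂halfLine) -
        poissonKernel r v * F.B v (F.A (poissonL1 w) x) (F.A (poissonL1 w) x)) ∂halfLine := by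
    intro r hr
    rw [integral_sub (F.integrable_mul_integral_B_add hr hw x)
      (F.integrable_mul_B (integrable_poissonKernel hr) _ _), F.integral_mul_integral_B_add hr hw,
      ← F.C_mkL1 (integrable_poissonKernel hr)]
    rfl
  rw [e ha, e hb, ← integral_const_mul]
  have hi : ∀ {r}, 0 < r → Integrable (fun v =>
      poissonKernel r v * (∫ u, poissonKernel w u * F.B (v + u) x x ∂halfLine) -
        poissonKernel r v * F.B v (F.A (poissonL1 w) x) (F.A (poissonL1 w) x)) halfLine :=
    fun hr => (F.integrable_mul_integral_B_add hr hw x).sub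
      (F.integrable_mul_B (integrable_poissonKernel hr) _ _)
  refine integral_mono_ae (hi hb) ((hi ha).const_mul _)
    ((ae_restrict_iff' measurableSet_Ioi).2 (Eventually.of_forall fun v hv => ?_))
  dsimp only
  have h1 := F.B_A_le (le_of_lt hv) one_pos hw (integrable_poissonKernel hw) (fun u hu => by
    rw [one_mul, abs_of_pos (poissonKernel_pos hw hu)]) x
  rw [one_pow, one_mul] at h1
  rw [← mul_sub, ← mul_sub, ← mul_assoc]
  exact mul_le_mul_of_nonneg_right (poissonKernel_le_of_le ha hab hv) (sub_nonneg.2 h1)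

theorem hasDerivWithinAt_C {k : ℝ → K1} {k' : K1} {x y : ℝ → V} {x' y' : V} {S : Set ℝ} {s : ℝ}
    (hk : HasDerivWithinAt k k' S s) (hx : HasDerivWithinAt x x' S s)
    (hy : HasDerivWithinAt y y' S s) :
    HasDerivWithinAt (fun s => F.C (k s) (x s) (y s))
      (F.C k' (x s) (y s) + F.C (k s) x' (y s) + F.C (k s) (x s) y') S s :=
  hasDerivWithinAt_trilinear F.C hk hx hy

theorem hasDerivAt_C {k : ℝ → K1} {k' : K1} {x y : ℝ → V} {x' y' : V} {s : ℝ}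
    (hk : HasDerivAt k k' s) (hx : HasDerivAt x x' s) (hy : HasDerivAt y y' s) :
    HasDerivAt (fun s => F.C (k s) (x s) (y s))
      (F.C k' (x s) (y s) + F.C (k s) x' (y s) + F.C (k s) (x s) y') s := by
  rw [← hasDerivWithinAt_univ] at *
  exact F.hasDerivWithinAt_C hk hx hy

theorem hasDerivWithinAt_A {k : ℝ → K1} {k' : K1} {S : Set ℝ} {s : ℝ}
    (hk : HasDerivWithinAt k k' S s) (x : V) :
    HasDerivWithinAt (fun s => F.A (k s) x) (F.A k' x) S s :=
  ((F.A.flip x).hasFDerivAt (x := k s)).comp_hasDerivWithinAt s hk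

theorem hasDerivAt_A {k : ℝ → K1} {k' : K1} {s : ℝ} (hk : HasDerivAt k k' s) (x : V) :
    HasDerivAt (fun s => F.A (k s) x) (F.A k' x) s :=
  ((F.A.flip x).hasFDerivAt (x := k s)).comp_hasDerivAt s hk

theorem A_Dt_A {s t : ℝ} (hs : 0 < s) (ht : 0 < t) (x : V) :
    F.A (poissonL1Dt s) (F.A (poissonL1 t) x) = F.A (poissonL1Dt (s + t)) x := by
  have h1 := F.hasDerivAt_A (hasDerivAt_poissonL1 hs) (F.A (poissonL1 t) x)
  have h2 : HasDerivAt (fun r => F.A (poissonL1 (r + t)) x) (F.A (poissonL1Dt (s + t)) x) s :=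
    F.hasDerivAt_A ((hasDerivAt_poissonL1 (add_pos hs ht)).comp_add_const s t) x
  refine h1.unique (h2.congr_of_eventuallyEq ?_)
  filter_upwards [Ioi_mem_nhds hs] with r hr
  exact F.A_A r t x hr ht

end Frame

end Frame

/-! ### The first inequality, for a frame -/

namespace Frame

variable {V : Type*} [NormedAddCommGroup V] [NormedSpace ℝ V] (F : Frame V)

/-- The Poisson semigroup of a frame. -/
abbrev P (s : ℝ) : V →L[ℝ] V := F.A (poissonL1 s)

/-- The derivative of the Poisson semigroup of a frame. -/
abbrev Q (s : ℝ) : V →L[ℝ] V := F.A (poissonL1Dt s)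

theorem hasDerivAt_P {s : ℝ} (hs : 0 < s) (g : V) : HasDerivAt (fun s => F.P s g) (F.Q s g) s :=
  F.hasDerivAt_A (hasDerivAt_poissonL1 hs) g

theorem hasDerivAt_Q {s : ℝ} (hs : 0 < s) (g : V) :
    HasDerivAt (fun s => F.Q s g) (F.A (poissonL1Du s) g) s :=
  F.hasDerivAt_A (hasDerivAt_poissonL1Dt hs) g

/-- The derivative at `δ = 0` of `∫ poissonKernel (r + δ) B(h, h) - ∫ poissonKernel r B(P_δ h, P_δ h)`,
for `h = P_s g`. -/
def energy (r s : ℝ) (g : V) : ℝ :=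
  F.C (poissonL1Dt r) (F.P s g) (F.P s g) - 2 * F.C (poissonL1 r) (F.P s g) (F.Q s g)

theorem hasDerivAt_defect {r s : ℝ} (hr : 0 < r) (hs : 0 < s) (g : V) :
    HasDerivAt (fun δ => F.C (poissonL1 (r + δ)) (F.P s g) (F.P s g) -
      F.C (poissonL1 r) (F.P (s + δ) g) (F.P (s + δ) g)) (F.energy r s g) 0 := by
  have h1 : HasDerivAt (fun δ => poissonL1 (r + δ)) (poissonL1Dt r) 0 :=
    HasDerivAt.comp_const_add r 0 (by simpa using hasDerivAt_poissonL1 hr)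
  have h2 : HasDerivAt (fun δ => F.P (s + δ) g) (F.Q s g) 0 :=
    HasDerivAt.comp_const_add (f := fun s => F.P s g) s 0 (by simpa using F.hasDerivAt_P hs g)
  have h3 := F.hasDerivAt_C h1 (hasDerivAt_const _ (F.P s g)) (hasDerivAt_const _ (F.P s g))
  have h4 := F.hasDerivAt_C (hasDerivAt_const _ (poissonL1 r)) h2 h2
  refine (h3.sub h4).congr_deriv ?_
  simp only [map_zero, zero_apply, add_zero, zero_add, energy, F.C_symm _ (F.Q s g)]
  ring

theorem P_P {s t : ℝ} (hs : 0 < s) (ht : 0 < t) (g : V) : F.P s (F.P t g) = F.P (s + t) g :=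
  F.A_A s t g hs ht

theorem energy_nonneg {r s : ℝ} (hr : 0 < r) (hs : 0 < s) (g : V) : 0 ≤ F.energy r s g := by
  refine deriv_le_of_eventually_le (hasDerivWithinAt_const 0 (Ici 0) (0 : ℝ))
    (F.hasDerivAt_defect hr hs g).hasDerivWithinAt (by simp) ?_
  filter_upwards [self_mem_nhdsWithin] with δ hδ
  have := F.C_poisson_le hr hδ (F.P s g)
  rw [F.P_P hδ hs, add_comm δ s] at this
  exact sub_nonneg.2 this

theorem energy_le {a b s : ℝ} (ha : 0 < a) (hab : a ≤ b) (hs : 0 < s) (g : V) :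
    F.energy b s g ≤ b / a * F.energy a s g := by
  refine deriv_le_of_eventually_le (F.hasDerivAt_defect (ha.trans_le hab) hs g).hasDerivWithinAt
    ((F.hasDerivAt_defect ha hs g).const_mul (b / a)).hasDerivWithinAt (by simp) ?_
  filter_upwards [self_mem_nhdsWithin] with δ hδ
  have := F.defect_le ha hab hδ (F.P s g)
  rwa [F.P_P hδ hs, add_comm δ s] at this

theorem C_T_le {r ε : ℝ} (hr : 0 < r) (hε : 0 ≤ ε) (x : V) :
    F.C (poissonL1 r) (F.T ε x) (F.T ε x) ≤ F.C (mkL1 (shiftedKernel r ε)) x x := by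
  have e : ∫ v, shiftedKernel r ε v * F.B v x x ∂halfLine =
      ∫ v, poissonKernel r v * F.B (v + ε) x x ∂halfLine :=
    integral_shiftedKernel_smul r hε fun v => F.B v x x
  rw [F.C_mkL1 (integrable_shiftedKernel ε hr), e, poissonL1,
    F.C_mkL1 (integrable_poissonKernel hr)]
  refine integral_mono_ae (F.integrable_mul_B (integrable_poissonKernel hr) _ _) ?_
    ((ae_restrict_iff' measurableSet_Ioi).2 (Eventually.of_forall fun v hv =>
      mul_le_mul_of_nonneg_left (F.B_T v ε x (le_of_lt hv) hε) (poissonKernel_pos hr hv).le))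
  have := F.integrable_mul_B_add hr ε x
  simpa only [add_comm ε] using this

/-- Positivity of the carré du champ of `T` at `P_s g`, integrated against `p_r`. Kadison–Schwarz
for `T_ε` is an equality at `ε = 0`, so the right derivatives there are ordered, and both come from
the shifted kernel. -/
theorem C_Du_le {r s : ℝ} (hr : 0 < r) (hs : 0 < s) (g : V) :
    F.C (poissonL1Du r) (F.P s g) (F.P s g) ≤
      2 * F.C (poissonL1 r) (F.P s g) (F.A (poissonL1Du s) g) := by
  have e : ∀ t, mkL1 (shiftedKernel t 0) = poissonL1 t := fun t =>
    mkL1_congr fun u hu => shiftedKernel_zero t hu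
  have h1 := F.hasDerivWithinAt_C (hasDerivWithinAt_shiftedKernel hr)
    (hasDerivWithinAt_const _ _ (F.P s g)) (hasDerivWithinAt_const _ _ (F.P s g))
  have h2 := F.hasDerivWithinAt_A (hasDerivWithinAt_shiftedKernel hs) g
  have h3 := F.hasDerivWithinAt_C (hasDerivWithinAt_const _ _ (poissonL1 r)) h2 h2
  have h4 := deriv_le_of_eventually_le h3 h1 (by simp only [e]) (by
    filter_upwards [self_mem_nhdsWithin] with ε hε
    have := F.C_T_le hr (le_of_lt hε) (F.P s g)
    rwa [F.T_A ε s g (le_of_lt hε) hs] at this)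
  simp only [map_zero, zero_apply, add_zero, zero_add, e, map_neg, neg_apply,
    F.C_symm _ (F.A (poissonL1Du s) g)] at h4
  linarith

/-- The derivative of `s ↦ energy (t + s) s g`. -/
def energyDeriv (t s : ℝ) (g : V) : ℝ :=
  F.C (poissonL1Du (t + s)) (F.P s g) (F.P s g) -
    2 * F.C (poissonL1 (t + s)) (F.P s g) (F.A (poissonL1Du s) g) -
    2 * F.C (poissonL1 (t + s)) (F.Q s g) (F.Q s g)

/-- On the diagonal `r = t + s` the cross terms containing `poissonL1Dt (t + s)` cancel. -/
theorem hasDerivAt_energy {t s : ℝ} (ht : 0 < t) (hs : 0 < s) (g : V) :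
    HasDerivAt (fun s => F.energy (t + s) s g) (F.energyDeriv t s g) s := by
  have hts := add_pos ht hs
  have hP := F.hasDerivAt_P hs g
  have hQ := F.hasDerivAt_Q hs g
  have h1 := F.hasDerivAt_C ((hasDerivAt_poissonL1Dt hts).comp_const_add t s) hP hP
  have h2 := F.hasDerivAt_C ((hasDerivAt_poissonL1 hts).comp_const_add t s) hP hQ
  refine (h1.sub (h2.const_mul 2)).congr_deriv ?_
  simp only [energyDeriv, F.C_symm _ (F.Q s g) (F.P s g)]
  ring

theorem energyDeriv_le {t s : ℝ} (ht : 0 < t) (hs : 0 < s) (g : V) :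
    F.energyDeriv t s g ≤ -(2 * F.C (poissonL1 (t + s)) (F.Q s g) (F.Q s g)) := by
  have := F.C_Du_le (add_pos ht hs) hs g
  rw [energyDeriv]
  linarith

/-- On the antidiagonal `r = t - s` the energy is an exact derivative, so its integral is a
difference of boundary values. -/
theorem hasDerivAt_C_sub {t s : ℝ} (hs : 0 < s) (hst : s < t) (g : V) :
    HasDerivAt (fun s => F.C (poissonL1 (t - s)) (F.P s g) (F.P s g)) (-F.energy (t - s) s g) s := by
  have hP := F.hasDerivAt_P hs g
  have hk : HasDerivAt (fun s => poissonL1 (t - s)) (-poissonL1Dt (t - s)) s :=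
    (hasDerivAt_poissonL1 (sub_pos.2 hst)).comp_const_sub t s
  refine (F.hasDerivAt_C hk hP hP).congr_deriv ?_
  simp only [energy, F.C_symm _ (F.Q s g) (F.P s g), map_neg, neg_apply]
  ring

theorem energy_add_le {t s : ℝ} (hs : 0 < s) (hst : s ≤ t / 2) (g : V) :
    F.energy (t + s) s g ≤ 3 * F.energy (t - s) s g := by
  have h0 : 0 < t - s := by linarith
  refine (F.energy_le h0 (by linarith) hs g).trans
    (mul_le_mul_of_nonneg_right ?_ (F.energy_nonneg h0 hs g))
  rw [div_le_iff₀ h0]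
  linarith

theorem C_sub_le {t s : ℝ} (hs : 0 < s) (hst : s < t) (g : V) :
    F.C (poissonL1 (t - s)) (F.P s g) (F.P s g) ≤ F.C (poissonL1 t) g g := by
  simpa using F.C_poisson_le (sub_pos.2 hst) hs g

theorem continuousOn_C_Q (c d : ℝ) (hd : ∀ s, 0 < s → 0 < c * s + d) (g : V) :
    ContinuousOn (fun s => F.C (poissonL1 (c * s + d)) (F.Q s g) (F.Q s g)) (Ioi 0) := by
  intro s hs
  have hQ := F.hasDerivAt_Q hs g
  have hl : HasDerivAt (fun s : ℝ => c * s + d) (c * 1) s :=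
    ((hasDerivAt_id s).const_mul c).add_const d
  have hk : HasDerivAt (fun s => poissonL1 (c * s + d)) ((c * 1) • poissonL1Dt (c * s + d)) s :=
    HasDerivAt.scomp (h := fun s => c * s + d) (g₁ := poissonL1) s
      (hasDerivAt_poissonL1 (hd s hs)) hl
  exact (F.hasDerivAt_C hk hQ hQ).continuousAt.continuousWithinAt

/-- The boundary term of the integration by parts. The energy decreases along the diagonal, so `(a /
2)` times its value at `a` is at most its integral over `[a/2, a]`. By `energy_add_le` this is at
most `3` times the integral along the antidiagonal, which is at most `C(p_t, g, g)`. -/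
theorem mul_energy_le {t a : ℝ} (ha : 0 < a) (hat : a ≤ t / 2) (g : V) :
    a * F.energy (t + a) a g ≤ 6 * F.C (poissonL1 t) g g := by
  have ht : 0 < t := by linarith
  have hanti : ∀ s ∈ Icc (a / 2) a, F.energy (t + a) a g ≤ F.energy (t + s) s g := by
    have : AntitoneOn (fun s => F.energy (t + s) s g) (Icc (a / 2) a) := by
      refine antitoneOn_of_hasDerivWithinAt_nonpos (f' := fun s => F.energyDeriv t s g)
        (convex_Icc _ _)
        (fun s hs => (F.hasDerivAt_energy ht (by linarith [hs.1]) g).continuousAt.continuousWithinAt)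
        (fun s hs => ?_) (fun s hs => ?_)
      · rw [interior_Icc] at hs
        exact (F.hasDerivAt_energy ht (by linarith [hs.1]) g).hasDerivWithinAt
      · rw [interior_Icc] at hs
        have hs0 : 0 < s := by linarith [hs.1]
        have := F.C_nonneg (add_pos ht hs0) (F.Q s g)
        linarith [F.energyDeriv_le ht hs0 g]
    exact fun s hs => this hs (right_mem_Icc.2 (by linarith)) hs.2
  have hlt : a < t := by linarith
  have h := intervalIntegral.integral_le_sub_of_hasDeriv_right_of_le (a := a / 2) (b := a)
    (φ := fun _ => F.energy (t + a) a g)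
    (g := fun s => -(3 * F.C (poissonL1 (t - s)) (F.P s g) (F.P s g)))
    (g' := fun s => 3 * F.energy (t - s) s g) (by linarith)
    (fun s hs => (((F.hasDerivAt_C_sub (by linarith [hs.1]) (hs.2.trans_lt hlt) g).const_mul
      3).neg.continuousAt.continuousWithinAt))
    (fun s hs => (((F.hasDerivAt_C_sub (by linarith [hs.1]) (hs.2.trans hlt) g).const_mul
      3).neg.hasDerivWithinAt.congr_deriv (by ring)))
    (by simp)
    (fun s hs => (hanti s ⟨hs.1.le, hs.2.le⟩).trans
      (F.energy_add_le (by linarith [hs.1]) (by linarith [hs.2]) g))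
  rw [intervalIntegral.integral_const, smul_eq_mul] at h
  have h1 := F.C_sub_le (t := t) (s := a / 2) (by linarith) (by linarith) g
  have h2 := F.C_nonneg (t := t - a) (by linarith) (F.P a g)
  linarith

/-- Integration by parts in `-s · d/ds E(t+s, s)`. The function `-(s E(t+s, s) + 3 C(p_{t-s}, P_s g,
P_s g))` has derivative at least the integrand; its lower boundary value costs `6 + 3`, and the
upper one has a favourable sign. -/
theorem integral_mul_C_add_le {t a : ℝ} (ha : 0 < a) (hat : a ≤ t / 2) (g : V) :
    ∫ s in a..(t / 2), 2 * (s * F.C (poissonL1 (t + s)) (F.Q s g) (F.Q s g)) ≤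
      9 * F.C (poissonL1 t) g g := by
  have ht : 0 < t := by linarith
  have hcont : ContinuousOn (fun s => 2 * (s * F.C (poissonL1 (t + s)) (F.Q s g) (F.Q s g)))
      (Ioi 0) := by
    have := F.continuousOn_C_Q 1 t (fun s hs => by linarith) g
    simp only [one_mul, add_comm _ t] at this
    exact continuousOn_const.mul (continuousOn_id.mul this)
  have hder : ∀ s, 0 < s → s ≤ t / 2 → HasDerivAt (fun s => -(s * F.energy (t + s) s g +
      3 * F.C (poissonL1 (t - s)) (F.P s g) (F.P s g))) (-(1 * F.energy (t + s) s g +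
        s * F.energyDeriv t s g + 3 * -F.energy (t - s) s g)) s := fun s hs hst =>
    ((((hasDerivAt_id s).mul (F.hasDerivAt_energy ht hs g))).add
      ((F.hasDerivAt_C_sub hs (by linarith) g).const_mul 3)).neg
  have h := intervalIntegral.integral_le_sub_of_hasDeriv_right_of_le (a := a) (b := t / 2)
    (φ := fun s => 2 * (s * F.C (poissonL1 (t + s)) (F.Q s g) (F.Q s g))) hat
    (fun s hs => (hder s (ha.trans_le hs.1) hs.2).continuousAt.continuousWithinAt)
    (fun s hs => (hder s (ha.trans hs.1) hs.2.le).hasDerivWithinAt)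
    (hcont.mono fun s hs => ha.trans_le hs.1).integrableOn_Icc
    (fun s hs => by
      have hs0 := ha.trans hs.1
      have h1 := mul_le_mul_of_nonneg_left (F.energyDeriv_le ht hs0 g) hs0.le
      have h2 := F.energy_add_le hs0 hs.2.le g
      linarith)
  have h1 := F.mul_energy_le ha hat g
  have h2 := F.C_sub_le (t := t) ha (by linarith) g
  have h3 := F.C_nonneg (t := t - t / 2) (by linarith) (F.P (t / 2) g)
  have h4 := mul_nonneg (half_pos ht).le (F.energy_nonneg (r := t + t / 2) (by linarith)
    (half_pos ht) g)
  linarith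

/-- Since `t + s ≤ 3t/2`, the fixed kernel at time `3t/2` costs a factor at most `3/2`; the constant
is then `(3/2)(9/2) = 27/4 ≤ 7`. -/
theorem integral_mul_C_le {t a : ℝ} (ha : 0 < a) (hat : a ≤ t / 2) (g : V) :
    ∫ s in a..(t / 2), s * F.C (poissonL1 (3 * t / 2)) (F.Q s g) (F.Q s g) ≤
      7 * F.C (poissonL1 t) g g := by
  have ht : 0 < t := by linarith
  have h1 := F.integral_mul_C_add_le ha hat g
  have hc : ∀ φ : ℝ → ℝ, ContinuousOn φ (Ioi 0) → IntervalIntegrable φ volume a (t / 2) :=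
    fun φ hφ => (hφ.mono fun s hs => by
      rw [uIcc_of_le hat] at hs; exact ha.trans_le hs.1).intervalIntegrable
  have c1 := F.continuousOn_C_Q 0 (3 * t / 2) (fun s hs => by linarith) g
  have c2 := F.continuousOn_C_Q 1 t (fun s hs => by linarith) g
  simp only [one_mul, zero_mul, zero_add, add_comm _ t] at c1 c2
  have h2 := intervalIntegral.integral_mono_on hat (hc _ (continuousOn_id.mul c1))
    (hc _ ((continuousOn_const (c := (3 / 4 : ℝ))).mul
      ((continuousOn_const (c := (2 : ℝ))).mul (continuousOn_id.mul c2)))) (fun s hs => ?_)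
  · refine h2.trans ?_
    simp only [Pi.mul_apply, id]
    rw [intervalIntegral.integral_const_mul]
    have := F.C_nonneg ht g
    refine (mul_le_mul_of_nonneg_left h1 (by norm_num)).trans ?_
    linarith
  · have hs0 : 0 < s := ha.trans_le hs.1
    have h3 := F.C_le_of_le (a := t + s) (b := 3 * t / 2) (by linarith) (by linarith [hs.2])
      (F.Q s g)
    have h4 : 3 * t / 2 / (t + s) ≤ 3 / 2 := by
      rw [div_le_iff₀ (by linarith)]; linarith
    have h5 := h3.trans (mul_le_mul_of_nonneg_right h4 (F.C_nonneg (by linarith) (F.Q s g)))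
    have h6 := mul_le_mul_of_nonneg_left h5 hs0.le
    simp only [Pi.mul_apply, id]
    linarith

/-! ### Pointwise control of the derivative, and assembly of the first inequality -/

theorem C_Q_sub_le {f : V} {M : ℝ} (hM : ∀ t, 0 < t →
    F.C (poissonL1 t) (f - F.P t f) (f - F.P t f) ≤ M ^ 2) {T w : ℝ} (hT : 0 < T)
    (hw : T ≤ 3 * w) :
    F.C (poissonL1 T) (F.Q w (f - F.P w f)) (F.Q w (f - F.P w f)) ≤ (44 * M / w) ^ 2 := by
  have hw0 : 0 < w := by linarith
  have hw2 := half_pos hw0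
  -- The hypothesis at time `w` would not do: comparison only raises times, and `T + w/2` may be
  -- smaller than `w`. At time `w / 2` it can always be applied, with ratios at most `7` and `8`
  -- because `T ≤ 3 w`.
  set x := f - F.P (w / 2) f with hx
  have e : f - F.P w f = x + F.P (w / 2) x := by
    rw [hx, map_sub, F.P_P hw2 hw2, add_halves]
    abel
  have h0 := F.C_nonneg hw2 x
  have h1 : F.C (poissonL1 (T + w / 2)) x x ≤ 7 * M ^ 2 := by
    refine (F.C_le_of_le hw2 (by linarith) x).trans ?_
    refine mul_le_mul ?_ (hM _ hw2) h0 (by norm_num)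
    rw [div_le_iff₀ hw2]; linarith
  have h2 : F.C (poissonL1 (T + w / 2)) (F.P (w / 2) x) (F.P (w / 2) x) ≤ 8 * M ^ 2 := by
    refine (F.C_poisson_le (by linarith) hw2 x).trans
      ((F.C_le_of_le hw2 (by linarith) x).trans ?_)
    refine mul_le_mul ?_ (hM _ hw2) h0 (by norm_num)
    rw [div_le_iff₀ hw2]; linarith
  refine (F.C_poissonDt_le hT hw0 _).trans ?_
  have h3 := F.C_add_le_two (t := T + w / 2) (by linarith) x (F.P (w / 2) x)
  rw [← e] at h3
  have h4 : F.C (poissonL1 (T + w / 2)) (f - F.P w f) (f - F.P w f) ≤ 30 * M ^ 2 := by linarith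
  -- Here `30 = 2 · 7 + 2 · 8`, and `8² · 30 = 1920 ≤ 44²`.
  calc (8 / w) ^ 2 * F.C (poissonL1 (T + w / 2)) (f - F.P w f) (f - F.P w f)
      ≤ (8 / w) ^ 2 * (30 * M ^ 2) := mul_le_mul_of_nonneg_left h4 (by positivity)
    _ ≤ (44 * M / w) ^ 2 := by
        rw [div_pow, div_pow, div_mul_eq_mul_div]
        refine div_le_div_of_nonneg_right ?_ (by positivity)
        nlinarith [sq_nonneg M]

/-- Iterating `P_w' f = P_w'(f - P_w f) + P_{2w}' f` and the triangle inequality for the seminorm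
`C(p_T, ·, ·)^{1/2}`, the terms `44 M / (2ⁿ s)` add up to at most `88 M / s`. -/
theorem C_Q_le {f : V} {M : ℝ} (hM : ∀ t, 0 < t →
    F.C (poissonL1 t) (f - F.P t f) (f - F.P t f) ≤ M ^ 2) {T s : ℝ} (hT : 0 < T)
    (hs : T ≤ 3 * s) (hM0 : 0 ≤ M) :
    F.C (poissonL1 T) (F.Q s f) (F.Q s f) ≤ (88 * M / s) ^ 2 := by
  have hs0 : 0 < s := by linarith
  -- telescoping along `s, 2 s, 4 s, …`
  have key : ∀ (n : ℕ) (w : ℝ), s ≤ w → ∀ β, 0 ≤ β →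
      F.C (poissonL1 T) (F.Q (2 ^ n * w) f) (F.Q (2 ^ n * w) f) ≤ β ^ 2 →
      F.C (poissonL1 T) (F.Q w f) (F.Q w f) ≤ (88 * M / w + β) ^ 2 := by
    intro n
    induction n with
    | zero =>
      intro w hw β hβ h
      rw [pow_zero, one_mul] at h
      refine h.trans (pow_le_pow_left₀ hβ (le_add_of_nonneg_left ?_) 2)
      have : 0 < w := by linarith
      positivity
    | succ n ih =>
      intro w hw β hβ h
      have hw0 : 0 < w := by linarith
      have h1 := ih (2 * w) (by linarith) β hβ (by rwa [← mul_assoc, ← pow_succ])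
      have h2 := F.C_Q_sub_le hM hT (w := w) (by linarith)
      have e : F.Q w f = F.Q w (f - F.P w f) + F.Q (2 * w) f := by
        rw [map_sub, F.A_Dt_A hw0 hw0, two_mul, sub_add_cancel]
      have h3 := F.C_add_le hT (by positivity) (by positivity) h2 h1
      rw [← e] at h3
      refine h3.trans_eq ?_
      congr 1
      field_simp
      ring
  -- The remainder of the telescoping tends to zero, since `P_w'` has norm at most `‖F.A‖ · 8 / w`.
  set L := √‖F.C (poissonL1 T)‖ * (‖F.A‖ * ‖f‖) with hL
  have hQ : ∀ w, 0 < w → F.C (poissonL1 T) (F.Q w f) (F.Q w f) ≤ (L * (8 / w)) ^ 2 := by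
    intro w hw
    have h1 : ‖F.Q w f‖ ≤ ‖F.A‖ * ‖f‖ * (8 / w) := by
      refine ((F.Q w).le_opNorm f).trans ?_
      have := (F.A.le_opNorm (poissonL1Dt w)).trans
        (mul_le_mul_of_nonneg_left (norm_poissonL1Dt_le hw) (norm_nonneg _))
      calc ‖F.Q w‖ * ‖f‖ ≤ ‖F.A‖ * (8 / w) * ‖f‖ :=
            mul_le_mul_of_nonneg_right this (norm_nonneg _)
        _ = _ := by ring
    refine (le_abs_self _).trans (((F.C (poissonL1 T)).le_opNorm₂ _ _).trans ?_)
    have h2 := Real.sq_sqrt (norm_nonneg (F.C (poissonL1 T)))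
    calc ‖F.C (poissonL1 T)‖ * ‖F.Q w f‖ * ‖F.Q w f‖
        ≤ ‖F.C (poissonL1 T)‖ * (‖F.A‖ * ‖f‖ * (8 / w)) * (‖F.A‖ * ‖f‖ * (8 / w)) := by gcongr
      _ = √‖F.C (poissonL1 T)‖ ^ 2 * (‖F.A‖ * ‖f‖ * (8 / w)) * (‖F.A‖ * ‖f‖ * (8 / w)) := by
          rw [h2]
      _ = _ := by rw [hL]; ring
  have hlim : Tendsto (fun n : ℕ => (88 * M / s + L * (8 / (2 ^ n * s))) ^ 2) atTop
      (𝓝 ((88 * M / s + L * 0) ^ 2)) := by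
    have h1 : Tendsto (fun n : ℕ => (2 : ℝ) ^ n * s) atTop atTop :=
      (tendsto_pow_atTop_atTop_of_one_lt one_lt_two).atTop_mul_const hs0
    exact (((tendsto_const_nhds.div_atTop h1).const_mul L).const_add _).pow 2
  rw [mul_zero, add_zero] at hlim
  exact ge_of_tendsto' hlim fun n =>
    key n s le_rfl _ (by positivity) (hQ _ (by positivity))

theorem lintegral_Ioo_le_of_forall_integral_le {φ : ℝ → ℝ} {b M : ℝ}
    (hφ : ContinuousOn φ (Ioi 0)) (hφ0 : ∀ s, 0 < s → 0 ≤ φ s) (hb : 0 < b)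
    (h : ∀ a, 0 < a → a ≤ b → ∫ s in a..b, φ s ≤ M) :
    ∫⁻ s in Ioo 0 b, ENNReal.ofReal (φ s) ≤ ENNReal.ofReal M := by
  have ha : Tendsto (fun n : ℕ => b * (1 / ((n : ℝ) + 1))) atTop (𝓝 0) := by
    simpa using tendsto_one_div_add_atTop_nhds_zero_nat.const_mul b
  have hcov := aecover_Ioc_of_Ioc (μ := volume) ha (tendsto_const_nhds (x := b))
  have hm : AEMeasurable (fun s => ENNReal.ofReal (φ s)) (volume.restrict (Ioc 0 b)) :=
    ((hφ.mono Ioc_subset_Ioi_self).aemeasurable measurableSet_Ioc).ennreal_ofReal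
  have hlim := hcov.lintegral_tendsto_of_countably_generated hm
  rw [restrict_Ioo_eq_restrict_Ioc]
  refine le_of_tendsto' hlim fun n => ?_
  have h0 : 0 < b * (1 / ((n : ℝ) + 1)) := by positivity
  have h1 : b * (1 / ((n : ℝ) + 1)) ≤ b := by
    refine mul_le_of_le_one_right hb.le ?_
    rw [div_le_one (by positivity)]
    linarith [(Nat.cast_nonneg n : (0 : ℝ) ≤ n)]
  rw [Measure.restrict_restrict measurableSet_Ioc,
    inter_eq_left.2 (Ioc_subset_Ioc_left h0.le)]
  have hint : IntegrableOn φ (Ioc (b * (1 / ((n : ℝ) + 1))) b) :=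
    ((hφ.mono fun s hs => h0.trans_le hs.1).integrableOn_Icc).mono_set Ioc_subset_Icc_self
  rw [← ofReal_integral_eq_lintegral_ofReal hint
    ((ae_restrict_iff' measurableSet_Ioc).2 (Eventually.of_forall fun s hs =>
      hφ0 s (h0.trans hs.1)))]
  have := h _ h0 h1
  rw [intervalIntegral.integral_of_le h1] at this
  exact ENNReal.ofReal_le_ofReal this

theorem lintegral_Ioo_le_of_le {φ : ℝ → ℝ} {a b c : ℝ} (hc : 0 ≤ c)
    (h : ∀ s ∈ Ioo a b, φ s ≤ c) :
    ∫⁻ s in Ioo a b, ENNReal.ofReal (φ s) ≤ ENNReal.ofReal (c * (b - a)) := by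
  calc ∫⁻ s in Ioo a b, ENNReal.ofReal (φ s) ≤ ∫⁻ _ in Ioo a b, ENNReal.ofReal c :=
        setLIntegral_mono measurable_const fun s hs => ENNReal.ofReal_le_ofReal (h s hs)
    _ = _ := by rw [setLIntegral_const, Real.volume_Ioo, ENNReal.ofReal_mul hc]

/-- If `p_t(f - P_t f) ≤ M` for all `t`, then `∫₀ᵀ p_T(∂ₛ P_s f)² s ds ≤ c M²`. -/
theorem lintegral_C_Q_le {f : V} {M : ℝ} (hM0 : 0 ≤ M) (hM : ∀ t, 0 < t →
    F.C (poissonL1 t) (f - F.P t f) (f - F.P t f) ≤ M ^ 2) {T : ℝ} (hT : 0 < T) :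
    ∫⁻ s in Ioo 0 T, ENNReal.ofReal (s * F.C (poissonL1 T) (F.Q s f) (F.Q s f)) ≤
      ENNReal.ofReal (62000 * M ^ 2) := by
  -- With this choice `3t/2 = T` and `t/2 = T/3`, so `integral_mul_C_le` covers `(0, T/3)` with the
  -- kernel at time `T`. There `P_s' f = P_s' g + P_{s+t}' f`, and `s + t` already lies in the range
  -- of the pointwise bound.
  set t := 2 * T / 3 with ht
  have ht0 : 0 < t := by positivity
  set g := f - F.P t f with hg
  have hT3 : 0 < T / 3 := by positivity
  have hbd : ∀ s, T / 3 ≤ s →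
      F.C (poissonL1 T) (F.Q s f) (F.Q s f) ≤ 88 ^ 2 * 9 * M ^ 2 / T ^ 2 := by
    intro s hs
    have hs0 : 0 < s := by linarith
    refine (F.C_Q_le hM hT (by linarith) hM0).trans ?_
    have h1 : 88 * M / s ≤ 88 * M / (T / 3) :=
      div_le_div_of_nonneg_left (by positivity) hT3 hs
    refine (pow_le_pow_left₀ (by positivity) h1 2).trans_eq ?_
    field_simp
    ring
  have hc := F.continuousOn_C_Q 0 T (fun s hs => by linarith) g
  simp only [zero_mul, zero_add] at hc
  -- the part near zero, for `g`
  have h1 : ∫⁻ s in Ioo 0 (T / 3), ENNReal.ofReal (s * F.C (poissonL1 T) (F.Q s g) (F.Q s g)) ≤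
      ENNReal.ofReal (7 * M ^ 2) := by
    refine lintegral_Ioo_le_of_forall_integral_le (continuousOn_id.mul hc)
      (fun s hs => mul_nonneg hs.le (F.C_nonneg hT _)) hT3 fun a ha haT => ?_
    have e1 : t / 2 = T / 3 := by rw [ht]; ring
    have e2 : 3 * t / 2 = T := by rw [ht]; ring
    have := F.integral_mul_C_le ha (t := t) (by linarith) g
    rw [e1, e2] at this
    exact this.trans (mul_le_mul_of_nonneg_left (hM t ht0) (by norm_num))
  have h2 : ∫⁻ s in Ioo 0 (T / 3),
      ENNReal.ofReal (s * F.C (poissonL1 T) (F.Q (s + t) f) (F.Q (s + t) f)) ≤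
      ENNReal.ofReal (88 ^ 2 * M ^ 2) := by
    refine (lintegral_Ioo_le_of_le (c := T / 3 * (88 ^ 2 * 9 * M ^ 2 / T ^ 2)) (by positivity) fun s hs => ?_).trans_eq ?_
    · exact mul_le_mul hs.2.le (hbd _ (by linarith [hs.1])) (F.C_nonneg hT _) hT3.le
    · congr 1; field_simp; ring
  have h3 : ∫⁻ s in Ico (T / 3) T, ENNReal.ofReal (s * F.C (poissonL1 T) (F.Q s f) (F.Q s f)) ≤
      ENNReal.ofReal (6 * 88 ^ 2 * M ^ 2) := by
    rw [← restrict_Ioo_eq_restrict_Ico]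
    refine (lintegral_Ioo_le_of_le (c := T * (88 ^ 2 * 9 * M ^ 2 / T ^ 2)) (by positivity) fun s hs => ?_).trans_eq ?_
    · exact mul_le_mul hs.2.le (hbd _ hs.1.le) (F.C_nonneg hT _) hT.le
    · congr 1; field_simp; ring
  have h4 : ∫⁻ s in Ioo 0 (T / 3), ENNReal.ofReal (s * F.C (poissonL1 T) (F.Q s f) (F.Q s f)) ≤
      2 * ENNReal.ofReal (7 * M ^ 2) + 2 * ENNReal.ofReal (88 ^ 2 * M ^ 2) := by
    have hmeas : AEMeasurable (fun s => ENNReal.ofReal (s * F.C (poissonL1 T) (F.Q s g) (F.Q s g)))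
        (volume.restrict (Ioo 0 (T / 3))) :=
      (((continuousOn_id.mul hc).mono Ioo_subset_Ioi_self).aemeasurable
        measurableSet_Ioo).ennreal_ofReal
    calc _ ≤ ∫⁻ s in Ioo 0 (T / 3),
          (2 * ENNReal.ofReal (s * F.C (poissonL1 T) (F.Q s g) (F.Q s g)) +
            2 * ENNReal.ofReal (s * F.C (poissonL1 T) (F.Q (s + t) f) (F.Q (s + t) f))) := by
          refine lintegral_mono_ae ((ae_restrict_iff' measurableSet_Ioo).2
            (Eventually.of_forall fun s hs => ?_))
          have hs0 : 0 < s := hs.1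
          have e : F.Q s f = F.Q s g + F.Q (s + t) f := by
            rw [hg, map_sub, F.A_Dt_A hs0 ht0, sub_add_cancel]
          have h := mul_le_mul_of_nonneg_left (F.C_add_le_two hT (F.Q s g) (F.Q (s + t) f)) hs0.le
          rw [← e] at h
          have n1 := mul_nonneg hs0.le (F.C_nonneg hT (F.Q s g))
          have n2 := mul_nonneg hs0.le (F.C_nonneg hT (F.Q (s + t) f))
          have h2e : (2 : ℝ≥0∞) = ENNReal.ofReal 2 := by simp
          rw [h2e, ← ENNReal.ofReal_mul zero_le_two, ← ENNReal.ofReal_mul zero_le_two,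
            ← ENNReal.ofReal_add (by positivity) (by positivity)]
          exact ENNReal.ofReal_le_ofReal (by linarith)
      _ = _ := by
          rw [lintegral_add_left' (hmeas.const_mul 2), lintegral_const_mul'' _ hmeas,
            lintegral_const_mul' _ _ (by simp)]
      _ ≤ _ := by gcongr
  have e : Ioo 0 T = Ioo 0 (T / 3) ∪ Ico (T / 3) T :=
    (Ioo_union_Ico_eq_Ioo hT3 (by linarith)).symm
  rw [e]
  refine (lintegral_union_le _ _ _).trans ((add_le_add h4 h3).trans ?_)
  have h2e : (2 : ℝ≥0∞) = ENNReal.ofReal 2 := by simp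
  rw [h2e, ← ENNReal.ofReal_mul zero_le_two, ← ENNReal.ofReal_mul zero_le_two,
    ← ENNReal.ofReal_add (by positivity) (by positivity),
    ← ENNReal.ofReal_add (by positivity) (by positivity)]
  refine ENNReal.ofReal_le_ofReal ?_
  -- The total is `2 · 7 + 2 · 88² + 6 · 88² = 61966`.
  nlinarith [sq_nonneg M]

end Frame

/-! ### The second inequality, for a frame -/

namespace Frame

variable {V : Type*} [NormedAddCommGroup V] [NormedSpace ℝ V] (F : Frame V)

/-- Write `f - T_u f = x + T_{u/2} x` with `x = f - T_{u/2} f`. By Kadison–Schwarz the second term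
at time `v` is bounded by `x` at time `v + u/2 ≥ u/2`, where the hypothesis applies. Each halving of
`u` thus costs one `M`. -/
theorem B_sub_T_le_of_le_two_pow {f : V} {M : ℝ} (hM0 : 0 ≤ M)
    (hM : ∀ u v, 0 < u → u ≤ v → F.B v (f - F.T u f) (f - F.T u f) ≤ M ^ 2) (n : ℕ) :
    ∀ u v, 0 < u → 0 < v → u ≤ 2 ^ n * v →
      F.B v (f - F.T u f) (f - F.T u f) ≤ (((n : ℝ) + 1) * M) ^ 2 := by
  induction n with
  | zero =>
    intro u v hu _ h
    simpa using hM u v hu (by simpa using h)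
  | succ n ih =>
    intro u v hu hv h
    have hu2 := half_pos hu
    set x := f - F.T (u / 2) f with hx
    have e : f - F.T u f = x + F.T (u / 2) x := by
      rw [hx, map_sub, ← F.T_add _ _ _ hu2.le hu2.le, add_halves]
      abel
    have h1 := ih (u / 2) v hu2 hv (by rw [pow_succ] at h; linarith)
    have h2 : F.B v (F.T (u / 2) x) (F.T (u / 2) x) ≤ M ^ 2 :=
      (F.B_T v (u / 2) x hv.le hu2.le).trans (hM _ _ hu2 (by linarith))
    have h3 := F.B_add_le (by positivity) hM0 h1 h2
    rw [e]
    refine h3.trans_eq ?_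
    push_cast
    ring

/-- Logarithmic growth is traded for a power that the tail `u^{-3/2}` of the Poisson kernel can
absorb. The constant `12` works because `12 · (log 2) / 8 > 1`; then `144 = 12²`. -/
theorem sq_add_two_le_two_pow (n : ℕ) {x : ℝ} (h : 2 ^ n ≤ x) :
    ((n : ℝ) + 2) ^ 2 ≤ 144 * x ^ (1 / 4 : ℝ) := by
  have hx0 : 0 < x := lt_of_lt_of_le (by positivity) h
  have h1 : (2 : ℝ) ^ ((n : ℝ) / 8) ≤ x ^ (1 / 8 : ℝ) := by
    refine le_trans (le_of_eq ?_) (Real.rpow_le_rpow (by positivity) h (by norm_num))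
    rw [← Real.rpow_natCast, ← Real.rpow_mul zero_le_two]
    ring_nf
  have h2 : Real.log 2 * ((n : ℝ) / 8) + 1 ≤ (2 : ℝ) ^ ((n : ℝ) / 8) := by
    rw [Real.rpow_def_of_pos two_pos]
    exact Real.add_one_le_exp _
  have h3 : (n : ℝ) + 2 ≤ 12 * x ^ (1 / 8 : ℝ) := by
    have h4 := Real.log_two_gt_d9
    have h5 : (0 : ℝ) ≤ n := Nat.cast_nonneg n
    nlinarith
  have h4 : (x ^ (1 / 8 : ℝ)) ^ 2 = x ^ (1 / 4 : ℝ) := by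
    rw [← Real.rpow_natCast, ← Real.rpow_mul hx0.le]
    norm_num
  calc ((n : ℝ) + 2) ^ 2 ≤ (12 * x ^ (1 / 8 : ℝ)) ^ 2 :=
        pow_le_pow_left₀ (by positivity) h3 2
    _ = 144 * x ^ (1 / 4 : ℝ) := by rw [mul_pow, h4]; norm_num

theorem B_sub_T_le {f : V} {M : ℝ} (hM0 : 0 ≤ M)
    (hM : ∀ u v, 0 < u → u ≤ v → F.B v (f - F.T u f) (f - F.T u f) ≤ M ^ 2) {u v : ℝ}
    (hu : 0 < u) (hv : 0 < v) :
    F.B v (f - F.T u f) (f - F.T u f) ≤ 144 * M ^ 2 * (1 + (u / v) ^ (1 / 4 : ℝ)) := by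
  have hM2 := sq_nonneg M
  have h0 : 0 ≤ (u / v) ^ (1 / 4 : ℝ) := by positivity
  rcases le_total u v with h | h
  · refine (hM u v hu h).trans ?_
    nlinarith
  · have h1 : 1 ≤ u / v := by rwa [one_le_div hv]
    obtain ⟨n, hn, hn'⟩ := exists_nat_pow_near h1 one_lt_two
    rw [div_lt_iff₀ hv] at hn'
    refine (F.B_sub_T_le_of_le_two_pow hM0 hM (n + 1) u v hu hv hn'.le).trans ?_
    have h2 := sq_add_two_le_two_pow n hn
    rw [mul_pow]
    push_cast
    have h3 := mul_le_mul_of_nonneg_right h2 hM2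
    have e : (n : ℝ) + 1 + 1 = n + 2 := by ring
    rw [e]
    nlinarith

/-- The moments of the Poisson kernel that enter the second inequality. -/
def momentConst : ℝ :=
  144 * (1 + (∫ w in Ioi (0 : ℝ), poissonKernel 1 w * w ^ (1 / 4 : ℝ)) *
    (1 + ∫ w in Ioi (0 : ℝ), poissonKernel 1 w * w ^ (-(1 / 2) : ℝ)))

/-- This separates the variables. With `b = t⁻²` both factors become functions of the rescaled
variables, whose moments against `p_t` do not depend on `t`. -/
theorem rpow_quarter_div_le {u v b : ℝ} (hu : 0 < u) (hv : 0 < v) (hb : 0 < b) :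
    (u / v) ^ (1 / 4 : ℝ) ≤ (b * u) ^ (1 / 4 : ℝ) * (1 + (b * v) ^ (-(1 / 2) : ℝ)) := by
  have e : u / v = b * u * (b * v)⁻¹ := by field_simp
  rw [e, Real.mul_rpow (by positivity) (by positivity), Real.inv_rpow (by positivity),
    ← Real.rpow_neg (by positivity)]
  refine mul_le_mul_of_nonneg_left ?_ (by positivity)
  have hw : 0 < b * v := by positivity
  set w := b * v
  rcases le_total w 1 with h | h
  · have := Real.rpow_le_rpow_of_exponent_ge hw h (by norm_num : (-(1 / 2) : ℝ) ≤ -(1 / 4))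
    linarith
  · have := Real.rpow_le_one_of_one_le_of_nonpos h (by norm_num : -(1 / 4 : ℝ) ≤ 0)
    have : 0 ≤ w ^ (-(1 / 2) : ℝ) := by positivity
    linarith

/-- If `B_v(f - T_u f, f - T_u f) ≤ M²` for `v ≥ u`, then `p_t(f - P_t f) ≤ c M`. -/
theorem C_sub_P_le {f : V} {M : ℝ} (hM0 : 0 ≤ M)
    (hM : ∀ u v, 0 < u → u ≤ v → F.B v (f - F.T u f) (f - F.T u f) ≤ M ^ 2) {t : ℝ} (ht : 0 < t) :
    F.C (poissonL1 t) (f - F.P t f) (f - F.P t f) ≤ momentConst * M ^ 2 := by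
  set y := f - F.P t f with hy
  set b : ℝ := (t ^ 2)⁻¹ with hb
  have hb0 : 0 < b := by positivity
  obtain ⟨i1, e1⟩ := integrable_poissonKernel_mul_scale ht integrable_poissonKernel_rpow_quarter
  obtain ⟨i2, e2⟩ := integrable_poissonKernel_mul_scale ht integrable_poissonKernel_rpow_neg_half
  have i0 := integrable_poissonKernel ht
  have e0 := integral_poissonKernel ht
  rw [← hb] at i1 e1 i2 e2
  set m1 := ∫ w in Ioi (0 : ℝ), poissonKernel 1 w * w ^ (1 / 4 : ℝ) with hm1
  set m2 := ∫ w in Ioi (0 : ℝ), poissonKernel 1 w * w ^ (-(1 / 2) : ℝ) with hm2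
  have hB : ∀ v, 0 < v →
      F.B v y y ≤ 144 * M ^ 2 * (1 + m1 * (1 + (b * v) ^ (-(1 / 2) : ℝ))) := by
    intro v hv
    set β : ℝ := 1 + (b * v) ^ (-(1 / 2) : ℝ) with hβ
    have iT : Integrable (fun u => poissonKernel t u * F.B v y (F.T u f)) halfLine :=
      i0.mul_bdd (c := F.K * ‖y‖ * ‖f‖) (F.measurable_B_T v f y).aestronglyMeasurable
        (Eventually.of_forall fun u => (F.bound v y _).trans
          (mul_le_mul_of_nonneg_left (F.norm_T u f) (mul_nonneg F.K_nonneg (norm_nonneg _))))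
    have hg : Integrable (fun u => poissonKernel t u *
        (144 * M ^ 2 * (1 + (b * u) ^ (1 / 4 : ℝ) * β))) halfLine := by
      refine ((i0.const_mul (144 * M ^ 2)).add (i1.const_mul (144 * M ^ 2 * β))).congr
        (Eventually.of_forall fun u => ?_)
      simp only [Pi.add_apply]
      ring
    -- Since `p_t` has integral `1`, `f - P_t f` is the weak average of `f - T_u f`; Jensen is
    -- applied with constant `c = 1`.
    have h := F.B_self_le_of_eq_integral (v := v) (y := y) (z := fun u => f - F.T u f)
      (f := poissonKernel t) (g := fun u => 144 * M ^ 2 * (1 + (b * u) ^ (1 / 4 : ℝ) * β))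
      one_pos ht (fun u hu => by rw [one_mul, abs_of_pos (poissonKernel_pos ht hu)]) ?_
      (fun u hu => ?_) hg
    · rw [one_pow, one_mul] at h
      refine h.trans_eq ?_
      have : ∀ u, poissonKernel t u * (144 * M ^ 2 * (1 + (b * u) ^ (1 / 4 : ℝ) * β)) =
          144 * M ^ 2 * poissonKernel t u +
            144 * M ^ 2 * β * (poissonKernel t u * (b * u) ^ (1 / 4 : ℝ)) := fun u => by ring
      simp only [this]
      rw [integral_add (i0.const_mul _) (i1.const_mul _), integral_const_mul, integral_const_mul,
        halfLine, e0, e1]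
      ring
    · have h1 : F.B v y (F.P t f) = ∫ u, poissonKernel t u * F.B v y (F.T u f) ∂halfLine := by
        rw [F.B_A]
        exact integral_congr_ae ((coeFn_mkL1 i0).mono fun u hu => by
          simp only [poissonL1, hu])
      have h2 : F.B v y f = ∫ u, poissonKernel t u * F.B v y f ∂halfLine := by
        rw [integral_mul_const, halfLine, e0, one_mul]
      have h3 : F.B v y y = F.B v y f - F.B v y (F.P t f) := by
        rw [← map_sub]
      rw [h3, h1, h2, ← integral_sub (i0.mul_const _) iT]
      simp only [map_sub, mul_sub]
    · refine (F.B_sub_T_le hM0 hM hu hv).trans ?_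
      have := rpow_quarter_div_le hu hv hb0
      exact mul_le_mul_of_nonneg_left (by linarith) (by positivity)
  rw [poissonL1, F.C_mkL1 i0]
  have hi : Integrable (fun v => poissonKernel t v *
      (144 * M ^ 2 * (1 + m1 * (1 + (b * v) ^ (-(1 / 2) : ℝ))))) halfLine := by
    refine ((i0.const_mul (144 * M ^ 2 * (1 + m1))).add
      (i2.const_mul (144 * M ^ 2 * m1))).congr (Eventually.of_forall fun u => ?_)
    simp only [Pi.add_apply]
    ring
  refine (integral_mono_ae (F.integrable_mul_B i0 _ _) hi
    ((ae_restrict_iff' measurableSet_Ioi).2 (Eventually.of_forall fun v hv =>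
      mul_le_mul_of_nonneg_left (hB v hv) (poissonKernel_pos ht hv).le))).trans_eq ?_
  have : ∀ v, poissonKernel t v * (144 * M ^ 2 * (1 + m1 * (1 + (b * v) ^ (-(1 / 2) : ℝ)))) =
      144 * M ^ 2 * (1 + m1) * poissonKernel t v +
        144 * M ^ 2 * m1 * (poissonKernel t v * (b * v) ^ (-(1 / 2) : ℝ)) := fun v => by ring
  simp only [this]
  rw [integral_add (i0.const_mul _) (i2.const_mul _), integral_const_mul, integral_const_mul,
    halfLine, e0, e2, momentConst]
  ring

end Frame


/-! ### Weakly continuous functionals and the semigroup -/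

/-- Bounded real-linear maps on `N` that are sequentially continuous for the weak operator topology
on bounded sets. -/
structure WeaklyContinuous {E : Type*} [NormedAddCommGroup E] [NormedSpace ℝ E]
    (φ : N →ₗ[ℝ] E) : Prop where
  bound : ∃ K, 0 ≤ K ∧ ∀ x, ‖φ x‖ ≤ K * ‖x‖
  tendsto : ∀ (M : ℝ) (x : ℕ → N), (∀ n, ‖x n‖ ≤ M) →
    (∀ ξ η, Tendsto (fun n => mc (x n) ξ η) atTop (𝓝 0)) → Tendsto (fun n => φ (x n)) atTop (𝓝 0)

/-- A matrix coefficient as a real-linear map. -/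
def mcₗ (ξ η : H) : N →ₗ[ℝ] ℂ where
  toFun x := mc x ξ η
  map_add' x y := mc_add x y ξ η
  map_smul' c x := mc_real_smul c x ξ η

theorem mcₗ_apply (x : N) (ξ η : H) : mcₗ ξ η x = mc x ξ η := rfl

theorem weaklyContinuous_mcₗ (ξ η : H) : WeaklyContinuous (N := N) (mcₗ ξ η) where
  bound := ⟨‖ξ‖ * ‖η‖, by positivity, fun x => (norm_mc_le x ξ η).trans_eq (by ring)⟩
  tendsto _ _ _ h := h ξ η

theorem NormalFunctional.weaklyContinuous (τ : NSFTrace N) (ρ : NormalFunctional N) :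
    WeaklyContinuous ρ.toFun where
  bound := ⟨ρ.toFun 1, ρ.one_nonneg, ρ.abs_le⟩
  tendsto _ _ hM hw := ρ.tendsto_zero_of_weak τ hM hw

/-- Left multiplication as a real-linear map. -/
def mulLeftₗ (y : N) : N →ₗ[ℝ] N where
  toFun x := y * x
  map_add' := mul_add y
  map_smul' c x := mul_smul_comm c y x

section Functional

variable {E : Type*} [NormedAddCommGroup E] [NormedSpace ℝ E] {φ : N →ₗ[ℝ] E}

theorem WeaklyContinuous.comp_mulLeft (hφ : WeaklyContinuous φ) (y : N) :
    WeaklyContinuous (φ.comp (mulLeftₗ y)) where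
  bound := by
    obtain ⟨K, hK, h⟩ := hφ.bound
    refine ⟨K * ‖y‖, by positivity, fun x => (h _).trans ?_⟩
    rw [mul_assoc]
    exact mul_le_mul_of_nonneg_left (norm_mul_le y x) hK
  tendsto M x hM hw := by
    refine hφ.tendsto (‖y‖ * M) _ (fun n => (norm_mul_le y (x n)).trans
      (mul_le_mul_of_nonneg_left (hM n) (norm_nonneg y))) fun ξ η => ?_
    exact (hw (((star y : N) : H →L[ℂ] H) ξ) η).congr fun n => (mc_mul_left y (x n) ξ η).symm

/-- The continuous linear map underlying a weakly continuous functional. -/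
def WeaklyContinuous.toCLM (hφ : WeaklyContinuous φ) : N →L[ℝ] E :=
  φ.mkContinuous hφ.bound.choose hφ.bound.choose_spec.2

theorem WeaklyContinuous.tendsto_of_weak (hφ : WeaklyContinuous φ) {M : ℝ} {x : ℕ → N} {y : N}
    (hM : ∀ n, ‖x n‖ ≤ M) (h : ∀ ξ η, Tendsto (fun n => mc (x n) ξ η) atTop (𝓝 (mc y ξ η))) :
    Tendsto (fun n => φ (x n)) atTop (𝓝 (φ y)) := by
  have h1 := hφ.tendsto (M + ‖y‖) (fun n => x n - y)
    (fun n => (norm_sub_le _ _).trans (add_le_add_left (hM n) _)) fun ξ η => by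
      simpa only [mc_sub, sub_self] using (h ξ η).sub_const (mc y ξ η)
  simpa only [map_sub, sub_add_cancel, zero_add] using h1.add_const (φ y)

end Functional

/-! ### Positivity, contractivity and weak sequential continuity of the semigroup -/

namespace StandardSemigroup

variable (S : StandardSemigroup τ)

theorem map_star (t : ℝ≥0) (x : N) : S.toFun t (star x) = star (S.toFun t x) :=
  (S.completelyPositive t).map_star (S.unital t) x

theorem kadison (t : ℝ≥0) (x : N) :
    star (S.toFun t x) * S.toFun t x ≤ S.toFun t (star x * x) :=
  (S.completelyPositive t).kadison_schwarz (S.unital t) x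

theorem map_nonneg (t : ℝ≥0) {x : N} (hx : 0 ≤ x) : 0 ≤ S.toFun t x := by
  obtain ⟨d, -, rfl⟩ := exists_sqrt hx
  exact (star_mul_self_nonneg' _).trans (S.kadison t d)

theorem map_mono (t : ℝ≥0) {x y : N} (h : x ≤ y) : S.toFun t x ≤ S.toFun t y := by
  have := S.map_nonneg t (sub_nonneg.2 h)
  rwa [map_sub, sub_nonneg] at this

theorem map_real_smul (t : ℝ≥0) (c : ℝ) (x : N) : S.toFun t (c • x) = c • S.toFun t x :=
  (S.toFun t).map_smul (c : ℂ) x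

theorem norm_map_le (t : ℝ≥0) (x : N) : ‖S.toFun t x‖ ≤ ‖x‖ := by
  have h1 := (S.kadison t x).trans (S.map_mono t (star_mul_self_le_of_norm_le (le_refl ‖x‖)))
  rw [map_real_smul, S.unital] at h1
  have h2 := norm_le_of_le_smul_one (star_mul_self_nonneg' _) (sq_nonneg _) h1
  rw [norm_star_mul_self'] at h2
  exact abs_le_of_sq_le_sq' h2 (norm_nonneg _) |>.2

theorem map_add_apply (s t : ℝ≥0) (x : N) : S.toFun (s + t) x = S.toFun s (S.toFun t x) := by
  rw [S.add]; rfl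

/-- The state `x ↦ Re ⟨ξ, T_t x ξ⟩`. -/
def state (t : ℝ≥0) (ξ : H) : NormalFunctional N where
  toFun := Complex.reLm.comp ((mcₗ ξ ξ).comp ((S.toFun t).restrictScalars ℝ))
  nonneg x hx := (Complex.le_def.1 (nonneg_iff_mc.1 (S.map_nonneg t hx) ξ)).1
  star_eq x := by
    change (mc (S.toFun t (star x)) ξ ξ).re = (mc (S.toFun t x) ξ ξ).re
    rw [S.map_star, mc_star, Complex.conj_re]
  normal D x hne h0 hd hx ε hε := by
    obtain ⟨_, ⟨y, hy, rfl⟩, h⟩ := exists_lt_mc_of_isLUB (D := S.toFun t '' D) (hne.image _)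
      (by rintro _ ⟨y, hy, rfl⟩; exact S.map_nonneg t (h0 y hy))
      (by
        rintro _ ⟨a, ha, rfl⟩ _ ⟨b, hb, rfl⟩
        obtain ⟨c, hc, h1, h2⟩ := hd a ha b hb
        exact ⟨_, ⟨c, hc, rfl⟩, S.map_mono t h1, S.map_mono t h2⟩)
      (S.normal t hne hd hx) ξ hε
    exact ⟨y, hy, h⟩

theorem state_apply (t : ℝ≥0) (ξ : H) (x : N) :
    (S.state t ξ).toFun x = (mc (S.toFun t x) ξ ξ).re := rfl

/-- `T_t` as a real-linear map. -/
def mapₗ (t : ℝ≥0) : N →ₗ[ℝ] N := (S.toFun t).restrictScalars ℝ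

/-- Composing a vector state with `T_t` gives a normal functional, so the diagonal coefficients
converge; polarization gives the others. -/
theorem tendsto_mc_map {t : ℝ≥0} {M : ℝ} {x : ℕ → N} (hM : ∀ n, ‖x n‖ ≤ M)
    (hw : ∀ ξ η, Tendsto (fun n => mc (x n) ξ η) atTop (𝓝 0)) (ξ η : H) :
    Tendsto (fun n => mc (S.toFun t (x n)) ξ η) atTop (𝓝 0) := by
  have hdiag : ∀ ζ, Tendsto (fun n => mc (S.toFun t (x n)) ζ ζ) atTop (𝓝 0) := by
    intro ζ
    have h1 := (S.state t ζ).tendsto_zero_of_weak τ hM hw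
    -- Applied to `-i x n`, the real functional yields the imaginary part of the coefficient.
    have h2 := (S.state t ζ).tendsto_zero_of_weak τ (x := fun n => -Complex.I • x n) (M := M)
      (fun n => by rw [norm_smul]; simpa using hM n) fun ξ η => by
        simpa only [mc_smul, mul_zero] using (hw ξ η).const_mul (-Complex.I)
    simp only [state_apply, map_smul, mc_smul] at h1 h2
    have h3 := (Complex.continuous_ofReal.tendsto 0).comp h1
    have h4 := ((Complex.continuous_ofReal.tendsto 0).comp h2).mul_const Complex.I
    have h5 := h3.add h4
    simp only [Complex.ofReal_zero, zero_mul, add_zero] at h5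
    refine h5.congr fun n => ?_
    apply Complex.ext <;> simp
  have hpol : ∀ y : N, mc y ξ η = (mc y (ξ + η) (ξ + η) - mc y (ξ - η) (ξ - η) +
      (-Complex.I * mc y (ξ + Complex.I • η) (ξ + Complex.I • η) +
        Complex.I * mc y (ξ - Complex.I • η) (ξ - Complex.I • η))) / 4 := by
    intro y
    simp only [sub_eq_add_neg, ← neg_one_smul ℂ η, ← neg_one_smul ℂ (Complex.I • η),
      mc_add_left, mc_add_right, mc_smul_left, mc_smul_right, smul_smul, map_neg, map_one,
      Complex.conj_I, map_mul]
    ring_nf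
    simp only [Complex.I_sq]
    ring
  simp only [hpol]
  simpa using ((((hdiag (ξ + η)).sub (hdiag (ξ - η))).add
    (((hdiag (ξ + Complex.I • η)).const_mul (-Complex.I)).add
      ((hdiag (ξ - Complex.I • η)).const_mul Complex.I))).div_const 4)

theorem _root_.SemigroupBMO.WeaklyContinuous.comp_map {E : Type*} [NormedAddCommGroup E]
    [NormedSpace ℝ E] {φ : N →ₗ[ℝ] E} (hφ : WeaklyContinuous φ) (S : StandardSemigroup τ)
    (t : ℝ≥0) : WeaklyContinuous (φ.comp (S.mapₗ t)) where
  bound := by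
    obtain ⟨K, hK, h⟩ := hφ.bound
    exact ⟨K, hK, fun x => (h _).trans (mul_le_mul_of_nonneg_left (S.norm_map_le t x) hK)⟩
  tendsto M _ hM hw :=
    hφ.tendsto M _ (fun n => (S.norm_map_le t _).trans (hM n)) (S.tendsto_mc_map hM hw)

/-! ### Right continuity and measurability -/

/-- Approximation of `u` from the right by multiples of `1 / (n + 1)`. -/
def rightApprox (n : ℕ) (u : ℝ) : ℝ≥0 := (⌊((n : ℝ) + 1) * u⌋₊ + 1 : ℝ≥0) / ((n : ℝ≥0) + 1)

theorem le_rightApprox (n : ℕ) (u : ℝ) : u.toNNReal ≤ rightApprox n u := by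
  rw [Real.toNNReal_le_iff_le_coe, rightApprox]
  push_cast
  rw [le_div_iff₀ (by positivity), mul_comm]
  exact (Nat.lt_floor_add_one _).le

theorem rightApprox_le (n : ℕ) (u : ℝ) :
    (rightApprox n u : ℝ) ≤ u.toNNReal + 1 / ((n : ℝ) + 1) := by
  have h0 : (0 : ℝ) < (n : ℝ) + 1 := by positivity
  rw [rightApprox]
  push_cast
  rw [add_div]
  refine add_le_add_left ?_ _
  rw [div_le_iff₀ h0]
  rcases le_total 0 u with h | h
  · rw [Real.coe_toNNReal u h, mul_comm u]
    exact Nat.floor_le (by positivity)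
  · rw [Nat.floor_of_nonpos (mul_nonpos_of_nonneg_of_nonpos h0.le h)]
    simp only [Nat.cast_zero]
    positivity

theorem tendsto_rightApprox (u : ℝ) : Tendsto (fun n => rightApprox n u) atTop (𝓝 u.toNNReal) := by
  rw [← NNReal.tendsto_coe]
  refine tendsto_of_tendsto_of_tendsto_of_le_of_le tendsto_const_nhds ?_
    (fun n => NNReal.coe_le_coe.2 (le_rightApprox n u)) (rightApprox_le · u)
  simpa using (tendsto_one_div_add_atTop_nhds_zero_nat (𝕜 := ℝ)).const_add (u.toNNReal : ℝ)

/-- Strong continuity at `0`, applied to `T_u x`, gives continuity from the right; hence the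
approximations must lie above `u`. -/
theorem tendsto_mc_rightApprox (x : N) (u : ℝ) (ξ η : H) :
    Tendsto (fun n => mc (S.toFun (rightApprox n u) x) ξ η) atTop
      (𝓝 (mc (S.toFun u.toNNReal x) ξ η)) := by
  have h1 : Tendsto (fun n => rightApprox n u - u.toNNReal) atTop (𝓝 0) := by
    simpa using (tendsto_rightApprox u).sub_const u.toNNReal
  have h2 := ((S.tendsto (S.toFun u.toNNReal x) η).comp h1)
  refine (tendsto_const_nhds.inner h2).congr fun n => ?_
  simp only [Function.comp, mc]
  rw [← S.map_add_apply, tsub_add_cancel_of_le (le_rightApprox n u)]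

section Integral

variable {E : Type*} [NormedAddCommGroup E] [NormedSpace ℝ E] {φ : N →ₗ[ℝ] E}

theorem tendsto_rightApprox_of_weaklyContinuous (hφ : WeaklyContinuous φ) (x : N) (u : ℝ) :
    Tendsto (fun n => φ (S.toFun (rightApprox n u) x)) atTop (𝓝 (φ (S.toFun u.toNNReal x))) :=
  hφ.tendsto_of_weak (fun _ => S.norm_map_le _ x) (S.tendsto_mc_rightApprox x u)

/-- For each `n` the approximation factors through a natural number, so any `g` may be composed with
it. -/
theorem stronglyMeasurable_comp_rightApprox {F : Type*} [TopologicalSpace F] (g : ℝ≥0 → F)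
    (n : ℕ) : StronglyMeasurable fun u => g (rightApprox n u) :=
  (StronglyMeasurable.of_discrete (f := fun k : ℕ => g ((k + 1 : ℝ≥0) / ((n : ℝ≥0) + 1)))).comp_measurable
    (Nat.measurable_floor.comp (measurable_const.mul measurable_id) :
      Measurable fun u : ℝ => ⌊((n : ℝ) + 1) * u⌋₊)

theorem stronglyMeasurable_of_weaklyContinuous (hφ : WeaklyContinuous φ) (x : N) :
    StronglyMeasurable fun u : ℝ => φ (S.toFun u.toNNReal x) :=
  stronglyMeasurable_of_tendsto atTop
    (fun n => stronglyMeasurable_comp_rightApprox (fun r => φ (S.toFun r x)) n)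
    (tendsto_pi_nhds.2 fun u => S.tendsto_rightApprox_of_weaklyContinuous hφ x u)

theorem integrable_smul_of_weaklyContinuous (hφ : WeaklyContinuous φ) {k : ℝ → ℝ}
    (hk : Integrable k halfLine) (x : N) :
    Integrable (fun u => k u • φ (S.toFun u.toNNReal x)) halfLine := by
  obtain ⟨K, hK, h⟩ := hφ.bound
  exact hk.smul_bdd (C := K * ‖x‖)
    (S.stronglyMeasurable_of_weaklyContinuous hφ x).aestronglyMeasurable
    (Eventually.of_forall fun u => (h _).trans
      (mul_le_mul_of_nonneg_left (S.norm_map_le _ x) hK))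

theorem tendsto_integral_rightApprox (hφ : WeaklyContinuous φ) {k : ℝ → ℝ}
    (hk : Integrable k halfLine) (x : N) :
    Tendsto (fun n => ∫ u, k u • φ (S.toFun (rightApprox n u) x) ∂halfLine) atTop
      (𝓝 (∫ u, k u • φ (S.toFun u.toNNReal x) ∂halfLine)) := by
  obtain ⟨K, hK, h⟩ := hφ.bound
  refine tendsto_integral_of_dominated_convergence (fun u => ‖k u‖ * (K * ‖x‖))
    (fun n => hk.aestronglyMeasurable.smul
      (stronglyMeasurable_comp_rightApprox (fun r => φ (S.toFun r x)) n).aestronglyMeasurable)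
    (hk.norm.mul_const _) (fun n => Eventually.of_forall fun u => ?_)
    (Eventually.of_forall fun u =>
      (S.tendsto_rightApprox_of_weaklyContinuous hφ x u).const_smul (k u))
  rw [norm_smul]
  exact mul_le_mul_of_nonneg_left ((h _).trans
    (mul_le_mul_of_nonneg_left (S.norm_map_le _ x) hK)) (norm_nonneg _)

end Integral

/-! ### Weak averages of the semigroup -/

/-- Existence of the weak integral `∫ k(u) T_u x du`, which moreover commutes with all weakly
continuous functionals. -/
theorem exists_average {k : ℝ → ℝ} (hk : Integrable k halfLine) (x : N) :
    ∃ y : N, ∀ {E : Type} [NormedAddCommGroup E] [NormedSpace ℝ E] [CompleteSpace E]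
      {φ : N →ₗ[ℝ] E}, WeaklyContinuous φ →
        φ y = ∫ u, k u • φ (S.toFun u.toNNReal x) ∂halfLine := by
  -- The orbit `u ↦ T_u x` is not known to be strongly measurable for the norm of `N`, but its
  -- discrete approximations are. Their Bochner integrals commute with `φ`, and the average is the
  -- weak limit of these integrals.
  have hint : ∀ n, Integrable (fun u => k u • S.toFun (rightApprox n u) x) halfLine := fun n =>
    hk.smul_bdd (C := ‖x‖)
      (stronglyMeasurable_comp_rightApprox (fun r => S.toFun r x) n).aestronglyMeasurable
      (Eventually.of_forall fun u => S.norm_map_le _ x)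
  let y : ℕ → N := fun n => ∫ u, k u • S.toFun (rightApprox n u) x ∂halfLine
  have hy : ∀ n, ‖y n‖ ≤ (∫ u, ‖k u‖ ∂halfLine) * ‖x‖ := fun n => by
    rw [← integral_mul_const]
    refine norm_integral_le_of_norm_le (hk.norm.mul_const _) (Eventually.of_forall fun u => ?_)
    rw [norm_smul]
    exact mul_le_mul_of_nonneg_left (S.norm_map_le _ x) (norm_nonneg _)
  have hφy : ∀ {E : Type} [NormedAddCommGroup E] [NormedSpace ℝ E] [CompleteSpace E]
      {φ : N →ₗ[ℝ] E}, WeaklyContinuous φ → Tendsto (fun n => φ (y n)) atTop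
        (𝓝 (∫ u, k u • φ (S.toFun u.toNNReal x) ∂halfLine)) := by
    intro E _ _ _ φ hφ
    refine (S.tendsto_integral_rightApprox hφ hk x).congr fun n => ?_
    have h := hφ.toCLM.integral_comp_comm (hint n)
    simp only [map_smul] at h
    exact h
  obtain ⟨z, hz⟩ := exists_weak_limit (l := atTop) y _ (Eventually.of_forall hy) _
    fun ξ η => hφy (weaklyContinuous_mcₗ ξ η)
  refine ⟨z, fun hφ => tendsto_nhds_unique (hφ.tendsto_of_weak hy fun ξ η => ?_) (hφy hφ)⟩
  rw [hz]
  exact hφy (weaklyContinuous_mcₗ ξ η)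

/-- The average `∫ k(u) T_u x du`. -/
def averageFun (k : K1) (x : N) : N := (S.exists_average (L1.integrable_coeFn k) x).choose

theorem apply_averageFun {E : Type} [NormedAddCommGroup E] [NormedSpace ℝ E] [CompleteSpace E]
    {φ : N →ₗ[ℝ] E} (hφ : WeaklyContinuous φ) (k : K1) (x : N) :
    φ (S.averageFun k x) = ∫ u, k u • φ (S.toFun u.toNNReal x) ∂halfLine :=
  (S.exists_average (L1.integrable_coeFn k) x).choose_spec hφ

theorem mc_averageFun (k : K1) (x : N) (ξ η : H) :
    mc (S.averageFun k x) ξ η = ∫ u, k u • mc (S.toFun u.toNNReal x) ξ η ∂halfLine :=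
  S.apply_averageFun (weaklyContinuous_mcₗ ξ η) k x

theorem integrable_smul_mc (k : K1) (x : N) (ξ η : H) :
    Integrable (fun u => k u • mc (S.toFun u.toNNReal x) ξ η) halfLine :=
  S.integrable_smul_of_weaklyContinuous (weaklyContinuous_mcₗ ξ η) (L1.integrable_coeFn k) x

theorem norm_averageFun_le (k : K1) (x : N) : ‖S.averageFun k x‖ ≤ 1 * ‖k‖ * ‖x‖ := by
  rw [one_mul]
  refine norm_le_of_mc (by positivity) fun ξ η => ?_
  have h : ∀ u : ℝ, ‖mc (S.toFun u.toNNReal x) ξ η‖ ≤ ‖x‖ * ‖ξ‖ * ‖η‖ := fun u =>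
    (norm_mc_le _ _ _).trans (by gcongr; exact S.norm_map_le _ x)
  have e : ‖k‖ * ‖x‖ * ‖ξ‖ * ‖η‖ = ∫ u, ‖k u‖ * (‖x‖ * ‖ξ‖ * ‖η‖) ∂halfLine := by
    rw [integral_mul_const, ← L1.norm_eq_integral_norm]
    ring
  rw [mc_averageFun, e]
  refine norm_integral_le_of_norm_le ((L1.integrable_coeFn k).norm.mul_const _)
    (Eventually.of_forall fun u => ?_)
  rw [norm_smul]
  exact mul_le_mul_of_nonneg_left (h u) (norm_nonneg _)

/-- The average `∫ k(u) T_u x du` as a bilinear map. -/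
def average : K1 →L[ℝ] N →L[ℝ] N :=
  LinearMap.mkContinuous₂
    (LinearMap.mk₂ ℝ S.averageFun
      (fun k l x => ext_mc fun ξ η => by
        rw [mc_add, mc_averageFun, mc_averageFun, mc_averageFun,
          ← integral_add (S.integrable_smul_mc k x ξ η) (S.integrable_smul_mc l x ξ η)]
        refine integral_congr_ae ((Lp.coeFn_add k l).mono fun u hu => ?_)
        simp only [hu, Pi.add_apply, add_smul])
      (fun c k x => ext_mc fun ξ η => by
        rw [mc_real_smul, mc_averageFun, mc_averageFun, ← Complex.real_smul, ← integral_smul]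
        refine integral_congr_ae ((Lp.coeFn_smul c k).mono fun u hu => ?_)
        simp only [hu, Pi.smul_apply, smul_assoc])
      (fun k x y => ext_mc fun ξ η => by
        rw [mc_add, mc_averageFun, mc_averageFun, mc_averageFun,
          ← integral_add (S.integrable_smul_mc k x ξ η) (S.integrable_smul_mc k y ξ η)]
        simp only [map_add, mc_add, smul_add])
      (fun c k x => ext_mc fun ξ η => by
        rw [mc_real_smul, mc_averageFun, mc_averageFun, ← Complex.real_smul, ← integral_smul]
        simp only [map_real_smul, mc_real_smul, ← Complex.real_smul, smul_comm c])) 1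
    S.norm_averageFun_le

theorem apply_average {E : Type} [NormedAddCommGroup E] [NormedSpace ℝ E] [CompleteSpace E]
    {φ : N →ₗ[ℝ] E} (hφ : WeaklyContinuous φ) (k : K1) (x : N) :
    φ (S.average k x) = ∫ u, k u • φ (S.toFun u.toNNReal x) ∂halfLine :=
  S.apply_averageFun hφ k x

theorem apply_average_mkL1 {E : Type} [NormedAddCommGroup E] [NormedSpace ℝ E] [CompleteSpace E]
    {φ : N →ₗ[ℝ] E} (hφ : WeaklyContinuous φ) {f : ℝ → ℝ} (hf : Integrable f halfLine) (x : N) :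
    φ (S.average (mkL1 f) x) = ∫ u, f u • φ (S.toFun u.toNNReal x) ∂halfLine := by
  rw [S.apply_average hφ]
  exact integral_congr_ae ((coeFn_mkL1 hf).mono fun u hu => by simp only [hu])

/-- The average witnesses the existence condition in the definition of `poisson`, so the default
value `0` is never taken for `t > 0`. -/
theorem average_poissonL1 {t : ℝ} (ht : 0 < t) (x : N) :
    S.average (poissonL1 t) x = S.poisson t x := by
  have h : ∀ ξ η : H, mc (S.average (poissonL1 t) x) ξ η = ∫ u in Ioi (0 : ℝ),
      (poissonKernel t u : ℂ) * mc (S.toFun u.toNNReal x) ξ η := fun ξ η => by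
    have := S.apply_average_mkL1 (weaklyContinuous_mcₗ ξ η) (integrable_poissonKernel ht) x
    simpa only [mcₗ_apply, Complex.real_smul, poissonL1, halfLine] using this
  have hex : ∃ y : N, ∀ ξ η : H, ⟪ξ, (y : H →L[ℂ] H) η⟫_ℂ = ∫ u in Ioi (0 : ℝ),
      (poissonKernel t u : ℂ) * ⟪ξ, (S.toFun u.toNNReal x : H →L[ℂ] H) η⟫_ℂ := ⟨_, h⟩
  rw [poisson, dif_pos hex]
  exact ext_mc fun ξ η => (h ξ η).trans (hex.choose_spec ξ η).symm

end StandardSemigroup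

/-! ### The frame of a standard semigroup on `N` -/

theorem WeaklyContinuous.re {φ : N →ₗ[ℝ] ℂ} (hφ : WeaklyContinuous φ) :
    WeaklyContinuous (Complex.reLm.comp φ) where
  bound := by
    obtain ⟨K, hK, h⟩ := hφ.bound
    exact ⟨K, hK, fun x => (Complex.abs_re_le_norm _).trans (h x)⟩
  tendsto M x hM hw := (Complex.continuous_re.tendsto 0).comp (hφ.tendsto M x hM hw)

theorem WeaklyContinuous.im {φ : N →ₗ[ℝ] ℂ} (hφ : WeaklyContinuous φ) :
    WeaklyContinuous (Complex.imLm.comp φ) where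
  bound := by
    obtain ⟨K, hK, h⟩ := hφ.bound
    exact ⟨K, hK, fun x => (Complex.abs_im_le_norm _).trans (h x)⟩
  tendsto M x hM hw := (Complex.continuous_im.tendsto 0).comp (hφ.tendsto M x hM hw)

theorem star_real_smul (c : ℝ) (x : N) : star (c • x) = c • star x := by
  change star ((c : ℂ) • x) = (c : ℂ) • star x
  rw [star_smul, RCLike.star_def, Complex.conj_ofReal]

namespace StandardSemigroup

variable (S : StandardSemigroup τ)

theorem map_toNNReal_add {u v : ℝ} (hu : 0 ≤ u) (hv : 0 ≤ v) (x : N) :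
    S.toFun (u + v).toNNReal x = S.toFun u.toNNReal (S.toFun v.toNNReal x) := by
  rw [Real.toNNReal_add hu hv, map_add_apply]

theorem map_average_poissonL1 {ε s : ℝ} (hε : 0 ≤ ε) (hs : 0 < s) (x : N) :
    S.toFun ε.toNNReal (S.average (poissonL1 s) x) = S.average (mkL1 (shiftedKernel s ε)) x := by
  refine ext_mc fun ξ η => ?_
  have h1 := S.apply_average_mkL1 ((weaklyContinuous_mcₗ ξ η).comp_map S ε.toNNReal)
    (integrable_poissonKernel hs) x
  have h2 := S.apply_average_mkL1 (weaklyContinuous_mcₗ ξ η) (integrable_shiftedKernel ε hs) x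
  rw [integral_shiftedKernel_smul s hε] at h2
  refine h1.trans (Eq.trans ?_ h2.symm)
  refine setIntegral_congr_fun measurableSet_Ioi fun u hu => ?_
  simp only [mcₗ_apply]
  rw [add_comm u, S.map_toNNReal_add hε (le_of_lt hu)]
  rfl

theorem average_average_poissonL1 {s t : ℝ} (hs : 0 < s) (ht : 0 < t) (x : N) :
    S.average (poissonL1 s) (S.average (poissonL1 t) x) = S.average (poissonL1 (s + t)) x := by
  refine ext_mc fun ξ η => ?_
  have h1 := S.apply_average_mkL1 (weaklyContinuous_mcₗ ξ η) (integrable_poissonKernel hs)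
    (S.average (poissonL1 t) x)
  have h2 := S.apply_average_mkL1 (weaklyContinuous_mcₗ ξ η)
    (integrable_poissonKernel (add_pos hs ht)) x
  refine h1.trans (Eq.trans ?_ h2.symm)
  refine Eq.trans ?_ (integral_integral_poissonKernel hs ht
    (F := fun u => mc (S.toFun u.toNNReal x) ξ η) (M := ‖x‖ * ‖ξ‖ * ‖η‖)
    (S.stronglyMeasurable_of_weaklyContinuous (weaklyContinuous_mcₗ ξ η) x).aestronglyMeasurable
    fun u _ => (norm_mc_le _ _ _).trans (by gcongr; exact S.norm_map_le _ x))
  refine setIntegral_congr_fun measurableSet_Ioi fun v hv => ?_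
  congr 1
  refine (S.apply_average_mkL1 ((weaklyContinuous_mcₗ ξ η).comp_map S v.toNNReal)
    (integrable_poissonKernel ht) x).trans ?_
  refine setIntegral_congr_fun measurableSet_Ioi fun u hu => ?_
  rw [S.map_toNNReal_add (le_of_lt hv) (le_of_lt hu)]
  rfl

/-- The form `(y, x) ↦ Re ⟨ξ, T_t(y* x) ξ⟩`. -/
def stateForm (t : ℝ≥0) (ξ : H) : LinearMap.BilinForm ℝ N :=
  LinearMap.mk₂ ℝ (fun y x => (S.state t ξ).toFun (star y * x))
    (fun y y' x => by rw [star_add, add_mul, map_add])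
    (fun c y x => by rw [star_real_smul, smul_mul_assoc, map_smul])
    (fun y x x' => by rw [mul_add, map_add])
    (fun c y x => by rw [mul_smul_comm, map_smul])

theorem stateForm_apply (t : ℝ≥0) (ξ : H) (y x : N) :
    S.stateForm t ξ y x = (mc (S.toFun t (star y * x)) ξ ξ).re := rfl

theorem norm_star' (x : N) : ‖star x‖ = ‖x‖ := norm_star (x : H →L[ℂ] H)

/-- The frame of a standard semigroup on `N`, for the functional `x ↦ Re ⟨ξ, x ξ⟩`. -/
def frame (ξ : H) : Frame N where
  T u := S.mapₗ u.toNNReal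
  A := S.average
  B v := S.stateForm v.toNNReal ξ
  K := ‖ξ‖ ^ 2
  K_nonneg := sq_nonneg _
  norm_T u x := S.norm_map_le _ x
  T_add s t x hs ht := S.map_toNNReal_add hs ht x
  symm v x y := by
    have := (S.state v.toNNReal ξ).star_eq (star x * y)
    rw [star_mul, star_star] at this
    exact this.symm
  nonneg v x := (S.state v.toNNReal ξ).nonneg _ (star_mul_self_nonneg' x)
  bound v x y := by
    refine (Complex.abs_re_le_norm _).trans ((norm_mc_le _ ξ ξ).trans ?_)
    have h1 := (S.norm_map_le v.toNNReal (star x * y)).trans (norm_mul_le (star x) y)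
    rw [norm_star'] at h1
    calc _ ≤ ‖x‖ * ‖y‖ * ‖ξ‖ * ‖ξ‖ := by gcongr; exact h1
      _ = _ := by ring
  measurable_B x y :=
    (S.stronglyMeasurable_of_weaklyContinuous (weaklyContinuous_mcₗ ξ ξ).re (star x * y)).measurable
  measurable_B_T v x y :=
    (S.stronglyMeasurable_of_weaklyContinuous
      (((S.state v.toNNReal ξ).weaklyContinuous τ).comp_mulLeft (star y)) x).measurable
  B_T v u x hv hu := by
    have h1 := (S.state v.toNNReal ξ).mono (S.kadison u.toNNReal x)
    refine h1.trans_eq ?_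
    rw [state_apply, stateForm_apply, S.map_toNNReal_add hv hu]
  -- The functional `x ↦ Re ⟨ξ, T_v(y* x) ξ⟩` must pass through a weak integral; this is where weak
  -- sequential continuity of normal functionals is indispensable.
  B_A v y k x :=
    S.apply_average (((S.state v.toNNReal ξ).weaklyContinuous τ).comp_mulLeft (star y)) k x
  T_A _ _ x hε hs := S.map_average_poissonL1 hε hs x
  A_A _ _ x hs ht := S.average_average_poissonL1 hs ht x

theorem frame_P {t : ℝ} (ht : 0 < t) (ξ : H) (f : N) : (S.frame ξ).P t f = S.poisson t f :=
  S.average_poissonL1 ht f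

theorem deriv_poisson {s : ℝ} (hs : 0 < s) (ξ : H) (f : N) :
    deriv (fun r => S.poisson r f) s = (S.frame ξ).Q s f := by
  refine (((S.frame ξ).hasDerivAt_P hs f).congr_of_eventuallyEq ?_).deriv
  filter_upwards [Ioi_mem_nhds hs] with r hr
  exact (S.frame_P hr ξ f).symm

theorem frame_C {t : ℝ} (ht : 0 < t) (ξ : H) (x : N) :
    (S.frame ξ).C (poissonL1 t) x x = (mc (S.poisson t (star x * x)) ξ ξ).re := by
  rw [← S.average_poissonL1 ht, poissonL1, Frame.C_mkL1 _ (integrable_poissonKernel ht)]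
  exact (S.apply_average_mkL1 (weaklyContinuous_mcₗ ξ ξ).re (integrable_poissonKernel ht) _).symm

theorem poisson_nonneg {t : ℝ} (ht : 0 < t) (x : N) : 0 ≤ S.poisson t (star x * x) := by
  rw [nonneg_iff_mc]
  intro ξ
  rw [Complex.le_def]
  constructor
  · rw [← S.frame_C ht ξ x]
    exact (S.frame ξ).C_nonneg ht x
  · have h := S.apply_average_mkL1 (weaklyContinuous_mcₗ ξ ξ).im (integrable_poissonKernel ht)
      (star x * x)
    have e : S.average (mkL1 (poissonKernel t)) (star x * x) = _ := S.average_poissonL1 ht _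
    rw [e] at h
    refine Eq.trans ?_ h.symm
    have h0 : ∀ u : ℝ, (mc (S.toFun u.toNNReal (star x * x)) ξ ξ).im = 0 := fun u =>
      (Complex.le_def.1 (nonneg_iff_mc.1 (S.map_nonneg _ (star_mul_self_nonneg' x)) ξ)).2.symm
    symm
    refine (integral_congr_ae (Eventually.of_forall fun u => ?_)).trans (integral_zero _ _)
    change _ • (mc (S.toFun u.toNNReal (star x * x)) ξ ξ).im = 0
    rw [h0, smul_zero]

theorem re_mc_le (x : N) (ξ : H) : (mc x ξ ξ).re ≤ ‖x‖ * ‖ξ‖ ^ 2 :=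
  (Complex.re_le_norm _).trans ((norm_mc_le x ξ ξ).trans_eq (by ring))

theorem norm_le_of_re_mc_le {x : N} (hx : 0 ≤ x) {c : ℝ} (hc : 0 ≤ c)
    (h : ∀ ξ, (mc x ξ ξ).re ≤ c * ‖ξ‖ ^ 2) : ‖x‖ ≤ c := by
  refine norm_le_of_le_smul_one hx hc (le_iff_mc.2 fun ξ => ?_)
  have e : mc (1 : N) ξ ξ = ((‖ξ‖ ^ 2 : ℝ) : ℂ) := by
    have := inner_self_eq_norm_sq_to_K (𝕜 := ℂ) ξ
    refine this.trans ?_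
    norm_cast
  rw [mc_real_smul, e, Complex.le_def]
  have h0 := (Complex.le_def.1 (nonneg_iff_mc.1 hx ξ)).2
  rw [Complex.zero_im] at h0
  rw [← h0]
  refine ⟨?_, by simp [-Complex.ofReal_pow]⟩
  simpa [← Complex.ofReal_mul, -Complex.ofReal_pow] using h ξ

/-! ### The two inequalities for elements of `N` -/

theorem _root_.SemigroupBMO.enorm_rpow_half_le {E : Type*} [NormedAddCommGroup E] {x : E} {M : ℝ}
    (hM : 0 ≤ M) : ‖x‖ₑ ^ (1 / 2 : ℝ) ≤ ENNReal.ofReal M ↔ ‖x‖ ≤ M ^ 2 := by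
  rw [← ofReal_norm, ENNReal.ofReal_rpow_of_nonneg (norm_nonneg x) (by norm_num),
    ENNReal.ofReal_le_ofReal_iff hM, ← Real.sqrt_eq_rpow, Real.sqrt_le_left hM]

theorem _root_.SemigroupBMO.ofReal_rpow_half_le {x c M : ℝ} (hc : 0 ≤ c) (hM : 0 ≤ M)
    (h : x ≤ (c * M) ^ 2) :
    ENNReal.ofReal x ^ (1 / 2 : ℝ) ≤ ENNReal.ofReal c * ENNReal.ofReal M := by
  rw [← ENNReal.ofReal_mul hc]
  refine (ENNReal.rpow_le_rpow (ENNReal.ofReal_le_ofReal h) (by norm_num)).trans_eq ?_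
  rw [ENNReal.ofReal_rpow_of_nonneg (by positivity) (by norm_num), ← Real.sqrt_eq_rpow,
    Real.sqrt_sq (by positivity)]

theorem bmoPartial_le (f : N) : S.bmoPartial f ≤ ENNReal.ofReal 250 * S.bmoP f := by
  by_cases htop : S.bmoP f = ∞
  · rw [htop, ENNReal.mul_top (by simp)]
    exact le_top
  set M := (S.bmoP f).toReal with hM
  have hM0 : 0 ≤ M := ENNReal.toReal_nonneg
  have hMe : S.bmoP f = ENNReal.ofReal M := (ENNReal.ofReal_toReal htop).symm
  have hnorm : ∀ t, 0 < t →
      ‖S.poisson t (star (f - S.poisson t f) * (f - S.poisson t f))‖ ≤ M ^ 2 := by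
    intro t ht
    rw [← enorm_rpow_half_le hM0, ← hMe]
    exact le_iSup₂ (f := fun t (_ : 0 < t) =>
      ‖S.poisson t (star (f - S.poisson t f) * (f - S.poisson t f))‖ₑ ^ (1 / 2 : ℝ)) t ht
  rw [hMe]
  refine iSup₂_le fun t ht => ?_
  -- The constant `250` satisfies `62000 ≤ 250²`.
  refine le_trans (ENNReal.rpow_le_rpow (iSup₂_le fun ξ hξ => ?_) (by norm_num))
    (ofReal_rpow_half_le (x := 62000 * M ^ 2) (by norm_num) hM0 (by nlinarith [sq_nonneg M]))
  refine le_trans (le_of_eq ?_) ((S.frame ξ).lintegral_C_Q_le (f := f) hM0 (fun r hr => ?_) ht)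
  · refine setLIntegral_congr_fun measurableSet_Ioo fun s hs => ?_
    rw [S.frame_C ht, S.deriv_poisson hs.1 ξ, ContinuousLinearMap.reApplyInnerSelf]
    congr 2
    rw [← inner_conj_symm]
    exact Complex.conj_re _
  · rw [S.frame_P hr, S.frame_C hr]
    refine (re_mc_le _ ξ).trans ((mul_le_of_le_one_right (norm_nonneg _) ?_).trans (hnorm r hr))
    exact pow_le_one₀ (norm_nonneg _) hξ

theorem bmoP_le (f : N) :
    S.bmoP f ≤ ENNReal.ofReal (√Frame.momentConst + 1) * S.bmoT f := by
  have hc0 : 0 < √Frame.momentConst + 1 := by positivity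
  by_cases htop : S.bmoT f = ∞
  · rw [htop, ENNReal.mul_top (by simpa using hc0)]
    exact le_top
  set M := (S.bmoT f).toReal with hM
  have hM0 : 0 ≤ M := ENNReal.toReal_nonneg
  have hMe : S.bmoT f = ENNReal.ofReal M := (ENNReal.ofReal_toReal htop).symm
  have hnorm : ∀ t : ℝ, 0 < t → ‖S.toFun t.toNNReal
      (star (f - S.toFun t.toNNReal f) * (f - S.toFun t.toNNReal f))‖ ≤ M ^ 2 := by
    intro t ht
    rw [← enorm_rpow_half_le hM0, ← hMe]
    exact le_iSup₂ (f := fun (t : ℝ) (_ : 0 < t) => ‖S.toFun t.toNNReal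
      (star (f - S.toFun t.toNNReal f) * (f - S.toFun t.toNNReal f))‖ₑ ^ (1 / 2 : ℝ)) t ht
  rw [hMe, ← ENNReal.ofReal_mul hc0.le]
  refine iSup₂_le fun t ht => ?_
  rw [enorm_rpow_half_le (by positivity)]
  refine norm_le_of_re_mc_le (S.poisson_nonneg ht _) (by positivity) fun ξ => ?_
  have h := (S.frame ξ).C_sub_P_le (f := f) (M := M * ‖ξ‖) (by positivity) (fun u v hu huv => ?_) ht
  · rw [S.frame_P ht, S.frame_C ht] at h
    refine h.trans ?_
    -- The sign of `momentConst` has not been recorded, so both signs are treated; adding `1` makes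
    -- the final constant visibly positive.
    have h1 : Frame.momentConst ≤ (√Frame.momentConst + 1) ^ 2 := by
      have h2 := Real.sqrt_nonneg Frame.momentConst
      rcases le_total 0 Frame.momentConst with h3 | h3
      · nlinarith [Real.sq_sqrt h3]
      · nlinarith
    calc Frame.momentConst * (M * ‖ξ‖) ^ 2 ≤ (√Frame.momentConst + 1) ^ 2 * (M * ‖ξ‖) ^ 2 :=
          mul_le_mul_of_nonneg_right h1 (sq_nonneg _)
      _ = _ := by ring
  -- The hypothesis bounds `T_u |f - T_u f|²` in norm, and the contraction `T_{v-u}` raises the time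
  -- to `v ≥ u`.
  · have e : v = v - u + u := (sub_add_cancel v u).symm
    set z := f - S.toFun u.toNNReal f with hz
    change (mc (S.toFun v.toNNReal (star z * z)) ξ ξ).re ≤ _
    rw [e, S.map_toNNReal_add (sub_nonneg.2 huv) hu.le, mul_pow]
    refine (re_mc_le _ ξ).trans (mul_le_mul_of_nonneg_right ?_ (sq_nonneg _))
    exact (S.norm_map_le _ _).trans (hnorm u hu)

end StandardSemigroup

/-! ### The semigroup on `L₂` -/

theorem tendsto_completion_of_contraction {E : Type*} [NormedAddCommGroup E]
    {T : ℕ → UniformSpace.Completion E → UniformSpace.Completion E}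
    (hT : ∀ n x y, ‖T n x - T n y‖ ≤ ‖x - y‖)
    (h : ∀ a : E, Tendsto (fun n => T n a) atTop (𝓝 (a : UniformSpace.Completion E)))
    (x : UniformSpace.Completion E) : Tendsto (fun n => T n x) atTop (𝓝 x) := by
  rw [Metric.tendsto_atTop]
  intro ε hε
  obtain ⟨a, ha⟩ := UniformSpace.Completion.denseRange_coe.exists_dist_lt x
    (show 0 < ε / 3 by positivity)
  obtain ⟨m, hm⟩ := Metric.tendsto_atTop.1 (h a) (ε / 3) (by positivity)
  refine ⟨m, fun n hn => ?_⟩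
  have h1 := hm n hn
  have h2 := hT n x a
  rw [← dist_eq_norm, ← dist_eq_norm] at h2
  have h3 := dist_triangle4 (T n x) (T n a) a x
  rw [dist_comm (a : UniformSpace.Completion E) x] at h3
  linarith

namespace StandardSemigroup

variable (S : StandardSemigroup τ)

theorem preMap_val (t : ℝ≥0) (a : L2Pre τ) : (S.preMap t a).val = S.toFun t a.val := rfl

theorem norm_preMap_le (t : ℝ≥0) (a : L2Pre τ) : ‖S.preMap t a‖ ≤ ‖a‖ :=
  Real.sqrt_le_sqrt (ENNReal.toReal_mono a.lt_top.ne (S.trace_sq_le t a.val))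

/-- `T_t` on `N ∩ L₂` as a continuous linear map. -/
def preMapCLM (t : ℝ≥0) : L2Pre τ →L[ℂ] L2Pre τ :=
  LinearMap.mkContinuous
    { toFun := S.preMap t
      map_add' := fun a b => L2Pre.val_injective ((S.toFun t).map_add a.val b.val)
      map_smul' := fun c a => L2Pre.val_injective ((S.toFun t).map_smul c a.val) } 1
    fun a => (S.norm_preMap_le t a).trans_eq (one_mul _).symm

/-- `T_t` on `L₂` as a continuous linear map. -/
def mapL2CLM (t : ℝ≥0) : L2 τ →L[ℂ] L2 τ := (S.preMapCLM t).completion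

theorem mapL2_coe (t : ℝ≥0) (a : L2Pre τ) : S.mapL2 t (a : L2 τ) = (S.preMap t a : L2 τ) :=
  UniformSpace.Completion.map_coe (S.uniformContinuous_preMap t) a

theorem norm_mapL2_le (t : ℝ≥0) (x : L2 τ) : ‖S.mapL2 t x‖ ≤ ‖x‖ := by
  induction x using UniformSpace.Completion.induction_on with
  | hp => exact isClosed_le (S.mapL2CLM t).continuous.norm continuous_norm
  | ih a =>
    rw [mapL2_coe, UniformSpace.Completion.norm_coe, UniformSpace.Completion.norm_coe]
    exact S.norm_preMap_le t a

theorem mapL2_sub (t : ℝ≥0) (x y : L2 τ) : S.mapL2 t (x - y) = S.mapL2 t x - S.mapL2 t y :=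
  map_sub (S.mapL2CLM t) x y

theorem mapL2_add (s t : ℝ≥0) (x : L2 τ) : S.mapL2 (s + t) x = S.mapL2 s (S.mapL2 t x) := by
  induction x using UniformSpace.Completion.induction_on with
  | hp =>
    exact isClosed_eq (S.mapL2CLM (s + t)).continuous
      ((S.mapL2CLM s).continuous.comp (S.mapL2CLM t).continuous)
  | ih a =>
    rw [mapL2_coe, mapL2_coe, mapL2_coe]
    congr 1
    exact L2Pre.val_injective (S.map_add_apply s t a.val)

/-- `T_t` on `L₂` as a real-linear map. -/
def mapL2ₗ (t : ℝ≥0) : L2 τ →ₗ[ℝ] L2 τ where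
  toFun := S.mapL2 t
  map_add' := map_add (S.mapL2CLM t)
  map_smul' c x := map_smul (S.mapL2CLM t) (c : ℂ) x

theorem mapL2ₗ_apply (t : ℝ≥0) (x : L2 τ) : S.mapL2ₗ t x = S.mapL2 t x := rfl

/-- `T_t` on `L₂` as a continuous real-linear map. -/
def mapL2RCLM (t : ℝ≥0) : L2 τ →L[ℝ] L2 τ :=
  (S.mapL2ₗ t).mkContinuous 1 fun x => (S.norm_mapL2_le t x).trans_eq (one_mul _).symm

theorem mapL2RCLM_apply (t : ℝ≥0) (x : L2 τ) : S.mapL2RCLM t x = S.mapL2 t x := rfl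

/-- Expanding the square and using `‖T_t a‖ ≤ ‖a‖` reduces strong convergence `T_t a → a` in `L₂` to
weak convergence. -/
theorem norm_preMap_sub_sq_le (t : ℝ≥0) (a : L2Pre τ) :
    ‖S.preMap t a - a‖ ^ 2 ≤ -2 * (⟪a, S.preMap t a - a⟫_ℂ).re := by
  have h1 := norm_sub_sq (𝕜 := ℂ) a (S.preMap t a)
  have h2 := inner_self_eq_norm_sq (𝕜 := ℂ) a
  have h3 : ‖S.preMap t a‖ ^ 2 ≤ ‖a‖ ^ 2 := by
    gcongr
    exact S.norm_preMap_le t a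
  rw [inner_sub_right, Complex.sub_re, norm_sub_rev]
  simp only [RCLike.re_to_complex] at h1 h2
  linarith

theorem tendsto_preMap {r : ℕ → ℝ≥0} (hr : Tendsto r atTop (𝓝 0)) (a : L2Pre τ) :
    Tendsto (fun n => S.preMap (r n) a) atTop (𝓝 a) := by
  rw [tendsto_iff_norm_sub_tendsto_zero]
  have h1 := (inner_tendsto_zero_of_weak a (x := fun n => S.preMap (r n) a - a)
    (M := ‖a.val‖ + ‖a.val‖) (R := ‖a‖ + ‖a‖)
    (fun n => (norm_sub_le (S.toFun (r n) a.val) a.val).trans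
      (add_le_add_left (S.norm_map_le _ _) _))
    (fun n => (norm_sub_le _ _).trans (add_le_add_left (S.norm_preMap_le _ _) _))
    fun ξ η => by
      have h2 := (S.tendsto a.val η).comp hr
      have h3 := (tendsto_const_nhds (x := ξ)).inner (𝕜 := ℂ) h2
      have h4 := h3.sub_const (mc a.val ξ η)
      simp only [mc, sub_self] at h4
      refine h4.congr fun n => ?_
      exact (mc_sub (S.toFun (r n) a.val) a.val ξ η).symm).const_mul (-2)
  rw [mul_zero] at h1
  have h2 := (squeeze_zero (fun n => sq_nonneg _) (fun n => S.norm_preMap_sub_sq_le (r n) a) h1).sqrt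
  simpa [Real.sqrt_sq (norm_nonneg _)] using h2

theorem tendsto_mapL2 {r : ℕ → ℝ≥0} (hr : Tendsto r atTop (𝓝 0)) (x : L2 τ) :
    Tendsto (fun n => S.mapL2 (r n) x) atTop (𝓝 x) := by
  refine tendsto_completion_of_contraction (fun n x y => ?_) (fun a => ?_) x
  · rw [← mapL2_sub]
    exact S.norm_mapL2_le _ _
  · simp only [mapL2_coe]
    exact ((UniformSpace.Completion.continuous_coe _).tendsto a).comp (S.tendsto_preMap hr a)

theorem stronglyMeasurable_mapL2 (x : L2 τ) :
    StronglyMeasurable fun u : ℝ => S.mapL2 u.toNNReal x := by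
  refine stronglyMeasurable_of_tendsto atTop
    (fun n => stronglyMeasurable_comp_rightApprox (fun r => S.mapL2 r x) n)
    (tendsto_pi_nhds.2 fun u => ?_)
  have h1 : Tendsto (fun n => rightApprox n u - u.toNNReal) atTop (𝓝 0) := by
    simpa using (tendsto_rightApprox u).sub_const u.toNNReal
  refine (S.tendsto_mapL2 h1 (S.mapL2 u.toNNReal x)).congr fun n => ?_
  rw [← S.mapL2_add, tsub_add_cancel_of_le (le_rightApprox n u)]

theorem integrable_smul_mapL2 {k : ℝ → ℝ} (hk : Integrable k halfLine) (x : L2 τ) :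
    Integrable (fun u => k u • S.mapL2 u.toNNReal x) halfLine :=
  hk.smul_bdd (C := ‖x‖) (S.stronglyMeasurable_mapL2 x).aestronglyMeasurable
    (Eventually.of_forall fun _ => S.norm_mapL2_le _ x)

/-- The average `∫ k(u) T_u x du` on `L₂`. -/
def averageL2 : K1 →L[ℝ] L2 τ →L[ℝ] L2 τ :=
  LinearMap.mkContinuous₂
    (LinearMap.mk₂ ℝ (fun k x => ∫ u, k u • S.mapL2 u.toNNReal x ∂halfLine)
      (fun k l x => by
        rw [← integral_add (S.integrable_smul_mapL2 (L1.integrable_coeFn k) x)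
          (S.integrable_smul_mapL2 (L1.integrable_coeFn l) x)]
        refine integral_congr_ae ((Lp.coeFn_add k l).mono fun u hu => ?_)
        simp only [hu, Pi.add_apply, add_smul])
      (fun c k x => by
        rw [← integral_smul]
        refine integral_congr_ae ((Lp.coeFn_smul c k).mono fun u hu => ?_)
        simp only [hu, Pi.smul_apply, smul_assoc])
      (fun k x y => by
        rw [← integral_add (S.integrable_smul_mapL2 (L1.integrable_coeFn k) x)
          (S.integrable_smul_mapL2 (L1.integrable_coeFn k) y)]
        simp only [← mapL2ₗ_apply, map_add, smul_add])
      (fun c k x => by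
        rw [← integral_smul]
        simp only [← mapL2ₗ_apply, map_smul, smul_comm c])) 1
    (fun k x => by
      change ‖∫ u, k u • S.mapL2 u.toNNReal x ∂halfLine‖ ≤ 1 * ‖k‖ * ‖x‖
      rw [one_mul, L1.norm_eq_integral_norm, ← integral_mul_const]
      refine norm_integral_le_of_norm_le ((L1.integrable_coeFn k).norm.mul_const _)
        (Eventually.of_forall fun u => ?_)
      rw [norm_smul]
      exact mul_le_mul_of_nonneg_left (S.norm_mapL2_le _ x) (norm_nonneg _))

theorem averageL2_apply (k : K1) (x : L2 τ) :
    S.averageL2 k x = ∫ u, k u • S.mapL2 u.toNNReal x ∂halfLine := rfl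

theorem averageL2_mkL1 {f : ℝ → ℝ} (hf : Integrable f halfLine) (x : L2 τ) :
    S.averageL2 (mkL1 f) x = ∫ u, f u • S.mapL2 u.toNNReal x ∂halfLine :=
  integral_congr_ae ((coeFn_mkL1 hf).mono fun u hu => by simp only [hu])

theorem averageL2_poissonL1 {t : ℝ} (ht : 0 < t) (x : L2 τ) :
    S.averageL2 (poissonL1 t) x = S.poissonL2 t x :=
  S.averageL2_mkL1 (integrable_poissonKernel ht) x

theorem clm_averageL2 {W : Type*} [NormedAddCommGroup W] [NormedSpace ℝ W] [CompleteSpace W]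
    (L : L2 τ →L[ℝ] W) (k : K1) (x : L2 τ) :
    L (S.averageL2 k x) = ∫ u, k u • L (S.mapL2 u.toNNReal x) ∂halfLine := by
  rw [averageL2_apply,
    ← L.integral_comp_comm (S.integrable_smul_mapL2 (L1.integrable_coeFn k) x)]
  simp only [map_smul]

theorem clm_averageL2_mkL1 {W : Type*} [NormedAddCommGroup W] [NormedSpace ℝ W] [CompleteSpace W]
    (L : L2 τ →L[ℝ] W) {f : ℝ → ℝ} (hf : Integrable f halfLine) (x : L2 τ) :
    L (S.averageL2 (mkL1 f) x) = ∫ u, f u • L (S.mapL2 u.toNNReal x) ∂halfLine := by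
  rw [clm_averageL2]
  exact integral_congr_ae ((coeFn_mkL1 hf).mono fun u hu => by simp only [hu])

theorem mapL2_toNNReal_add {u v : ℝ} (hu : 0 ≤ u) (hv : 0 ≤ v) (x : L2 τ) :
    S.mapL2 (u + v).toNNReal x = S.mapL2 u.toNNReal (S.mapL2 v.toNNReal x) := by
  rw [Real.toNNReal_add hu hv, mapL2_add]

theorem mapL2_averageL2_poissonL1 {ε s : ℝ} (hε : 0 ≤ ε) (hs : 0 < s) (x : L2 τ) :
    S.mapL2 ε.toNNReal (S.averageL2 (poissonL1 s) x) =
      S.averageL2 (mkL1 (shiftedKernel s ε)) x := by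
  rw [averageL2_mkL1 S (integrable_shiftedKernel ε hs), integral_shiftedKernel_smul s hε,
    ← mapL2RCLM_apply, poissonL1, S.clm_averageL2_mkL1 _ (integrable_poissonKernel hs)]
  refine setIntegral_congr_fun measurableSet_Ioi fun u hu => ?_
  simp only [mapL2RCLM_apply]
  rw [add_comm u, S.mapL2_toNNReal_add hε (le_of_lt hu)]

theorem averageL2_averageL2_poissonL1 {s t : ℝ} (hs : 0 < s) (ht : 0 < t) (x : L2 τ) :
    S.averageL2 (poissonL1 s) (S.averageL2 (poissonL1 t) x) =
      S.averageL2 (poissonL1 (s + t)) x := by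
  rw [poissonL1, poissonL1, poissonL1, averageL2_mkL1 S (integrable_poissonKernel hs),
    averageL2_mkL1 S (integrable_poissonKernel (add_pos hs ht))]
  refine Eq.trans ?_ (integral_integral_poissonKernel hs ht
    (F := fun u => S.mapL2 u.toNNReal x) (M := ‖x‖)
    (S.stronglyMeasurable_mapL2 x).aestronglyMeasurable fun u _ => S.norm_mapL2_le _ x)
  refine setIntegral_congr_fun measurableSet_Ioi fun v hv => ?_
  rw [← mapL2RCLM_apply, S.clm_averageL2_mkL1 _ (integrable_poissonKernel ht)]
  congr 1
  refine setIntegral_congr_fun measurableSet_Ioi fun u hu => ?_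
  rw [S.mapL2_toNNReal_add (le_of_lt hv) (le_of_lt hu), mapL2RCLM_apply]

end StandardSemigroup

/-! ### The frame of a standard semigroup on `L₂` -/

namespace L2Pre

/-- The functional `x ↦ Re ⟨b*, x b*⟩`, that is `τ(b x b*)`. -/
def conjFunctional (b : L2Pre τ) : N →ₗ[ℝ] ℝ where
  toFun x := (⟪adj b, lmul x (adj b)⟫_ℂ).re
  map_add' x y := by
    have e : lmul (x + y) (adj b) = lmul x (adj b) + lmul y (adj b) :=
      val_injective (add_mul x y _)
    rw [e, inner_add_right, Complex.add_re]
  map_smul' c x := by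
    have e : lmul (c • x) (adj b) = (c : ℂ) • lmul x (adj b) :=
      val_injective (smul_mul_assoc (c : ℂ) x _)
    rw [e, inner_smul_right, Complex.re_ofReal_mul]
    rfl

theorem conjFunctional_apply (b : L2Pre τ) (x : N) :
    conjFunctional b x = (⟪adj b, lmul x (adj b)⟫_ℂ).re := rfl

theorem trace_conj_eq_conjFunctional (b : L2Pre τ) {x : N} (hx : 0 ≤ x) :
    τ.toFun (b.val * x * star b.val) = ENNReal.ofReal (conjFunctional b x) :=
  trace_conj_eq b hx

theorem conjFunctional_nonneg (b : L2Pre τ) {x : N} (hx : 0 ≤ x) : 0 ≤ conjFunctional b x := by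
  obtain ⟨d, hd, rfl⟩ := exists_sqrt hx
  have e : lmul (star d * d) (adj b) = lmul (star d) (lmul d (adj b)) :=
    val_injective (mul_assoc _ _ _)
  have e2 : (⟪lmul d (adj b), lmul d (adj b)⟫_ℂ).re = ‖lmul d (adj b)‖ ^ 2 :=
    inner_self_eq_norm_sq (𝕜 := ℂ) (lmul d (adj b))
  rw [conjFunctional_apply, e, ← re_inner_lmul, e2]
  positivity

theorem weaklyContinuous_conjFunctional (b : L2Pre τ) : WeaklyContinuous (conjFunctional b) where
  bound := by
    refine ⟨‖adj b‖ * ‖adj b‖, by positivity, fun x => ?_⟩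
    refine (Complex.abs_re_le_norm _).trans ((norm_inner_le_norm _ _).trans ?_)
    rw [mul_assoc, mul_comm _ ‖x‖]
    gcongr
    exact norm_lmul_le x _
  tendsto M x hM hw := by
    refine inner_tendsto_zero_of_weak (adj b) (x := fun n => lmul (x n) (adj b))
      (M := M * ‖(adj b).val‖) (R := M * ‖adj b‖) (fun n => ?_) (fun n => ?_) fun ξ η => ?_
    · exact (norm_mul_le (x n) (adj b).val).trans
        (mul_le_mul_of_nonneg_right (hM n) (norm_nonneg _))
    · exact (norm_lmul_le _ _).trans (mul_le_mul_of_nonneg_right (hM n) (norm_nonneg _))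
    · exact hw ξ (((adj b).val : H →L[ℂ] H) η)

end L2Pre

/-- Right multiplication by `d ∈ N` on `L₂`. -/
def rmulL2 (d : N) : L2 τ →L[ℂ] L2 τ :=
  ContinuousLinearMap.completion (LinearMap.mkContinuous
    { toFun := L2Pre.rmul d
      map_add' := fun a b => L2Pre.val_injective (add_mul a.val b.val d)
      map_smul' := fun c a => L2Pre.val_injective (smul_mul_assoc c a.val d) } ‖d‖
    (L2Pre.norm_rmul_le d))

theorem rmulL2_coe (d : N) (a : L2Pre τ) : rmulL2 d (a : L2 τ) = (L2Pre.rmul d a : L2 τ) :=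
  ContinuousLinearMap.completion_apply_coe _ a

theorem norm_rmulL2_le (d : N) (x : L2 τ) : ‖rmulL2 d x‖ ≤ ‖d‖ * ‖x‖ := by
  induction x using UniformSpace.Completion.induction_on with
  | hp =>
    exact isClosed_le (rmulL2 d).continuous.norm (continuous_const.mul continuous_norm)
  | ih a =>
    rw [rmulL2_coe, UniformSpace.Completion.norm_coe, UniformSpace.Completion.norm_coe]
    exact L2Pre.norm_rmul_le d a

/-- The form `(x, y) ↦ Re ⟨x d, y d⟩` on `L₂`. -/
def conjForm (d : N) : LinearMap.BilinForm ℝ (L2 τ) :=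
  LinearMap.mk₂ ℝ (fun x y => (⟪rmulL2 d x, rmulL2 d y⟫_ℂ).re)
    (fun x x' y => by rw [map_add, inner_add_left, Complex.add_re])
    (fun c x y => by
      change (⟪rmulL2 d ((c : ℂ) • x), rmulL2 d y⟫_ℂ).re = _
      rw [map_smul, inner_smul_left, Complex.conj_ofReal, Complex.re_ofReal_mul, smul_eq_mul])
    (fun x y y' => by rw [map_add, inner_add_right, Complex.add_re])
    (fun c x y => by
      change (⟪rmulL2 d x, rmulL2 d ((c : ℂ) • y)⟫_ℂ).re = _
      rw [map_smul, inner_smul_right, Complex.re_ofReal_mul, smul_eq_mul])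

theorem conjForm_apply (d : N) (x y : L2 τ) :
    conjForm d x y = (⟪rmulL2 d x, rmulL2 d y⟫_ℂ).re := rfl

theorem conjForm_self (d : N) (x : L2 τ) : conjForm d x x = ‖rmulL2 d x‖ ^ 2 :=
  inner_self_eq_norm_sq (𝕜 := ℂ) (rmulL2 d x)

theorem continuous_conjForm_self (d : N) : Continuous fun x : L2 τ => conjForm d x x := by
  simp only [conjForm_self]
  exact (rmulL2 d).continuous.norm.pow 2

theorem conjForm_symm (d : N) (x y : L2 τ) : conjForm d x y = conjForm d y x := by
  rw [conjForm_apply, conjForm_apply, ← inner_conj_symm, Complex.conj_re]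

theorem abs_conjForm_le (d : N) (x y : L2 τ) : |conjForm d x y| ≤ ‖d‖ ^ 2 * ‖x‖ * ‖y‖ := by
  refine (Complex.abs_re_le_norm _).trans ((norm_inner_le_norm _ _).trans ?_)
  calc ‖rmulL2 d x‖ * ‖rmulL2 d y‖ ≤ (‖d‖ * ‖x‖) * (‖d‖ * ‖y‖) := by
        gcongr <;> exact norm_rmulL2_le d _
    _ = _ := by ring

/-- The functional `y ↦ Re ⟨x d, y d⟩` on `L₂`. -/
def conjFormCLM (d : N) (x : L2 τ) : L2 τ →L[ℝ] ℝ :=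
  (conjForm d x).mkContinuous (‖d‖ ^ 2 * ‖x‖) (abs_conjForm_le d x)

theorem conjForm_polarization (d : N) (x y : L2 τ) :
    conjForm d x y = (conjForm d (x + y) (x + y) - conjForm d (x - y) (x - y)) / 4 := by
  simp only [map_add, map_sub, LinearMap.add_apply, LinearMap.sub_apply, conjForm_symm d y x]
  ring

/-! ### The dual quadratic forms of the semigroup on `L₂` -/

namespace StandardSemigroup

variable (S : StandardSemigroup τ)

/-- A square root of `T_t(b* b)`. -/
def sqrtMap (t : ℝ≥0) (b : N) : N :=
  (exists_sqrt (S.map_nonneg t (star_mul_self_nonneg' b))).choose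

theorem star_sqrtMap (t : ℝ≥0) (b : N) : star (S.sqrtMap t b) = S.sqrtMap t b :=
  (exists_sqrt (S.map_nonneg t (star_mul_self_nonneg' b))).choose_spec.1

theorem star_sqrtMap_mul_self (t : ℝ≥0) (b : N) :
    star (S.sqrtMap t b) * S.sqrtMap t b = S.toFun t (star b * b) :=
  (exists_sqrt (S.map_nonneg t (star_mul_self_nonneg' b))).choose_spec.2

theorem norm_sqrtMap_le (t : ℝ≥0) (b : N) : ‖S.sqrtMap t b‖ ≤ ‖b‖ := by
  refine (sq_le_sq₀ (norm_nonneg (S.sqrtMap t b)) (norm_nonneg b)).1 ?_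
  rw [← norm_star_mul_self', star_sqrtMap_mul_self, ← norm_star_mul_self']
  exact S.norm_map_le _ _

theorem trace_sqrtMap (t : ℝ≥0) (b : N) :
    τ.toFun (star (S.sqrtMap t b) * S.sqrtMap t b) = τ.toFun (star b * b) := by
  have h := S.symm t b 1
  simp only [star_one, one_mul, mul_one, S.unital] at h
  rw [star_sqrtMap_mul_self, h, ← τ.tracial]

/-- Symmetry moves `T_t` from `|a|²` to `b* b`: `τ(b T_t(a* a) b*) = τ(a T_t(b* b) a*) = ‖a T_t(b*
b)^{1/2}‖₂²`. The last expression makes sense for every element of `L₂` and depends continuously on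
it. -/
theorem ofReal_conjForm_coe (t : ℝ≥0) (b : N) (a : L2Pre τ) :
    ENNReal.ofReal (conjForm (S.sqrtMap t b) (a : L2 τ) a) =
      τ.toFun (b * S.toFun t (star a.val * a.val) * star b) := by
  rw [conjForm_self, rmulL2_coe, UniformSpace.Completion.norm_coe, L2Pre.ofReal_norm_sq,
    L2Pre.rmul_val, τ.tracial, S.symm, star_mul, ← star_sqrtMap_mul_self, star_sqrtMap]
  simp only [mul_assoc]

theorem conjForm_coe (t : ℝ≥0) (b a : L2Pre τ) :
    conjForm (S.sqrtMap t b.val) (a : L2 τ) a =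
      b.conjFunctional (S.toFun t (star a.val * a.val)) := by
  have h0 := S.map_nonneg t (star_mul_self_nonneg' a.val)
  have h := S.ofReal_conjForm_coe t b.val a
  rw [b.trace_conj_eq_conjFunctional h0] at h
  refine (ENNReal.ofReal_eq_ofReal_iff ?_ (b.conjFunctional_nonneg h0)).1 h
  rw [conjForm_self]
  positivity

/-- Measurability in `v` is not visible on the square roots. On the dense subspace `N ∩ L₂` the form
is a weakly continuous functional of `T_v |a|²`, and pointwise limits of measurable functions are
measurable. -/
theorem measurable_conjForm_self (b : L2Pre τ) (x : L2 τ) :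
    Measurable fun v : ℝ => conjForm (S.sqrtMap v.toNNReal b.val) x x := by
  obtain ⟨y, hy, hx⟩ := mem_closure_iff_seq_limit.1
    ((UniformSpace.Completion.denseRange_coe (α := L2Pre τ)).closure_range ▸ mem_univ x)
  choose a ha using hy
  refine measurable_of_tendsto_metrizable (fun n => ?_) (tendsto_pi_nhds.2 fun v =>
    ((continuous_conjForm_self (S.sqrtMap v.toNNReal b.val)).tendsto x).comp hx)
  simp only [Function.comp, ← ha, conjForm_coe]
  exact (S.stronglyMeasurable_of_weaklyContinuous b.weaklyContinuous_conjFunctional _).measurable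

theorem conjForm_mapL2_le (t r : ℝ≥0) (b : L2Pre τ) (x : L2 τ) :
    conjForm (S.sqrtMap t b.val) (S.mapL2 r x) (S.mapL2 r x) ≤
      conjForm (S.sqrtMap (t + r) b.val) x x := by
  induction x using UniformSpace.Completion.induction_on with
  | hp =>
    exact isClosed_le ((continuous_conjForm_self _).comp (S.mapL2CLM r).continuous)
      (continuous_conjForm_self _)
  | ih a =>
    rw [mapL2_coe, conjForm_coe, conjForm_coe, preMap_val, map_add_apply]
    have h := b.conjFunctional_nonneg (sub_nonneg.2 (S.map_mono t (S.kadison r a.val)))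
    rwa [map_sub, sub_nonneg] at h

/-- The frame of a standard semigroup on `L₂`, for the functional `h ↦ τ(b h b*)`. -/
def frameL2 (b : L2Pre τ) : Frame (L2 τ) where
  T u := S.mapL2ₗ u.toNNReal
  A := S.averageL2
  B v := conjForm (S.sqrtMap v.toNNReal b.val)
  K := ‖b.val‖ ^ 2
  K_nonneg := sq_nonneg _
  norm_T u x := S.norm_mapL2_le _ x
  T_add s t x hs ht := S.mapL2_toNNReal_add hs ht x
  symm v x y := conjForm_symm _ x y
  nonneg v x := by
    rw [conjForm_self]
    positivity
  bound v x y := by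
    refine (abs_conjForm_le _ x y).trans ?_
    gcongr
    exact S.norm_sqrtMap_le _ _
  measurable_B x y := by
    simp only [conjForm_polarization _ x y]
    exact ((S.measurable_conjForm_self b _).sub (S.measurable_conjForm_self b _)).div_const 4
  measurable_B_T v x y :=
    ((conjFormCLM (S.sqrtMap v.toNNReal b.val) y).continuous.comp_stronglyMeasurable
      (S.stronglyMeasurable_mapL2 x)).measurable
  B_T v u x hv hu := by
    rw [Real.toNNReal_add hv hu]
    exact S.conjForm_mapL2_le _ _ b x
  B_A v y k x := S.clm_averageL2 (conjFormCLM (S.sqrtMap v.toNNReal b.val) y) k x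
  T_A _ _ x hε hs := S.mapL2_averageL2_poissonL1 hε hs x
  A_A _ _ x hs ht := S.averageL2_averageL2_poissonL1 hs ht x

theorem frameL2_P {t : ℝ} (ht : 0 < t) (b : L2Pre τ) (g : L2 τ) :
    (S.frameL2 b).P t g = S.poissonL2 t g :=
  S.averageL2_poissonL1 ht g

theorem deriv_poissonL2 {s : ℝ} (hs : 0 < s) (b : L2Pre τ) (g : L2 τ) :
    deriv (fun r => S.poissonL2 r g) s = (S.frameL2 b).Q s g := by
  refine (((S.frameL2 b).hasDerivAt_P hs g).congr_of_eventuallyEq ?_).deriv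
  filter_upwards [Ioi_mem_nhds hs] with r hr
  exact (S.frameL2_P hr b g).symm

/-! ### The pairing -/

theorem _root_.SemigroupBMO.sqPairing_eq_ofReal {Φ : N → N} {b : N} {q : L2 τ → ℝ}
    (hq : Continuous q) (h : ∀ a : L2Pre τ,
      τ.toFun (b * Φ (star a.val * a.val) * star b) = ENNReal.ofReal (q a)) (g : L2 τ) :
    sqPairing Φ b g = ENNReal.ofReal (q g) := by
  refine UniformSpace.Completion.isDenseInducing_coe.extend_eq_of_tendsto ?_
  simp only [h]
  exact ((ENNReal.continuous_ofReal.comp hq).tendsto g).comp tendsto_comap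

theorem sqPairing_map (t : ℝ≥0) (b : N) (g : L2 τ) :
    sqPairing (fun a => S.toFun t a) b g = ENNReal.ofReal (conjForm (S.sqrtMap t b) g g) :=
  sqPairing_eq_ofReal (continuous_conjForm_self _)
    (fun a => (S.ofReal_conjForm_coe t b a).symm) g

/-- Two uses of symmetry transfer `T_r` to the test element: `b` is replaced by `T_r(b* b)^{1/2}`,
which has the same `‖·‖₂`. In `L₂` this plays the part of the contractivity of `T_r` in operator
norm. -/
theorem sqPairing_map_add (t r : ℝ≥0) (b : N) (g : L2 τ) :
    sqPairing (fun a => S.toFun (t + r) a) b g =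
      sqPairing (fun a => S.toFun t a) (S.sqrtMap r b) g := by
  unfold sqPairing
  congr 1
  funext a
  rw [S.symm, map_add_apply, ← star_sqrtMap_mul_self, ← S.symm]

/-- Both sides are extensions by continuity from `N ∩ L₂`, where `τ(b · b*)` passes through the weak
integral defining `P_t |a|²`. -/
theorem sqPairing_poisson {t : ℝ} (ht : 0 < t) (b : L2Pre τ) (g : L2 τ) :
    sqPairing (S.poisson t) b.val g =
      ENNReal.ofReal ((S.frameL2 b).C (poissonL1 t) g g) := by
  refine sqPairing_eq_ofReal (q := fun g => (S.frameL2 b).C (poissonL1 t) g g) (by fun_prop)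
    (fun a => ?_) g
  rw [b.trace_conj_eq_conjFunctional (S.poisson_nonneg ht a.val), ← S.average_poissonL1 ht,
    poissonL1, Frame.C_mkL1 _ (integrable_poissonKernel ht),
    S.apply_average_mkL1 b.weaklyContinuous_conjFunctional (integrable_poissonKernel ht)]
  congr 1
  refine integral_congr_ae (Eventually.of_forall fun u => ?_)
  exact congrArg (poissonKernel t u * ·) (S.conjForm_coe u.toNNReal b a).symm

/-! ### The two inequalities for elements of `L₂` -/

theorem _root_.SemigroupBMO.le_ofReal_sq_of_rpow_half_le {X : ℝ≥0∞} {M : ℝ} (hM : 0 ≤ M)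
    (h : X ^ (1 / 2 : ℝ) ≤ ENNReal.ofReal M) : X ≤ ENNReal.ofReal (M ^ 2) := by
  rw [ENNReal.ofReal_pow hM]
  calc X = (X ^ (1 / 2 : ℝ)) ^ 2 := by
        rw [← ENNReal.rpow_natCast, ← ENNReal.rpow_mul]
        norm_num
    _ ≤ _ := by gcongr

theorem bmoPartialL2_le (g : L2 τ) : S.bmoPartialL2 g ≤ ENNReal.ofReal 250 * S.bmoPL2 g := by
  by_cases htop : S.bmoPL2 g = ∞
  · rw [htop, ENNReal.mul_top (by simp)]
    exact le_top
  set M := (S.bmoPL2 g).toReal with hM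
  have hM0 : 0 ≤ M := ENNReal.toReal_nonneg
  have hMe : S.bmoPL2 g = ENNReal.ofReal M := (ENNReal.ofReal_toReal htop).symm
  have hsup : ∀ t, 0 < t → ∀ b : N, τ.toFun (star b * b) ≤ 1 →
      sqPairing (S.poisson t) b (g - S.poissonL2 t g) ≤ ENNReal.ofReal (M ^ 2) := by
    intro t ht b hb
    refine (le_iSup₂ (f := fun (b : N) (_ : τ.toFun (star b * b) ≤ 1) =>
      sqPairing (S.poisson t) b (g - S.poissonL2 t g)) b hb).trans
      (le_ofReal_sq_of_rpow_half_le hM0 ?_)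
    rw [← hMe]
    exact le_iSup₂ (f := fun t (_ : 0 < t) => (⨆ (b : N) (_ : τ.toFun (star b * b) ≤ 1),
      sqPairing (S.poisson t) b (g - S.poissonL2 t g)) ^ (1 / 2 : ℝ)) t ht
  rw [hMe]
  refine iSup₂_le fun t ht => ?_
  refine le_trans (ENNReal.rpow_le_rpow (iSup₂_le fun b hb => ?_) (by norm_num))
    (ofReal_rpow_half_le (x := 62000 * M ^ 2) (by norm_num) hM0 (by nlinarith [sq_nonneg M]))
  let β : L2Pre τ := L2Pre.mk b (hb.trans_lt ENNReal.one_lt_top)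
  refine le_trans (le_of_eq ?_) ((S.frameL2 β).lintegral_C_Q_le (f := g) hM0 (fun r hr => ?_) ht)
  · refine setLIntegral_congr_fun measurableSet_Ioo fun s hs => ?_
    have h := S.sqPairing_poisson ht β (deriv (fun r => S.poissonL2 r g) s)
    rw [S.deriv_poissonL2 hs.1 β] at h ⊢
    rw [ENNReal.ofReal_mul hs.1.le, ← h]
    rfl
  · have h := hsup r hr b hb
    rw [S.frameL2_P hr, ← ENNReal.ofReal_le_ofReal_iff (sq_nonneg M)]
    rwa [← S.sqPairing_poisson hr β]

theorem bmoPL2_le (g : L2 τ) :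
    S.bmoPL2 g ≤ ENNReal.ofReal (√Frame.momentConst + 1) * S.bmoTL2 g := by
  have hc0 : 0 < √Frame.momentConst + 1 := by positivity
  by_cases htop : S.bmoTL2 g = ∞
  · rw [htop, ENNReal.mul_top (by simpa using hc0)]
    exact le_top
  set M := (S.bmoTL2 g).toReal with hM
  have hM0 : 0 ≤ M := ENNReal.toReal_nonneg
  have hMe : S.bmoTL2 g = ENNReal.ofReal M := (ENNReal.ofReal_toReal htop).symm
  have hsup : ∀ t : ℝ, 0 < t → ∀ b : N, τ.toFun (star b * b) ≤ 1 →
      sqPairing (fun a => S.toFun t.toNNReal a) b (g - S.mapL2 t.toNNReal g) ≤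
        ENNReal.ofReal (M ^ 2) := by
    intro t ht b hb
    refine (le_iSup₂ (f := fun (b : N) (_ : τ.toFun (star b * b) ≤ 1) =>
      sqPairing (fun a => S.toFun t.toNNReal a) b (g - S.mapL2 t.toNNReal g)) b hb).trans
      (le_ofReal_sq_of_rpow_half_le hM0 ?_)
    rw [← hMe]
    exact le_iSup₂ (f := fun (t : ℝ) (_ : 0 < t) => (⨆ (b : N) (_ : τ.toFun (star b * b) ≤ 1),
      sqPairing (fun a => S.toFun t.toNNReal a) b (g - S.mapL2 t.toNNReal g)) ^ (1 / 2 : ℝ)) t ht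
  rw [hMe]
  refine iSup₂_le fun t ht => ?_
  refine le_trans (ENNReal.rpow_le_rpow (iSup₂_le fun b hb => ?_) (by norm_num))
    (ofReal_rpow_half_le (x := Frame.momentConst * M ^ 2) hc0.le hM0 ?_)
  · let β : L2Pre τ := L2Pre.mk b (hb.trans_lt ENNReal.one_lt_top)
    have h := (S.frameL2 β).C_sub_P_le (f := g) hM0 (fun u v hu huv => ?_) ht
    · rw [S.frameL2_P ht] at h
      exact (S.sqPairing_poisson ht β _).trans_le (ENNReal.ofReal_le_ofReal h)
    · rw [← ENNReal.ofReal_le_ofReal_iff (sq_nonneg M)]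
      -- The modified test element is still admissible, because `T_{v-u}` preserves the trace of `b*
      -- b`; it converts the hypothesis at time `u` into the bound at time `v`.
      have h1 := hsup u hu (S.sqrtMap (v - u).toNNReal b) (by rwa [S.trace_sqrtMap])
      rw [← S.sqPairing_map_add, ← Real.toNNReal_add hu.le (sub_nonneg.2 huv),
        add_sub_cancel, S.sqPairing_map] at h1
      exact h1
  · rw [mul_pow]
    refine mul_le_mul_of_nonneg_right ?_ (sq_nonneg _)
    have h2 := Real.sqrt_nonneg Frame.momentConst
    rcases le_total 0 Frame.momentConst with h3 | h3
    · nlinarith [Real.sq_sqrt h3]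
    · nlinarith

end StandardSemigroup

end SemigroupBMO

end

/-! ### The two inequalities with one absolute constant -/

theorem mainTheorem8 :
    ∃ C : ℝ≥0, ∀ (H : Type*) [NormedAddCommGroup H] [InnerProductSpace ℂ H] [CompleteSpace H]
      (N : VonNeumannAlgebra H) (τ : SemigroupBMO.NSFTrace N)
      (S : SemigroupBMO.StandardSemigroup τ),
      (∀ f : N, S.bmoPartial f ≤ C * S.bmoP f ∧ S.bmoP f ≤ C * S.bmoT f) ∧
      (∀ g : SemigroupBMO.L2 τ,
        S.bmoPartialL2 g ≤ C * S.bmoPL2 g ∧ S.bmoPL2 g ≤ C * S.bmoTL2 g) := by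
  have h1 : ENNReal.ofReal 250 ≤
      ENNReal.ofReal (max 250 (√SemigroupBMO.Frame.momentConst + 1)) :=
    ENNReal.ofReal_le_ofReal (le_max_left _ _)
  have h2 : ENNReal.ofReal (√SemigroupBMO.Frame.momentConst + 1) ≤
      ENNReal.ofReal (max 250 (√SemigroupBMO.Frame.momentConst + 1)) :=
    ENNReal.ofReal_le_ofReal (le_max_right _ _)
  refine ⟨(max 250 (√SemigroupBMO.Frame.momentConst + 1)).toNNReal, ?_⟩
  intro H _ _ _ N τ S
  exact ⟨fun f => ⟨(S.bmoPartial_le f).trans (mul_le_mul_left h1 _),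
      (S.bmoP_le f).trans (mul_le_mul_left h2 _)⟩,
    fun g => ⟨(S.bmoPartialL2_le g).trans (mul_le_mul_left h1 _),
      (S.bmoPL2_le g).trans (mul_le_mul_left h2 _)⟩⟩
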